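/- Let $n\ge 2$, let $M$ be a connected orientable PL $n$-manifold (Hausdorff, possibly with boundary), and let $K\subset M$ be a nonempty closed subset that is an $(n-2)$-dimensional PL submanifold of $M$ (possibly with boundary, not assumed to be locally flat). Fix an orientation of $M$ and let $\mathrm{PL}_+(M,K)$ be the group of all orientation-preserving PL self-homeomorphisms of $M$ that fix $K$ pointwise. Then $\mathrm{PL}_+(M,K)$ is circularly orderable. Here a map is PL if locally its domain is a union of finitely many closed convex polyhedra on each of which the map is affine in charts; a PL manifold is a manifold given by an atlas with PL coordinate changes; an orientation of a PL manifold is an atlas of charts of its PL structure whose coordinate changes have positive Jacobian determinant wherever they are affine; and a subset $K$ is a $k$-dimensional PL submanifold if every point of $K$ has a neighbourhood in $K$ that is the image of an open subset of a $k$-dimensional Euclidean half-space under a PL topological embedding. A group $G$ is circularly orderable if there is a function $e:G^3\to\{-1,0,1\}$ such that $e(a,b,c)\ne 0$ exactly when $a,b,c$ are pairwise distinct, $e(b,c,d)-e(a,c,d)+e(a,b,d)-e(a,b,c)=0$ for all $a,b,c,d\in G$, and $e(ga,gb,gc)=e(a,b,c)$ for all $g,a,b,c\in G$. -/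

import Mathlib

open Set Filter Topology
open scoped Manifold

/-! ### Circularly orderable groups -/

/-- A left-invariant circular order on `G`, extended by `0` to the triples that are not distinct:
`e` is `±1` on the triples of distinct elements and `0` on all others, satisfies the cocycle
condition on all quadruples, and is invariant under left multiplication. -/
structure IsLeftCircularOrder {G : Type*} [Group G] (e : G → G → G → ℤ) : Prop where
  eq_one_or_neg_one : ∀ a b c : G, a ≠ b → b ≠ c → a ≠ c → e a b c = 1 ∨ e a b c = -1
  eq_zero : ∀ a b c : G, (a = b ∨ b = c ∨ a = c) → e a b c = 0
  cocycle : ∀ a b c d : G, e b c d - e a c d + e a b d - e a b c = 0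
  left_invariant : ∀ g a b c : G, e (g * a) (g * b) (g * c) = e a b c

/-- A group is circularly orderable if it admits a left-invariant circular order. -/
def CircularlyOrderable (G : Type*) [Group G] : Prop :=
  ∃ e : G → G → G → ℤ, IsLeftCircularOrder e

/-! ### Piecewise linear maps between subsets of Euclidean spaces -/

section PLMaps

variable {E F F' : Type*} [NormedAddCommGroup E] [NormedSpace ℝ E]
  [NormedAddCommGroup F] [NormedSpace ℝ F] [NormedAddCommGroup F'] [NormedSpace ℝ F']

/-- A closed convex polyhedron: an intersection of finitely many closed half-spaces. -/
def IsConvexPolyhedron (P : Set E) : Prop :=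
  ∃ L : Set (E →ᵃ[ℝ] ℝ), L.Finite ∧ P = {x | ∀ l ∈ L, 0 ≤ l x}

/-- `f` is piecewise linear on `S`: it is continuous on `S`, and every point of `S` has a
neighbourhood in `S` that is covered by finitely many closed convex polyhedra such that `f` is
affine on the part of each of them that lies in this neighbourhood. A member `(P, A)` of `Q` is
a polyhedron `P` together with an affine map `A` that agrees with `f` there. -/
def IsPLOn (f : E → F) (S : Set E) : Prop :=
  ContinuousOn f S ∧ ∀ x ∈ S, ∃ Q : Set (Set E × (E →ᵃ[ℝ] F)), Q.Finite ∧
    (∀ q ∈ Q, IsConvexPolyhedron q.1) ∧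
    ∀ᶠ y in 𝓝[S] x, (∃ q ∈ Q, y ∈ q.1) ∧ ∀ q ∈ Q, y ∈ q.1 → f y = q.2 y

/-- `f` preserves orientation on `S`: whenever `f` is affine on a nonempty open subset of `S`, its
linear part there has positive determinant. For a piecewise linear homeomorphism `f` the open sets
on which it is affine are dense in the interior of `S`. -/
def PreservesOrientationOn (f : E → E) (S : Set E) : Prop :=
  ∀ W : Set E, IsOpen W → W.Nonempty → W ⊆ S →
    ∀ A : E →ᵃ[ℝ] E, EqOn f A W → 0 < LinearMap.det A.linear

theorem IsConvexPolyhedron.univ : IsConvexPolyhedron (univ : Set E) :=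
  ⟨∅, finite_empty, by simp⟩

theorem IsConvexPolyhedron.inter {P P' : Set E} (h : IsConvexPolyhedron P)
    (h' : IsConvexPolyhedron P') : IsConvexPolyhedron (P ∩ P') := by
  obtain ⟨L, hL, rfl⟩ := h
  obtain ⟨L', hL', rfl⟩ := h'
  refine ⟨L ∪ L', hL.union hL', ?_⟩
  ext x
  simp only [mem_inter_iff, mem_ofPred_eq, mem_union]
  constructor
  · rintro ⟨h1, h2⟩ l (hl | hl)
    exacts [h1 l hl, h2 l hl]
  · exact fun h => ⟨fun l hl => h l (Or.inl hl), fun l hl => h l (Or.inr hl)⟩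

theorem IsConvexPolyhedron.preimage {P : Set F} (h : IsConvexPolyhedron P) (A : E →ᵃ[ℝ] F) :
    IsConvexPolyhedron (A ⁻¹' P) := by
  obtain ⟨L, hL, rfl⟩ := h
  refine ⟨(fun l => l.comp A) '' L, hL.image _, ?_⟩
  ext x
  simp

theorem IsConvexPolyhedron.isClosed [FiniteDimensional ℝ E] {P : Set E}
    (h : IsConvexPolyhedron P) : IsClosed P := by
  obtain ⟨L, -, rfl⟩ := h
  simp only [ofPred_forall]
  exact isClosed_iInter fun l => isClosed_iInter fun _ =>
    isClosed_le continuous_const l.continuous_of_finiteDimensional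

theorem IsPLOn.mono {f : E → F} {S T : Set E} (h : IsPLOn f S) (hT : T ⊆ S) : IsPLOn f T := by
  refine ⟨h.1.mono hT, fun x hx => ?_⟩
  obtain ⟨Q, hQ, hP, hy⟩ := h.2 x (hT hx)
  exact ⟨Q, hQ, hP, hy.filter_mono (nhdsWithin_mono x hT)⟩

theorem IsPLOn.congr {f g : E → F} {S : Set E} (h : IsPLOn f S) (hg : EqOn g f S) :
    IsPLOn g S := by
  refine ⟨h.1.congr hg, fun x hx => ?_⟩
  obtain ⟨Q, hQ, hP, hy⟩ := h.2 x hx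
  refine ⟨Q, hQ, hP, ?_⟩
  filter_upwards [hy, self_mem_nhdsWithin] with y hy hyS
  exact ⟨hy.1, fun q hq hyq => (hg hyS).trans (hy.2 q hq hyq)⟩

theorem isPLOn_id (S : Set E) : IsPLOn (id : E → E) S := by
  refine ⟨continuousOn_id, fun x _ => ⟨{(univ, AffineMap.id ℝ E)}, finite_singleton _, ?_, ?_⟩⟩
  · rintro q rfl
    exact IsConvexPolyhedron.univ
  · refine Eventually.of_forall fun y => ⟨⟨_, rfl, mem_univ _⟩, ?_⟩
    rintro q rfl -
    rfl

theorem IsPLOn.comp {f : E → F} {g : F → F'} {S : Set E} {T : Set F} (hg : IsPLOn g T)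
    (hf : IsPLOn f S) (hST : MapsTo f S T) : IsPLOn (g ∘ f) S := by
  refine ⟨hg.1.comp hf.1 hST, fun x hx => ?_⟩
  obtain ⟨Q, hQ, hP, hy⟩ := hf.2 x hx
  obtain ⟨R, hR, hP', hz⟩ := hg.2 (f x) (hST hx)
  refine ⟨(fun r : (Set E × (E →ᵃ[ℝ] F)) × (Set F × (F →ᵃ[ℝ] F')) =>
    (r.1.1 ∩ r.1.2 ⁻¹' r.2.1, r.2.2.comp r.1.2)) '' (Q ×ˢ R), (hQ.prod hR).image _, ?_, ?_⟩
  · rintro _ ⟨⟨q, r⟩, ⟨hq, hr⟩, rfl⟩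
    exact (hP q hq).inter ((hP' r hr).preimage q.2)
  · have ht : Tendsto f (𝓝[S] x) (𝓝[T] (f x)) :=
      tendsto_nhdsWithin_of_tendsto_nhds_of_eventually_within _ (hf.1 x hx)
        (eventually_nhdsWithin_of_forall hST)
    filter_upwards [hy, ht.eventually hz] with y hy hz
    constructor
    · obtain ⟨q, hq, hyq⟩ := hy.1
      obtain ⟨r, hr, hzr⟩ := hz.1
      refine ⟨_, ⟨(q, r), ⟨hq, hr⟩, rfl⟩, hyq, ?_⟩
      rw [mem_preimage, ← hy.2 q hq hyq]
      exact hzr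
    · rintro _ ⟨⟨q, r⟩, ⟨hq, hr⟩, rfl⟩ ⟨hyq, hyr⟩
      have e := hy.2 q hq hyq
      simp only [mem_preimage, ← e] at hyr
      simp only [Function.comp_apply, AffineMap.comp_apply, ← e]
      exact hz.2 r hr hyr

theorem IsPLOn.of_locally {f : E → F} {S : Set E}
    (h : ∀ x ∈ S, ∃ V, IsOpen V ∧ x ∈ V ∧ IsPLOn f (S ∩ V)) : IsPLOn f S := by
  have key : ∀ x V, IsOpen V → x ∈ V → 𝓝[S ∩ V] x = 𝓝[S] x := fun x V hV hx =>
    nhdsWithin_inter_of_mem' (mem_nhdsWithin_of_mem_nhds (hV.mem_nhds hx))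
  refine ⟨fun x hx => ?_, fun x hx => ?_⟩
  · obtain ⟨V, hV, hxV, hf⟩ := h x hx
    have := hf.1 x ⟨hx, hxV⟩
    rwa [ContinuousWithinAt, key x V hV hxV] at this
  · obtain ⟨V, hV, hxV, hf⟩ := h x hx
    have := hf.2 x ⟨hx, hxV⟩
    rwa [key x V hV hxV] at this

/-- A piecewise linear map is affine on some nonempty open subset of any nonempty open set. -/
theorem IsPLOn.exists_affine [FiniteDimensional ℝ E] {f : E → F} {W : Set E} (hf : IsPLOn f W)
    (hW : IsOpen W) (hne : W.Nonempty) :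
    ∃ W' ⊆ W, IsOpen W' ∧ W'.Nonempty ∧ ∃ A : E →ᵃ[ℝ] F, EqOn f A W' := by
  obtain ⟨x, hx⟩ := hne
  obtain ⟨Q, hQ, hP, hy⟩ := hf.2 x hx
  rw [hW.nhdsWithin_eq hx] at hy
  obtain ⟨U, hU, hUo, hxU⟩ := eventually_nhds_iff.1 hy
  have : ∃ q ∈ Q, (interior q.1 ∩ (U ∩ W)).Nonempty := by
    by_contra hcon
    push Not at hcon
    have : ∀ Q' : Set (Set E × (E →ᵃ[ℝ] F)), Q'.Finite → Q' ⊆ Q →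
        ∃ V ⊆ U ∩ W, IsOpen V ∧ V.Nonempty ∧ ∀ q ∈ Q', Disjoint V q.1 := by
      intro Q' hQ'
      induction Q', hQ' using Set.Finite.induction_on with
      | empty => exact fun _ => ⟨U ∩ W, subset_rfl, hUo.inter hW, ⟨x, hxU, hx⟩, by simp⟩
      | @insert q s _ _ ih =>
        intro hs
        obtain ⟨V, hV, hVo, hVne, hd⟩ := ih ((subset_insert _ _).trans hs)
        have hq : q ∈ Q := hs (mem_insert _ _)
        refine ⟨V \ q.1, sdiff_subset.trans hV, hVo.sdiff (hP q hq).isClosed, ?_, ?_⟩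
        · rw [nonempty_iff_ne_empty, Ne, sdiff_eq_empty]
          intro hVq
          obtain ⟨z, hz⟩ := hVne
          have : z ∈ interior q.1 ∩ (U ∩ W) := ⟨interior_maximal hVq hVo hz, hV hz⟩
          rw [hcon q hq] at this
          exact this
        · rintro r (rfl | hr)
          · exact disjoint_sdiff_left
          · exact (hd r hr).mono_left sdiff_subset
    obtain ⟨V, hV, -, ⟨z, hz⟩, hd⟩ := this Q hQ subset_rfl
    obtain ⟨q, hq, hzq⟩ := (hU z (hV hz).1).1
    exact disjoint_left.1 (hd q hq) hz hzq
  obtain ⟨q, hq, hne⟩ := this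
  exact ⟨interior q.1 ∩ (U ∩ W), fun y hy => hy.2.2, isOpen_interior.inter (hUo.inter hW), hne,
    q.2, fun y hy => (hU y hy.2.1).2 q hq (interior_subset hy.1)⟩

theorem AffineMap.eq_of_eqOn_isOpen {A B : E →ᵃ[ℝ] F} {W : Set E} (hW : IsOpen W)
    (hne : W.Nonempty) (h : EqOn A B W) : A = B :=
  AffineMap.ext_on (hW.affineSpan_eq_top hne) h

theorem PreservesOrientationOn.comp [FiniteDimensional ℝ E] {f g : E → E} {S T : Set E}
    (hg : PreservesOrientationOn g T) (hgP : IsPLOn g T) (hf : PreservesOrientationOn f S)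
    (hfP : IsPLOn f S) (hST : MapsTo f S T) : PreservesOrientationOn (g ∘ f) S := by
  intro W hW hne hWS C hC
  obtain ⟨W₁, hW₁, hW₁o, hW₁ne, A, hA⟩ := (hfP.mono hWS).exists_affine hW hne
  have hdA := hf W₁ hW₁o hW₁ne (hW₁.trans hWS) A hA
  have hAsurj : Function.Surjective A := by
    rw [← AffineMap.linear_surjective_iff]
    exact (LinearMap.equivOfDetNeZero A.linear hdA.ne').surjective
  have hAopen : IsOpen (A '' W₁) := by
    have := (AffineMap.isOpenMap_linear_iff (f := A)).1
      (LinearMap.isOpenMap_of_finiteDimensional A.linear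
        ((AffineMap.linear_surjective_iff A).2 hAsurj))
    exact this _ hW₁o
  have hAT : A '' W₁ ⊆ T := by
    rintro _ ⟨y, hy, rfl⟩
    rw [← hA hy]
    exact hST (hWS (hW₁ hy))
  obtain ⟨W₂, hW₂, hW₂o, ⟨_, hz⟩, B, hB⟩ :=
    (hgP.mono hAT).exists_affine hAopen (hW₁ne.image A)
  obtain ⟨y, hy, rfl⟩ := hW₂ hz
  have hdB := hg W₂ hW₂o ⟨_, hz⟩ (hW₂.trans hAT) B hB
  have hCBA : C = B.comp A := by
    refine AffineMap.eq_of_eqOn_isOpen (W := W₁ ∩ A ⁻¹' W₂)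
      (hW₁o.inter (hW₂o.preimage A.continuous_of_finiteDimensional)) ⟨y, hy, hz⟩ ?_
    rintro w ⟨hw, hw'⟩
    rw [← hC (hW₁ hw), AffineMap.comp_apply, ← hB hw', Function.comp_apply, hA hw]
  have hlin : C.linear = B.linear ∘ₗ A.linear := by rw [hCBA]; rfl
  rw [hlin, LinearMap.det_comp]
  exact mul_pos hdB hdA

end PLMaps

/-! ### The groupoids of piecewise linear homeomorphisms -/

section Groupoids

variable {E H : Type*} [NormedAddCommGroup E] [NormedSpace ℝ E] [TopologicalSpace H]
  (I : ModelWithCorners ℝ E H)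

/-- The maps of the model space that are piecewise linear when read in `E`. -/
def plPregroupoid : Pregroupoid H where
  property f s := IsPLOn (I ∘ f ∘ I.symm) (I.symm ⁻¹' s ∩ range I)
  comp {f g u v} hf hg _ _ _ := by
    have e : I ∘ (g ∘ f) ∘ I.symm = (I ∘ g ∘ I.symm) ∘ (I ∘ f ∘ I.symm) := by ext x; simp
    rw [e]
    refine hg.comp (hf.mono fun x hx => ⟨hx.1.1, hx.2⟩) ?_
    rintro x ⟨hx, -⟩
    exact ⟨by simpa using hx.2, mem_range_self _⟩
  id_mem := by
    refine (isPLOn_id _).congr ?_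
    rintro _ ⟨-, y, rfl⟩
    simp
  locality {f u} _ h := by
    refine IsPLOn.of_locally ?_
    rintro _ ⟨hx, y, rfl⟩
    obtain ⟨v, hv, hyv, hf⟩ := h y (by simpa using hx)
    refine ⟨I.symm ⁻¹' v, hv.preimage I.continuous_symm, by simpa using hyv, hf.mono ?_⟩
    exact fun z hz => ⟨⟨hz.1.1, hz.2⟩, hz.1.2⟩
  congr {f g u} _ h hf := by
    refine hf.congr ?_
    rintro x ⟨hx, -⟩
    simp [h _ hx]

/-- The maps of the model space that are piecewise linear and orientation preserving when read
in `E`. -/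
def plOrientedPregroupoid [FiniteDimensional ℝ E] : Pregroupoid H where
  property f s := IsPLOn (I ∘ f ∘ I.symm) (I.symm ⁻¹' s ∩ range I) ∧
    PreservesOrientationOn (I ∘ f ∘ I.symm) (I.symm ⁻¹' s ∩ range I)
  comp {f g u v} hf hg hu hv huv := by
    refine ⟨(plPregroupoid I).comp hf.1 hg.1 hu hv huv, ?_⟩
    have e : I ∘ (g ∘ f) ∘ I.symm = (I ∘ g ∘ I.symm) ∘ (I ∘ f ∘ I.symm) := by ext x; simp
    have hs : I.symm ⁻¹' (u ∩ f ⁻¹' v) ∩ range I ⊆ I.symm ⁻¹' u ∩ range I :=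
      fun x hx => ⟨hx.1.1, hx.2⟩
    rw [e]
    refine hg.2.comp hg.1 (fun W hW hne hWS => hf.2 W hW hne (hWS.trans hs)) (hf.1.mono hs) ?_
    rintro x ⟨hx, -⟩
    exact ⟨by simpa using hx.2, mem_range_self _⟩
  id_mem := by
    refine ⟨(plPregroupoid I).id_mem, fun W hW hne hWS A hA => ?_⟩
    have : A = AffineMap.id ℝ E := by
      refine AffineMap.eq_of_eqOn_isOpen hW hne fun y hy => ?_
      rw [← hA hy]
      obtain ⟨z, rfl⟩ := (hWS hy).2
      simp
    simp [this]
  locality {f u} hu h := by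
    refine ⟨(plPregroupoid I).locality hu fun x hx => ?_, fun W hW hne hWS A hA => ?_⟩
    · obtain ⟨v, hv, hxv, hf⟩ := h x hx
      exact ⟨v, hv, hxv, hf.1⟩
    · obtain ⟨y, hy⟩ := hne
      obtain ⟨v, hv, hyv, hf⟩ := h (I.symm y) (hWS hy).1
      exact hf.2 (W ∩ I.symm ⁻¹' v) (hW.inter (hv.preimage I.continuous_symm)) ⟨y, hy, hyv⟩
        (fun z hz => ⟨⟨(hWS hz.1).1, hz.2⟩, (hWS hz.1).2⟩) A (hA.mono inter_subset_left)
  congr {f g u} hu h hf := by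
    refine ⟨(plPregroupoid I).congr hu h hf.1, fun W hW hne hWS A hA => ?_⟩
    refine hf.2 W hW hne hWS A fun y hy => ?_
    rw [← hA hy]
    simp [h _ (hWS hy).1]

/-- The groupoid of piecewise linear homeomorphisms between open subsets of the model space. -/
def plGroupoid : StructureGroupoid H := (plPregroupoid I).groupoid

/-- The groupoid of orientation-preserving piecewise linear homeomorphisms between open subsets of
the model space. -/
def plOrientedGroupoid [FiniteDimensional ℝ E] : StructureGroupoid H :=
  (plOrientedPregroupoid I).groupoid

end Groupoids

/-! ### Piecewise linear manifolds

A PL `n`-manifold, possibly with boundary, is a charted space over the Euclidean half-space of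
dimension `n` all of whose coordinate changes are piecewise linear homeomorphisms. -/

/-- `M` is a PL `n`-manifold, possibly with boundary. -/
abbrev IsPLManifold (n : ℕ) [NeZero n] (M : Type*) [TopologicalSpace M]
    [ChartedSpace (EuclideanHalfSpace n) M] : Prop :=
  HasGroupoid M (plGroupoid (𝓡∂ n))

/-- An orientation of a PL manifold, given by an oriented atlas: charts of the PL structure of `M`
that cover `M` and whose coordinate changes preserve orientation. -/
structure PLOrientation (n : ℕ) [NeZero n] (M : Type*) [TopologicalSpace M]
    [ChartedSpace (EuclideanHalfSpace n) M] where
  charts : Set (OpenPartialHomeomorph M (EuclideanHalfSpace n))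
  subset_maximalAtlas : charts ⊆ (plGroupoid (𝓡∂ n)).maximalAtlas M
  cover : ∀ x : M, ∃ c ∈ charts, x ∈ c.source
  compatible : ∀ c ∈ charts, ∀ c' ∈ charts, c.symm ≫ₕ c' ∈ plOrientedGroupoid (𝓡∂ n)

section Homeomorphisms

variable {n : ℕ} [NeZero n] {M : Type*} [TopologicalSpace M]
  [ChartedSpace (EuclideanHalfSpace n) M]

/-- A self-homeomorphism of `M` is PL if it and its inverse are piecewise linear in all charts. -/
def IsPLHomeo (n : ℕ) [NeZero n] {M : Type*} [TopologicalSpace M]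
    [ChartedSpace (EuclideanHalfSpace n) M] (g : M ≃ₜ M) : Prop :=
  ∀ c ∈ atlas (EuclideanHalfSpace n) M, ∀ c' ∈ atlas (EuclideanHalfSpace n) M,
    c.symm ≫ₕ g.toOpenPartialHomeomorph ≫ₕ c' ∈ plGroupoid (𝓡∂ n)

/-- A self-homeomorphism of `M` preserves the orientation `o` if it does so in all charts of the
oriented atlas. -/
def PLOrientation.Preserves (o : PLOrientation n M) (g : M ≃ₜ M) : Prop :=
  ∀ c ∈ o.charts, ∀ c' ∈ o.charts,
    c.symm ≫ₕ g.toOpenPartialHomeomorph ≫ₕ c' ∈ plOrientedGroupoid (𝓡∂ n)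

/-- Self-homeomorphisms that lie in a groupoid when read in an atlas are stable under
composition, contain the identity and are stable under inverses. -/
theorem structomorph_closure {H : Type*} [TopologicalSpace H] (G : StructureGroupoid H)
    (a : ChartedSpace H M) [HasGroupoid M G] :
    let p : (M ≃ₜ M) → Prop := fun g => ∀ c ∈ atlas H M, ∀ c' ∈ atlas H M,
      c.symm ≫ₕ g.toOpenPartialHomeomorph ≫ₕ c' ∈ G
    p 1 ∧ (∀ g g', p g → p g' → p (g * g')) ∧ ∀ g, p g → p g⁻¹ := by
  intro p
  refine ⟨fun c hc c' hc' => (Structomorph.refl (G := G) M).mem_groupoid c c' hc hc', ?_, ?_⟩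
  · intro g g' hg hg' c hc c' hc'
    exact (Structomorph.trans (G := G)
      ⟨g', fun c c' hc hc' => hg' c hc c' hc'⟩
      ⟨g, fun c c' hc hc' => hg c hc c' hc'⟩).mem_groupoid c c' hc hc'
  · intro g hg c hc c' hc'
    exact (Structomorph.symm (G := G)
      ⟨g, fun c c' hc hc' => hg c hc c' hc'⟩).mem_groupoid c c' hc hc'

theorem isPLHomeo_closure [IsPLManifold n M] :
    IsPLHomeo n (1 : M ≃ₜ M) ∧
      (∀ g g' : M ≃ₜ M, IsPLHomeo n g → IsPLHomeo n g' → IsPLHomeo n (g * g')) ∧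
      ∀ g : M ≃ₜ M, IsPLHomeo n g → IsPLHomeo n g⁻¹ :=
  structomorph_closure (plGroupoid (𝓡∂ n)) inferInstance

theorem PLOrientation.preserves_closure (o : PLOrientation n M) :
    o.Preserves 1 ∧ (∀ g g', o.Preserves g → o.Preserves g' → o.Preserves (g * g')) ∧
      ∀ g, o.Preserves g → o.Preserves g⁻¹ := by
  choose φ hφ hxφ using o.cover
  have hcompat := o.compatible
  let a : ChartedSpace (EuclideanHalfSpace n) M :=
    { atlas := o.charts
      chartAt := φ
      mem_chart_source := hxφ
      chart_mem_atlas := hφ }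
  have : @HasGroupoid _ _ M _ a (plOrientedGroupoid (𝓡∂ n)) :=
    @HasGroupoid.mk _ _ M _ a _ fun {c c'} hc hc' => hcompat c hc c' hc'
  exact structomorph_closure (plOrientedGroupoid (𝓡∂ n)) a

/-- The group `PL₊(M, K)` of the orientation-preserving PL self-homeomorphisms of the oriented PL
manifold `M` that fix `K` pointwise. -/
def PLPlus [IsPLManifold n M] (o : PLOrientation n M) (K : Set M) : Subgroup (M ≃ₜ M) where
  carrier := {g | IsPLHomeo n g ∧ o.Preserves g ∧ ∀ x ∈ K, g x = x}
  mul_mem' {g g'} hg hg' := by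
    refine ⟨isPLHomeo_closure.2.1 g g' hg.1 hg'.1, o.preserves_closure.2.1 g g' hg.2.1 hg'.2.1,
      fun x hx => ?_⟩
    change g (g' x) = x
    rw [hg'.2.2 x hx, hg.2.2 x hx]
  one_mem' := ⟨isPLHomeo_closure.1, o.preserves_closure.1, fun _ _ => rfl⟩
  inv_mem' {g} hg := by
    refine ⟨isPLHomeo_closure.2.2 g hg.1, o.preserves_closure.2.2 g hg.2.1, fun x hx => ?_⟩
    change g.symm x = x
    rw [Homeomorph.symm_apply_eq]
    exact (hg.2.2 x hx).symm

/-- The Euclidean half-space of dimension `k` as a subset of `ℝᵏ`; it is all of `ℝ⁰` if `k = 0`. -/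
def halfSpaceSet (k : ℕ) : Set (EuclideanSpace ℝ (Fin k)) :=
  {y | ∀ i : Fin k, (i : ℕ) = 0 → 0 ≤ y i}

/-- `K` is a `k`-dimensional PL submanifold of `M`, possibly with boundary: each of its points has
a neighbourhood in `K` that is the image of an open subset `V` of the `k`-dimensional half-space
under a map `j` that is a topological embedding on `V` and is piecewise linear in the charts
of `M`. -/
def IsPLSubmanifold (n : ℕ) [NeZero n] {M : Type*} [TopologicalSpace M]
    [ChartedSpace (EuclideanHalfSpace n) M] (k : ℕ) (K : Set M) : Prop :=
  ∀ x ∈ K, ∃ (V : Set (EuclideanSpace ℝ (Fin k))) (j : EuclideanSpace ℝ (Fin k) → M),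
    (∃ O : Set (EuclideanSpace ℝ (Fin k)), IsOpen O ∧ V = O ∩ halfSpaceSet k) ∧
    IsEmbedding (fun y : V => j y) ∧
    (∃ U : Set M, IsOpen U ∧ x ∈ U ∧ j '' V = K ∩ U) ∧
    ∀ c ∈ atlas (EuclideanHalfSpace n) M,
      IsPLOn (fun y => (𝓡∂ n) (c (j y))) (V ∩ j ⁻¹' c.source)

end Homeomorphisms

/-! By compactness, a group is circularly orderable if its finitely generated subgroups are
(`circularlyOrderable_of_finite`), so let Γ be generated by a finite symmetric set. Only finitely
many PL maps then matter, and a point p of K can be chosen generically for all of them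
(`exists_subset_conicSubgroup`): in a chart, K contains an open affine piece with direction space L
of codimension two, and p avoids every wall of the local polyhedral decompositions that crosses this
piece. At p the germ of each generator is positively homogeneous and commutes with translations by
L. These properties survive composition, so Γ acts on the tangent cone at p and, modulo L, on a
plane, or on a half-plane if p lies on the boundary of M.

Hence Γ acts on a circle or arc of rays. Since orientation is preserved and L is fixed, this action
preserves the circular order of the rays (`IsConicGerm.exists_linear`, `cycSign_arg_map`). The
circular order on the orbit of one ray lifts to Γ as soon as the stabilizer Z of the ray is left
orderable: elements of one coset of Z are compared by the left order
(`exists_isLeftCircularOrderOn`).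

Left orderability of Z follows from a Burns–Hale argument (`exists_isLeftOrderSign`): for every
finite nonempty subset T of Z without 1, some group containing T needs a left-invariant preorder in
which not all of T is equivalent to 1. If T moves a ray, cut the circle at the fixed ray and compare
arguments. If T fixes all rays but moves a vector v of the cone, the elements fixing the ray of v
modulo L send v to a positive multiple of v plus an element of L; the multiple is a homomorphism to
the positive reals, and on its kernel the translation part is a homomorphism to L
(`IsConeAction.hasOrderFun`). If all germs of T at p are trivial, T fixes an open set pointwise. By
connectedness, the interior of the fixed set of T has a frontier, and near it there is a point at
which T is the identity on one side of a hyperplane and linear on the other; the same argument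
applies to the action on that half-space (`hasOrderFun_of_fix_isOpen`). -/

/-! ### Left orders and circular orders on subgroups -/

section Orders

variable {G : Type*} [Group G]

/-- `e` restricts to a left-invariant circular order on the subgroup `Γ`. -/
structure IsLeftCircularOrderOn (Γ : Subgroup G) (e : G → G → G → ℤ) : Prop where
  eq_one_or_neg_one : ∀ a ∈ Γ, ∀ b ∈ Γ, ∀ c ∈ Γ, a ≠ b → b ≠ c → a ≠ c →
    e a b c = 1 ∨ e a b c = -1
  eq_zero : ∀ a ∈ Γ, ∀ b ∈ Γ, ∀ c ∈ Γ, (a = b ∨ b = c ∨ a = c) → e a b c = 0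
  cocycle : ∀ a ∈ Γ, ∀ b ∈ Γ, ∀ c ∈ Γ, ∀ d ∈ Γ, e b c d - e a c d + e a b d - e a b c = 0
  left_invariant : ∀ g ∈ Γ, ∀ a ∈ Γ, ∀ b ∈ Γ, ∀ c ∈ Γ, e (g * a) (g * b) (g * c) = e a b c

theorem Ultrafilter.exists_eventually_eq {ι α : Type*} (U : Ultrafilter ι) {f : ι → α} {s : Set α}
    (hs : s.Finite) (h : ∀ᶠ i in (U : Filter ι), f i ∈ s) :
    ∃ a ∈ s, ∀ᶠ i in (U : Filter ι), f i = a := by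
  have h' : (⋃ a ∈ s, f ⁻¹' {a}) ∈ U := by
    refine mem_of_superset h fun i hi => ?_
    simpa using hi
  obtain ⟨a, ha, h2⟩ := (Ultrafilter.finite_biUnion_mem_iff hs).1 h'
  exact ⟨a, ha, h2⟩

/-- Any ultrafilter finer than `atTop` works. Limits along it carry out the compactness arguments
for circular and left orders. -/
theorem exists_ultrafilter_finset (α : Type*) :
    ∃ U : Ultrafilter (Finset α), ∀ a : α, ∀ᶠ S in (U : Filter (Finset α)), a ∈ S := by
  classical
  refine ⟨Ultrafilter.of atTop, fun a => Ultrafilter.of_le _ ?_⟩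
  filter_upwards [eventually_ge_atTop ({a} : Finset α)] with S hS
  exact hS (by simp)

/-- Circular orderability is a local property. -/
theorem circularlyOrderable_of_finite
    (h : ∀ S : Finset G, ∃ e, IsLeftCircularOrderOn (Subgroup.closure (S : Set G)) e) :
    CircularlyOrderable G := by
  choose e he using h
  obtain ⟨U, hU⟩ := exists_ultrafilter_finset G
  have hU' : ∀ a : G, ∀ᶠ S : Finset G in (U : Filter (Finset G)),
      a ∈ Subgroup.closure (S : Set G) := fun a => (hU a).mono fun S hS =>
    Subgroup.subset_closure hS
  -- The values lie in a finite set, so they have ultrafilter limits. Each axiom involves finitely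
  -- many of these and is read off at a single S.
  have key : ∀ a b c : G, ∃ i : ℤ, ∀ᶠ S in (U : Filter (Finset G)), e S a b c = i := by
    intro a b c
    obtain ⟨i, -, hi⟩ := U.exists_eventually_eq (f := fun S => e S a b c) (s := {0, 1, -1})
      (by simp) (by
        filter_upwards [hU' a, hU' b, hU' c] with S ha hb hc
        by_cases h : a = b ∨ b = c ∨ a = c
        · exact Or.inl ((he S).eq_zero a ha b hb c hc h)
        · push Not at h
          exact Or.inr ((he S).eq_one_or_neg_one a ha b hb c hc h.1 h.2.1 h.2.2))
    exact ⟨i, hi⟩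
  choose ε hε using key
  refine ⟨ε, ⟨fun a b c h1 h2 h3 => ?_, fun a b c h => ?_, fun a b c d => ?_, fun g a b c => ?_⟩⟩
  · obtain ⟨S, h, ha, hb, hc⟩ := ((hε a b c).and ((hU' a).and ((hU' b).and (hU' c)))).exists
    rw [← h]
    exact (he S).eq_one_or_neg_one a ha b hb c hc h1 h2 h3
  · obtain ⟨S, h', ha, hb, hc⟩ := ((hε a b c).and ((hU' a).and ((hU' b).and (hU' c)))).exists
    rw [← h']
    exact (he S).eq_zero a ha b hb c hc h
  · obtain ⟨S, h1, h2, h3, h4, ha, hb, hc, hd⟩ := ((hε b c d).and ((hε a c d).and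
      ((hε a b d).and ((hε a b c).and
        ((hU' a).and ((hU' b).and ((hU' c).and (hU' d)))))))).exists
    rw [← h1, ← h2, ← h3, ← h4]
    exact (he S).cocycle a ha b hb c hc d hd
  · obtain ⟨S, h1, h2, hg, ha, hb, hc⟩ := ((hε (g * a) (g * b) (g * c)).and ((hε a b c).and
      ((hU' g).and ((hU' a).and ((hU' b).and (hU' c)))))).exists
    rw [← h1, ← h2]
    exact (he S).left_invariant g hg a ha b hb c hc

/-! ### Left orders from a Burns–Hale criterion -/

/-- `ζ` is the sign function of a left order on the subgroup `Z`. -/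
structure IsLeftOrderSign (Z : Subgroup G) (ζ : G → ℤ) : Prop where
  one : ζ 1 = 0
  eq_one_or_neg_one : ∀ z ∈ Z, z ≠ 1 → ζ z = 1 ∨ ζ z = -1
  inv : ∀ z ∈ Z, ζ z⁻¹ = -ζ z
  mul : ∀ z ∈ Z, ∀ w ∈ Z, ζ z = 1 → ζ w = 1 → ζ (z * w) = 1

/-- The preorder on the subgroup `H` pulled back along `φ` is left-invariant. -/
def IsOrderFun (H : Subgroup G) (φ : G → ℝ) : Prop :=
  ∀ a ∈ H, ∀ b ∈ H, ∀ c ∈ H, φ b ≤ φ c → φ (a * b) ≤ φ (a * c)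

theorem IsOrderFun.eq {H : Subgroup G} {φ : G → ℝ} (h : IsOrderFun H φ) {a b c : G} (ha : a ∈ H)
    (hb : b ∈ H) (hc : c ∈ H) (e : φ b = φ c) : φ (a * b) = φ (a * c) :=
  le_antisymm (h a ha b hb c hc e.le) (h a ha c hc b hb e.ge)

theorem IsOrderFun.lt {H : Subgroup G} {φ : G → ℝ} (h : IsOrderFun H φ) {a b c : G} (ha : a ∈ H)
    (hb : b ∈ H) (hc : c ∈ H) (e : φ b < φ c) : φ (a * b) < φ (a * c) := by
  by_contra! h'
  have := h a⁻¹ (H.inv_mem ha) _ (H.mul_mem ha hc) _ (H.mul_mem ha hb) h'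
  simp only [inv_mul_cancel_left] at this
  exact absurd e this.not_gt

/-- Some left-invariant preorder on a subgroup containing `S` does not kill all of `S`. -/
def HasOrderFun (S : Set G) : Prop :=
  ∃ (H : Subgroup G) (φ : G → ℝ), S ⊆ H ∧ IsOrderFun H φ ∧ ∃ s ∈ S, φ s ≠ φ 1

/-- A preorder that is nontrivial on S dictates the signs of the elements not equivalent to 1: their
signed powers are positive. The remaining elements form a strictly smaller set, which receives its
signs by induction. A product of signed elements is then either positive or built from the smaller
set alone, so it is never 1. -/
theorem exists_signs {Z : Subgroup G}
    (h : ∀ S : Finset G, (S : Set G) ⊆ Z → S.Nonempty → 1 ∉ S → HasOrderFun (S : Set G))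
    (S : Finset G) : (S : Set G) ⊆ Z → 1 ∉ S →
    ∃ σ : G → ℤ, (∀ s ∈ S, σ s = 1 ∨ σ s = -1) ∧
      1 ∉ Subsemigroup.closure {t : G | ∃ s ∈ S, t = s ^ σ s} := by
  classical
  induction S using Finset.strongInduction with
  | H S ih =>
  intro hSZ h1
  rcases S.eq_empty_or_nonempty with rfl | hne
  · refine ⟨1, by simp, ?_⟩
    simp only [Finset.notMem_empty, false_and, exists_false, Set.ofPred_false]
    rw [Subsemigroup.closure_empty]
    exact Subsemigroup.notMem_bot
  obtain ⟨H, φ, hSH, hφ, s₀, hs₀, hs₀'⟩ := h S hSZ hne h1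
  set S₀ := S.filter fun s => φ s = φ 1 with hS₀
  have hsub : S₀ ⊂ S := by
    refine Finset.filter_ssubset.2 ⟨s₀, hs₀, hs₀'⟩
  obtain ⟨σ₀, hσ₀, hσ₁⟩ := ih S₀ hsub ((Finset.coe_subset.2 hsub.1).trans hSZ)
    fun h => h1 (hsub.1 h)
  refine ⟨fun s => if φ 1 < φ s then 1 else if φ s < φ 1 then -1 else σ₀ s, ?_, ?_⟩
  · intro s hs
    dsimp only
    split_ifs with h2 h3
    · simp
    · simp
    · exact hσ₀ s (Finset.mem_filter.2 ⟨hs, by linarith⟩)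
  · intro hmem
    have key : ∀ t ∈ Subsemigroup.closure {t : G | ∃ s ∈ S, t = s ^
        (if φ 1 < φ s then 1 else if φ s < φ 1 then -1 else σ₀ s)}, t ∈ H ∧ (φ 1 < φ t ∨
        φ t = φ 1 ∧ t ∈ Subsemigroup.closure {t : G | ∃ s ∈ S₀, t = s ^ σ₀ s}) := by
      intro t ht
      induction ht using Subsemigroup.closure_induction with
      | mem t ht =>
        obtain ⟨s, hs, rfl⟩ := ht
        have hsH : s ∈ H := hSH hs
        refine ⟨H.zpow_mem hsH _, ?_⟩
        split_ifs with h2 h3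
        · simpa using Or.inl h2
        · left
          have := hφ.lt (H.inv_mem hsH) hsH H.one_mem h3
          simpa using this
        · right
          have h4 : φ s = φ 1 := by linarith
          have h5 : s ∈ S₀ := Finset.mem_filter.2 ⟨hs, h4⟩
          refine ⟨?_, Subsemigroup.subset_closure ⟨s, h5, rfl⟩⟩
          rcases hσ₀ s h5 with h6 | h6
          · simpa [h6] using h4
          · have := hφ.eq (H.inv_mem hsH) hsH H.one_mem h4
            simpa [h6] using this.symm
      | mul x y _ _ hx hy =>
        refine ⟨H.mul_mem hx.1 hy.1, ?_⟩
        rcases hy.2 with h3 | h3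
        · have := hφ.lt hx.1 H.one_mem hy.1 h3
          rw [mul_one] at this
          rcases hx.2 with h2 | h2
          · exact Or.inl (h2.trans this)
          · exact Or.inl (h2.1 ▸ this)
        · have := hφ.eq hx.1 hy.1 H.one_mem h3.1
          rw [mul_one] at this
          rcases hx.2 with h2 | h2
          · exact Or.inl (this ▸ h2)
          · exact Or.inr ⟨this.trans h2.1, Subsemigroup.mul_mem _ h2.2 h3.2⟩
    rcases (key 1 hmem).2 with h2 | h2
    · exact lt_irrefl _ h2
    · exact hσ₁ h2.2

/-- A form of the Burns–Hale criterion for left orderability. -/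
theorem exists_isLeftOrderSign {Z : Subgroup G}
    (h : ∀ S : Finset G, (S : Set G) ⊆ Z → S.Nonempty → 1 ∉ S → HasOrderFun (S : Set G)) :
    ∃ ζ, IsLeftOrderSign Z ζ := by
  classical
  have h' : ∀ S : Finset G, ∃ σ : G → ℤ,
      (∀ s ∈ S.filter fun s => s ∈ Z ∧ s ≠ 1, σ s = 1 ∨ σ s = -1) ∧
      1 ∉ Subsemigroup.closure {t : G | ∃ s ∈ S.filter fun s => s ∈ Z ∧ s ≠ 1, t = s ^ σ s} :=
    fun S => exists_signs h _ (fun s hs => (Finset.mem_filter.1 hs).2.1) (by simp)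
  choose σ hσ hσ' using h'
  obtain ⟨U, hU⟩ := exists_ultrafilter_finset G
  have key : ∀ g : G, ∃ i : ℤ, g ∈ Z → g ≠ 1 →
      (i = 1 ∨ i = -1) ∧ ∀ᶠ S in (U : Filter (Finset G)), σ S g = i := by
    intro g
    by_cases hg : g ∈ Z ∧ g ≠ 1
    · obtain ⟨i, hi, hi'⟩ := U.exists_eventually_eq (f := fun S => σ S g) (s := {1, -1})
        (by simp) ((hU g).mono fun S hS => hσ S g (Finset.mem_filter.2 ⟨hS, hg⟩))
      exact ⟨i, fun _ _ => ⟨hi, hi'⟩⟩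
    · exact ⟨0, fun h1 h2 => (hg ⟨h1, h2⟩).elim⟩
  choose ε hε using key
  have hgen : ∀ (S : Finset G) (g : G), g ∈ S → g ∈ Z → g ≠ 1 → g ^ σ S g ∈
      Subsemigroup.closure {t : G | ∃ s ∈ S.filter fun s => s ∈ Z ∧ s ≠ 1, t = s ^ σ S s} :=
    fun S g h1 h2 h3 => Subsemigroup.subset_closure ⟨g, Finset.mem_filter.2 ⟨h1, h2, h3⟩, rfl⟩
  refine ⟨fun g => if g = 1 then 0 else ε g, by simp, fun z hz h1 => ?_, fun z hz => ?_,
    fun z hz w hw h1 h2 => ?_⟩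
  · simpa [h1] using (hε z hz h1).1
  · rcases eq_or_ne z 1 with rfl | h1
    · simp
    have h1' : z⁻¹ ≠ 1 := inv_ne_one.2 h1
    simp only [h1, h1', if_false]
    obtain ⟨S, h3, h4, hS, hS'⟩ := ((hε z hz h1).2.and ((hε z⁻¹ (Z.inv_mem hz) h1').2.and
      ((hU z).and (hU z⁻¹)))).exists
    -- Equal signs for z and z⁻¹ would make the product of their signed powers 1, which the
    -- semigroup avoids.
    have := Subsemigroup.mul_mem _ (hgen S z hS hz h1) (hgen S z⁻¹ hS' (Z.inv_mem hz) h1')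
    rcases (hε z hz h1).1 with h5 | h5 <;> rcases (hε _ (Z.inv_mem hz) h1').1 with h6 | h6 <;>
      rw [h3, h4, h5, h6] at this <;> simp only [h5, h6, neg_neg] <;>
      exact (hσ' S (by simpa using this)).elim
  · have hz1 : z ≠ 1 := by rintro rfl; simp at h1
    have hw1 : w ≠ 1 := by rintro rfl; simp at h2
    simp only [hz1, hw1, if_false] at h1 h2
    have hzw : z * w ≠ 1 := by
      intro h3
      obtain ⟨S, h4, h5, hS, hS'⟩ := ((hε z hz hz1).2.and ((hε w hw hw1).2.and
        ((hU z).and (hU w)))).exists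
      have := Subsemigroup.mul_mem _ (hgen S z hS hz hz1) (hgen S w hS' hw hw1)
      rw [h4, h5, h1, h2, zpow_one, zpow_one, h3] at this
      exact hσ' S this
    simp only [hzw, if_false]
    refine (hε _ (Z.mul_mem hz hw) hzw).1.resolve_right fun h3 => ?_
    -- With sign -1 for z * w, the semigroup would contain z * w * (z * w)⁻¹ = 1.
    obtain ⟨S, h4, h5, h6, hS, hS', hS''⟩ := ((hε z hz hz1).2.and ((hε w hw hw1).2.and
      ((hε _ (Z.mul_mem hz hw) hzw).2.and ((hU z).and ((hU w).and (hU (z * w))))))).exists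
    have := Subsemigroup.mul_mem _ (Subsemigroup.mul_mem _ (hgen S z hS hz hz1)
      (hgen S w hS' hw hw1)) (hgen S (z * w) hS'' (Z.mul_mem hz hw) hzw)
    rw [h4, h5, h6, h1, h2, h3] at this
    exact hσ' S (by simpa using this)

/-! ### Circular orders from linear orders and point stabilizers -/

/-- The sign of the pair `(a, b)` in a linear order. -/
noncomputable def ordSign (a b : ℝ) : ℤ := if a < b then 1 else if b < a then -1 else 0

theorem ordSign_of_lt {a b : ℝ} (h : a < b) : ordSign a b = 1 := if_pos h

theorem ordSign_of_gt {a b : ℝ} (h : b < a) : ordSign a b = -1 := by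
  simp [ordSign, h, h.not_gt]

theorem ordSign_self (a : ℝ) : ordSign a a = 0 := by simp [ordSign]

theorem ordSign_swap (a b : ℝ) : ordSign b a = -ordSign a b := by
  rcases lt_trichotomy a b with h | rfl | h
  · rw [ordSign_of_lt h, ordSign_of_gt h]
  · simp [ordSign_self]
  · rw [ordSign_of_lt h, ordSign_of_gt h, neg_neg]

/-- The circular order induced by a linear order. -/
noncomputable def cycSign (a b c : ℝ) : ℤ := ordSign a b + ordSign b c + ordSign c a

theorem cycSign_rotate (a b c : ℝ) : cycSign b c a = cycSign a b c := by
  simp only [cycSign]; ring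

theorem cycSign_swap (a b c : ℝ) : cycSign b a c = -cycSign a b c := by
  simp only [cycSign, ordSign_swap b a, ordSign_swap c b, ordSign_swap c a]; ring

theorem cycSign_self_left (a b : ℝ) : cycSign a a b = 0 := by
  simp only [cycSign, ordSign_self, ordSign_swap a b]; ring

theorem cycSign_of_lt {a b c : ℝ} (h : a < b) (h' : b < c) : cycSign a b c = 1 := by
  simp [cycSign, ordSign_of_lt h, ordSign_of_lt h', ordSign_of_gt (h.trans h')]

/-- Two alternating cyclic functions of three points of a linear order agree if they agree on
increasing triples and on degenerate ones. -/
theorem eq_of_alternating {X : Type*} (θ : X → ℝ) {f g : X → X → X → ℤ}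
    (hf : ∀ a b c, f b c a = f a b c) (hg : ∀ a b c, g b c a = g a b c)
    (hf' : ∀ a b c, f b a c = -f a b c) (hg' : ∀ a b c, g b a c = -g a b c)
    (h0 : ∀ a b c, θ a = θ b → f a b c = g a b c)
    (h : ∀ a b c, θ a < θ b → θ b < θ c → f a b c = g a b c) (a b c : X) :
    f a b c = g a b c := by
  have h1 : ∀ a b c, θ a ≤ θ b → θ b ≤ θ c → f a b c = g a b c := by
    intro a b c h1 h2
    rcases h1.lt_or_eq with h1 | h1
    · rcases h2.lt_or_eq with h2 | h2
      · exact h a b c h1 h2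
      · rw [← hf, ← hg]; exact h0 _ _ _ h2
    · exact h0 _ _ _ h1
  rcases le_total (θ a) (θ b) with h2 | h2 <;> rcases le_total (θ b) (θ c) with h3 | h3 <;>
    rcases le_total (θ a) (θ c) with h4 | h4
  · exact h1 _ _ _ h2 h3
  · exact h1 _ _ _ h2 h3
  · have := h1 a c b h4 h3
    rw [hf' c a b, hg' c a b, ← hf c a b, ← hg c a b] at this
    omega
  · have := h1 c a b h4 h2
    rwa [← hf c a b, ← hg c a b] at this
  · have := h1 b a c h2 h4
    rw [hf', hg'] at this
    omega
  · have := h1 b c a h3 h4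
    rw [hf, hg] at this; exact this
  · have := h1 b a c h2 h4
    rw [hf', hg'] at this
    omega
  · have := h1 c b a h3 h2
    rw [hf' b c a, hg' b c a, hf a b c, hg a b c] at this
    omega

theorem cycSign_eq_one_or_neg_one {a b c : ℝ} (h1 : a ≠ b) (h2 : b ≠ c) (h3 : a ≠ c) :
    cycSign a b c = 1 ∨ cycSign a b c = -1 := by
  rcases lt_or_gt_of_ne h1 with h1 | h1 <;> rcases lt_or_gt_of_ne h2 with h2 | h2 <;>
    rcases lt_or_gt_of_ne h3 with h3 | h3 <;>
    simp [cycSign, ordSign_of_lt, ordSign_of_gt, h1, h2, h3] <;> linarith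

/-- A group acting on a circle is circularly orderable if the stabilizer of a point is left
orderable. Here `Φ` is the orbit map of the point. -/
theorem exists_isLeftCircularOrderOn {Γ Z : Subgroup G} {Φ : G → ℝ} {ζ : G → ℤ}
    (hΦ : ∀ g ∈ Γ, ∀ a ∈ Γ, ∀ b ∈ Γ, ∀ c ∈ Γ,
      cycSign (Φ (g * a)) (Φ (g * b)) (Φ (g * c)) = cycSign (Φ a) (Φ b) (Φ c))
    (hΦ' : ∀ g ∈ Γ, ∀ a ∈ Γ, ∀ b ∈ Γ, Φ a = Φ b → Φ (g * a) = Φ (g * b))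
    (hZ : ∀ g, g ∈ Z ↔ g ∈ Γ ∧ Φ g = Φ 1) (hζ : IsLeftOrderSign Z ζ) :
    ∃ e, IsLeftCircularOrderOn Γ e := by
  classical
  -- For a and b in Γ, `τ (a⁻¹ * b)` compares them by the left order if they lie in one coset of Z,
  -- and is 0 otherwise.
  set τ : G → ℤ := fun g => if g ∈ Z then ζ g else 0 with hτ
  have hτZ : ∀ {g}, g ∈ Z → τ g = ζ g := fun h => if_pos h
  have hτn : ∀ {g}, g ∉ Z → τ g = 0 := fun h => if_neg h
  have hτ1 : τ 1 = 0 := by rw [hτZ Z.one_mem, hζ.one]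
  have hτi : ∀ a b, τ (b⁻¹ * a) = -τ (a⁻¹ * b) := by
    intro a b
    have e : b⁻¹ * a = (a⁻¹ * b)⁻¹ := by group
    by_cases h : a⁻¹ * b ∈ Z
    · rw [e, hτZ h, hτZ (Z.inv_mem h), hζ.inv _ h]
    · rw [e, hτn h, hτn (fun h' => h (Z.inv_mem_iff.1 h')), neg_zero]
  have hiff : ∀ a ∈ Γ, ∀ b ∈ Γ, a⁻¹ * b ∈ Z ↔ Φ a = Φ b := by
    intro a ha b hb
    rw [hZ]
    constructor
    · rintro ⟨-, h⟩
      have := hΦ' a ha _ (Γ.mul_mem (Γ.inv_mem ha) hb) _ Γ.one_mem h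
      simpa using this.symm
    · intro h
      refine ⟨Γ.mul_mem (Γ.inv_mem ha) hb, ?_⟩
      have := hΦ' _ (Γ.inv_mem ha) _ hb _ ha h.symm
      simpa using this
  have hval : ∀ a ∈ Γ, ∀ b ∈ Γ, a ≠ b → Φ a = Φ b → τ (a⁻¹ * b) = 1 ∨ τ (a⁻¹ * b) = -1 := by
    intro a ha b hb hab h
    have hm := (hiff a ha b hb).2 h
    rw [hτZ hm]
    exact hζ.eq_one_or_neg_one _ hm (by rwa [Ne, inv_mul_eq_one])
  have hne : ∀ a ∈ Γ, ∀ b ∈ Γ, Φ a ≠ Φ b → τ (a⁻¹ * b) = 0 := fun a ha b hb h =>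
    hτn fun h' => h ((hiff a ha b hb).1 h')
  have htr : ∀ a ∈ Γ, ∀ b ∈ Γ, ∀ c ∈ Γ, Φ a = Φ b → Φ b = Φ c → τ (a⁻¹ * b) = 1 →
      τ (b⁻¹ * c) = 1 → τ (a⁻¹ * c) = 1 := by
    intro a ha b hb c hc h1 h2 h3 h4
    have m1 := (hiff a ha b hb).2 h1
    have m2 := (hiff b hb c hc).2 h2
    rw [hτZ m1] at h3
    rw [hτZ m2] at h4
    have := hζ.mul _ m1 _ m2 h3 h4
    have e : a⁻¹ * b * (b⁻¹ * c) = a⁻¹ * c := by group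
    rw [e] at this
    rwa [hτZ (e ▸ Z.mul_mem m1 m2)]
  -- Both summands are coboundaries of antisymmetric functions of pairs, whence the cocycle
  -- identity. At most one of them is nonzero: `cycSign` sees triples in three different cosets, the
  -- sum of τ sees triples with two elements in one coset.
  refine ⟨fun a b c => cycSign (Φ a) (Φ b) (Φ c) + (τ (a⁻¹ * b) + τ (b⁻¹ * c) + τ (c⁻¹ * a)),
    ⟨?_, ?_, ?_, ?_⟩⟩
  · intro a ha b hb c hc hab hbc hac
    by_cases h1 : Φ a = Φ b
    · rw [h1, cycSign_self_left, zero_add]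
      by_cases h2 : Φ b = Φ c
      · have i1 := hτi a b
        have i2 := hτi b c
        have i3 := hτi a c
        have t1 := htr a ha b hb c hc h1 h2
        have t2 := htr c hc b hb a ha h2.symm h1.symm
        have v1 := hval a ha b hb hab h1
        have v2 := hval b hb c hc hbc h2
        have v3 := hval a ha c hc hac (h1.trans h2)
        omega
      · rw [hne b hb c hc h2, hne c hc a ha (fun h => h2 (h1.symm.trans h.symm)), add_zero,
          add_zero]
        exact hval a ha b hb hab h1
    · rw [hne a ha b hb h1]
      by_cases h2 : Φ b = Φ c
      · rw [hne c hc a ha (fun h => h1 (h2.trans h).symm), h2, ← cycSign_rotate,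
          cycSign_self_left]
        simpa using hval b hb c hc hbc h2
      · rw [hne b hb c hc h2]
        by_cases h3 : Φ c = Φ a
        · rw [h3, ← cycSign_rotate, ← cycSign_rotate, cycSign_self_left]
          simpa using hval c hc a ha hac.symm h3
        · rw [hne c hc a ha h3]
          simpa using cycSign_eq_one_or_neg_one h1 h2 (Ne.symm h3)
  · rintro a ha b hb c hc (rfl | rfl | rfl)
    · have := hτi a c
      simp [cycSign_self_left, hτ1, this]
    · have := hτi a b
      rw [← cycSign_rotate, cycSign_self_left]
      simp [hτ1, this]
    · have := hτi a b
      rw [← cycSign_rotate, ← cycSign_rotate, cycSign_self_left]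
      simp [hτ1, this]
  · intro a _ b _ c _ d _
    have i1 := hτi b d
    have i2 := hτi a c
    have i3 := hτi a d
    simp only [cycSign]
    have o1 := ordSign_swap (Φ b) (Φ d)
    have o2 := ordSign_swap (Φ a) (Φ c)
    have o3 := ordSign_swap (Φ a) (Φ d)
    linarith
  · intro g hg a ha b hb c hc
    have e : ∀ x y : G, (g * x)⁻¹ * (g * y) = x⁻¹ * y := fun x y => by group
    simp only [e, hΦ g hg a ha b hb c hc]

end Orders

/-! ### The circular order of the rays of the plane -/

section Plane

/-- The signed area of the parallelogram spanned by `u` and `v`. -/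
def planeArea (u v : ℂ) : ℝ := u.re * v.im - u.im * v.re

theorem planeArea_eq (u v : ℂ) :
    planeArea u v = ‖u‖ * ‖v‖ * Real.sin (v.arg - u.arg) := by
  rw [Real.sin_sub, planeArea, ← Complex.norm_mul_cos_arg u, ← Complex.norm_mul_sin_arg u,
    ← Complex.norm_mul_cos_arg v, ← Complex.norm_mul_sin_arg v]
  ring

theorem planeArea_map (B : ℂ →ₗ[ℝ] ℂ) (u v : ℂ) :
    planeArea (B u) (B v) = LinearMap.det B * planeArea u v := by
  have h : ∀ z : ℂ, B z = z.re • B 1 + z.im • B Complex.I := by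
    intro z
    rw [← map_smul, ← map_smul, ← map_add]
    congr 1
    simp
  have hdet : LinearMap.det B = (B 1).re * (B Complex.I).im - (B Complex.I).re * (B 1).im := by
    rw [← LinearMap.det_toMatrix Complex.basisOneI, Matrix.det_fin_two]
    simp [LinearMap.toMatrix_apply]
  rw [hdet, h u, h v]
  simp [planeArea]
  ring

/-- The signed area, up to a factor, of the triangle cut out on the unit circle by three rays. -/
noncomputable def rayArea (u v w : ℂ) : ℝ :=
  planeArea u v / (‖u‖ * ‖v‖) + planeArea v w / (‖v‖ * ‖w‖) + planeArea w u / (‖w‖ * ‖u‖)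

theorem rayArea_eq {u v w : ℂ} (hu : u ≠ 0) (hv : v ≠ 0) (hw : w ≠ 0) :
    rayArea u v w = Real.sin (v.arg - u.arg) + Real.sin (w.arg - v.arg) +
      Real.sin (u.arg - w.arg) := by
  have h1 := norm_ne_zero_iff.2 hu
  have h2 := norm_ne_zero_iff.2 hv
  have h3 := norm_ne_zero_iff.2 hw
  simp only [rayArea, planeArea_eq]
  field_simp

/-- With half-gaps a and b, the sum of sines equals 4 sin a sin b sin (a + b), and a + b < π because
arguments range over an interval of length 2π. -/
theorem rayArea_pos_of_arg_lt {u v w : ℂ} (hu : u ≠ 0) (hv : v ≠ 0) (hw : w ≠ 0)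
    (h : u.arg < v.arg) (h' : v.arg < w.arg) : 0 < rayArea u v w := by
  rw [rayArea_eq hu hv hw]
  have h1 := u.neg_pi_lt_arg
  have h2 := w.arg_le_pi
  set a := (v.arg - u.arg) / 2
  set b := (w.arg - v.arg) / 2
  have e1 : v.arg - u.arg = 2 * a := by simp only [a]; ring
  have e2 : w.arg - v.arg = 2 * b := by simp only [b]; ring
  have e3 : u.arg - w.arg = -(2 * (a + b)) := by simp only [a, b]; ring
  have ha : 0 < a := by simp only [a]; linarith
  have hb : 0 < b := by simp only [b]; linarith
  have hab : a + b < Real.pi := by simp only [a, b]; linarith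
  have p1 := Real.sin_pos_of_pos_of_lt_pi ha (by linarith)
  have p2 := Real.sin_pos_of_pos_of_lt_pi hb (by linarith)
  have p3 := Real.sin_pos_of_pos_of_lt_pi (by linarith) hab
  have key : Real.sin (2 * a) + Real.sin (2 * b) + -Real.sin (2 * (a + b)) =
      4 * (Real.sin a * Real.sin b * Real.sin (a + b)) := by
    rw [Real.sin_two_mul, Real.sin_two_mul, Real.sin_two_mul, Real.sin_add, Real.cos_add]
    have s1 := Real.sin_sq_add_cos_sq a
    have s2 := Real.sin_sq_add_cos_sq b
    linear_combination (-2 * Real.sin b * Real.cos b) * s1 + (-2 * Real.sin a * Real.cos a) * s2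
  rw [e1, e2, e3, Real.sin_neg, key]
  positivity

theorem ordSign_zero_neg (x : ℝ) : ordSign 0 (-x) = -ordSign 0 x := by
  rcases lt_trichotomy 0 x with h | rfl | h
  · rw [ordSign_of_lt h, ordSign_of_gt (by linarith)]
  · simp [ordSign_self]
  · rw [ordSign_of_gt h, ordSign_of_lt (by linarith), neg_neg]

/-- This replaces the argument, which jumps across the negative real axis, by a function that is
continuous in the nonzero vectors, as a connectedness argument requires. Both sides alternate, so
increasing triples suffice. -/
theorem cycSign_arg {u v w : ℂ} (hu : u ≠ 0) (hv : v ≠ 0) (hw : w ≠ 0) :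
    cycSign u.arg v.arg w.arg = ordSign 0 (rayArea u v w) := by
  refine eq_of_alternating (X := {z : ℂ // z ≠ 0}) (fun z => z.1.arg)
    (f := fun a b c => cycSign a.1.arg b.1.arg c.1.arg)
    (g := fun a b c => ordSign 0 (rayArea a.1 b.1 c.1)) ?_ ?_ ?_ ?_ ?_ ?_
    ⟨u, hu⟩ ⟨v, hv⟩ ⟨w, hw⟩
  · exact fun a b c => cycSign_rotate _ _ _
  · intro a b c
    simp only [rayArea]
    congr 1
    ring
  · exact fun a b c => cycSign_swap _ _ _
  · intro a b c
    rw [← ordSign_zero_neg]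
    congr 1
    simp only [rayArea, planeArea]
    ring
  · intro a b c h
    have h' : a.1.arg = b.1.arg := h
    have : rayArea a.1 b.1 c.1 = 0 := by
      rw [rayArea_eq a.2 b.2 c.2, h', ← neg_sub c.1.arg, Real.sin_neg]
      simp
    simp only [this, h', cycSign_self_left, ordSign_self]
  · intro a b c h h'
    rw [cycSign_of_lt h h', ordSign_of_lt (rayArea_pos_of_arg_lt a.2 b.2 c.2 h h')]

/-- The sum of sines is sin a (1 - cos b) + sin b (1 - cos a) with both sines positive. Unlike an
increasing sequence of arguments, the hypotheses persist under linear maps of positive determinant.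
-/
theorem rayArea_pos_of_planeArea_pos {u v w : ℂ} (h : 0 < planeArea u v)
    (h' : 0 < planeArea v w) : 0 < rayArea u v w := by
  have hu : u ≠ 0 := by rintro rfl; simp [planeArea] at h
  have hv : v ≠ 0 := by rintro rfl; simp [planeArea] at h
  have hw : w ≠ 0 := by rintro rfl; simp [planeArea] at h'
  rw [rayArea_eq hu hv hw]
  rw [planeArea_eq] at h h'
  have p1 := pos_of_mul_pos_right h (by positivity)
  have p2 := pos_of_mul_pos_right h' (by positivity)
  set a := v.arg - u.arg
  set b := w.arg - v.arg
  have e : u.arg - w.arg = -(a + b) := by simp only [a, b]; ring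
  have c1 : Real.cos a < 1 := by nlinarith [Real.sin_sq_add_cos_sq a]
  have c2 : Real.cos b < 1 := by nlinarith [Real.sin_sq_add_cos_sq b]
  rw [e, Real.sin_neg, Real.sin_add]
  nlinarith [mul_pos p1 (sub_pos.2 c2), mul_pos p2 (sub_pos.2 c1)]

theorem planeArea_exp (r θ θ' : ℝ) :
    planeArea (r • Complex.exp (θ * Complex.I)) (r • Complex.exp (θ' * Complex.I)) =
      r ^ 2 * Real.sin (θ' - θ) := by
  simp only [planeArea, Complex.smul_re, Complex.smul_im, Complex.exp_ofReal_mul_I_re,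
    Complex.exp_ofReal_mul_I_im, Real.sin_sub, smul_eq_mul]
  ring

/-- A positively homogeneous map of a cone `D` of the plane that is injective on rays and
somewhere linear with positive determinant preserves the circular order of rays. -/
theorem cycSign_arg_map {D V : Set ℂ} {J : Set ℝ} {k : ℂ → ℂ} {B : ℂ →ₗ[ℝ] ℂ}
    (hJ : Convex ℝ J) (hJ' : J ⊆ Ioc (-Real.pi) Real.pi)
    (hJD : ∀ θ ∈ J, Complex.exp (θ * Complex.I) ∈ D) (hDJ : ∀ u ∈ D, u ≠ 0 → u.arg ∈ J)
    (hk : ContinuousOn k D) (hk0 : ∀ u ∈ D, u ≠ 0 → k u ≠ 0)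
    (hks : ∀ a : ℝ, 0 < a → ∀ u ∈ D, k (a • u) = a • k u)
    (hki : ∀ u ∈ D, ∀ v ∈ D, u ≠ 0 → v ≠ 0 → (k u).arg = (k v).arg → u.arg = v.arg)
    (hV : IsOpen V) (hVne : V.Nonempty) (hVD : V ⊆ D) (hB : 0 < LinearMap.det B)
    (hkB : EqOn k B V) {u v w : ℂ} (hu : u ∈ D) (hv : v ∈ D) (hw : w ∈ D)
    (hu0 : u ≠ 0) (hv0 : v ≠ 0) (hw0 : w ≠ 0) :
    cycSign (k u).arg (k v).arg (k w).arg = cycSign u.arg v.arg w.arg := by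
  set E : ℝ → ℂ := fun θ => Complex.exp (θ * Complex.I) with hE
  have hEc : Continuous E := by fun_prop
  have hE0 : ∀ θ, E θ ≠ 0 := fun θ => Complex.exp_ne_zero _
  have hEarg : ∀ θ ∈ J, (E θ).arg = θ := fun θ h => by
    rw [hE]
    dsimp only
    rw [Complex.arg_exp_mul_I, toIocMod_eq_self]
    have := hJ' h
    exact ⟨this.1, by linarith [this.2]⟩
  have hkarg : ∀ u ∈ D, u ≠ 0 → (k u).arg = (k (E u.arg)).arg := by
    intro u hu hu0
    have h1 : u = ‖u‖ • E u.arg := by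
      simp [hE, Complex.norm_mul_exp_arg_mul_I]
    conv_lhs => rw [h1, hks _ (norm_pos_iff.2 hu0) _ (hJD _ (hDJ u hu hu0))]
    exact Complex.arg_real_mul _ (norm_pos_iff.2 hu0)
  have hkE0 : ∀ θ ∈ J, k (E θ) ≠ 0 := fun θ h => hk0 _ (hJD θ h) (hE0 θ)
  have hkEinj : ∀ θ ∈ J, ∀ θ' ∈ J, (k (E θ)).arg = (k (E θ')).arg → θ = θ' := by
    intro θ h θ' h' he
    have := hki _ (hJD θ h) _ (hJD θ' h') (hE0 _) (hE0 _) he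
    rwa [hEarg θ h, hEarg θ' h'] at this
  -- Increasing triples of angles form a convex, hence connected, set. On it F is continuous and, as
  -- k is injective on rays, never zero; one positive value therefore settles the sign.
  set T : Set (ℝ × ℝ × ℝ) := {p | (p.1 ∈ J ∧ p.2.1 ∈ J ∧ p.2.2 ∈ J) ∧ p.1 < p.2.1 ∧ p.2.1 < p.2.2}
    with hT
  have hTc : Convex ℝ T := by
    rintro ⟨a, b, c⟩ ⟨⟨h1, h2, h3⟩, h4, h5⟩ ⟨a', b', c'⟩ ⟨⟨h1', h2', h3'⟩, h4', h5'⟩ s t hs ht hst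
    refine ⟨⟨hJ h1 h1' hs ht hst, hJ h2 h2' hs ht hst, hJ h3 h3' hs ht hst⟩, ?_, ?_⟩
    · simp only [Prod.fst_add, Prod.smul_fst, Prod.snd_add, Prod.smul_snd, smul_eq_mul] at *
      rcases hs.eq_or_lt with rfl | hs
      · have : t = 1 := by linarith
        subst this; linarith
      · nlinarith
    · simp only [Prod.fst_add, Prod.smul_fst, Prod.snd_add, Prod.smul_snd, smul_eq_mul] at *
      rcases hs.eq_or_lt with rfl | hs
      · have : t = 1 := by linarith
        subst this; linarith
      · nlinarith
  set F : ℝ × ℝ × ℝ → ℝ := fun p => rayArea (k (E p.1)) (k (E p.2.1)) (k (E p.2.2)) with hF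
  have hFc : ContinuousOn F T := by
    have c1 : ContinuousOn (fun p : ℝ × ℝ × ℝ => k (E p.1)) T :=
      hk.comp (hEc.comp continuous_fst).continuousOn fun p hp => hJD _ hp.1.1
    have c2 : ContinuousOn (fun p : ℝ × ℝ × ℝ => k (E p.2.1)) T :=
      hk.comp (hEc.comp (continuous_fst.comp continuous_snd)).continuousOn
        fun p hp => hJD _ hp.1.2.1
    have c3 : ContinuousOn (fun p : ℝ × ℝ × ℝ => k (E p.2.2)) T :=
      hk.comp (hEc.comp (continuous_snd.comp continuous_snd)).continuousOn
        fun p hp => hJD _ hp.1.2.2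
    have key : ∀ {f g : ℝ × ℝ × ℝ → ℂ}, ContinuousOn f T → ContinuousOn g T →
        (∀ p ∈ T, f p ≠ 0) → (∀ p ∈ T, g p ≠ 0) →
        ContinuousOn (fun p => planeArea (f p) (g p) / (‖f p‖ * ‖g p‖)) T := by
      intro f g hf hg hf0 hg0
      refine ContinuousOn.div ?_ (hf.norm.mul hg.norm) fun p hp =>
        mul_ne_zero (norm_ne_zero_iff.2 (hf0 p hp)) (norm_ne_zero_iff.2 (hg0 p hp))
      exact ((Complex.continuous_re.comp_continuousOn hf).mul
        (Complex.continuous_im.comp_continuousOn hg)).sub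
        ((Complex.continuous_im.comp_continuousOn hf).mul
        (Complex.continuous_re.comp_continuousOn hg))
    have n1 : ∀ p ∈ T, k (E p.1) ≠ 0 := fun p hp => hkE0 _ hp.1.1
    have n2 : ∀ p ∈ T, k (E p.2.1) ≠ 0 := fun p hp => hkE0 _ hp.1.2.1
    have n3 : ∀ p ∈ T, k (E p.2.2) ≠ 0 := fun p hp => hkE0 _ hp.1.2.2
    exact ((key c1 c2 n1 n2).add (key c2 c3 n2 n3)).add (key c3 c1 n3 n1)
  have hFs : ∀ p ∈ T, cycSign (k (E p.1)).arg (k (E p.2.1)).arg (k (E p.2.2)).arg =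
      ordSign 0 (F p) := fun p hp =>
    cycSign_arg (hkE0 _ hp.1.1) (hkE0 _ hp.1.2.1) (hkE0 _ hp.1.2.2)
  have hF0 : ∀ p ∈ T, F p ≠ 0 := by
    intro p hp h0
    have h1 := hFs p hp
    rw [h0, ordSign_self] at h1
    have h2 := cycSign_eq_one_or_neg_one
      (fun h => hp.2.1.ne (hkEinj _ hp.1.1 _ hp.1.2.1 h))
      (fun h => hp.2.2.ne (hkEinj _ hp.1.2.1 _ hp.1.2.2 h))
      (fun h => (hp.2.1.trans hp.2.2).ne (hkEinj _ hp.1.1 _ hp.1.2.2 h))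
    omega
  obtain ⟨p₀, hp₀, hFp₀⟩ : ∃ p ∈ T, 0 < F p := by
    -- Off the real axis the argument is not π, so angles near that of v₀ are again arguments.
    obtain ⟨v₀, hv₀V, hv₀⟩ : ∃ v₀ ∈ V, v₀.im ≠ 0 := by
      by_contra! h
      have : Complex.imLm.toAffineMap = 0 :=
        AffineMap.eq_of_eqOn_isOpen hV hVne fun z hz => by simpa using h z hz
      have h2 := congrArg (fun f : ℂ →ᵃ[ℝ] ℝ => f Complex.I) this
      simp at h2
    have hv₀0 : v₀ ≠ 0 := by rintro rfl; simp at hv₀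
    have hr : 0 < ‖v₀‖ := norm_pos_iff.2 hv₀0
    have hπ : v₀.arg < Real.pi := lt_of_le_of_ne v₀.arg_le_pi fun h =>
      hv₀ (Complex.arg_eq_pi_iff.1 h).2
    have hev : ∀ᶠ θ in 𝓝 v₀.arg, ‖v₀‖ • E θ ∈ V ∧ -Real.pi < θ ∧ θ < Real.pi := by
      refine Filter.Eventually.and ?_ ((lt_mem_nhds v₀.neg_pi_lt_arg).and (gt_mem_nhds hπ))
      have hc : ContinuousAt (fun θ => ‖v₀‖ • E θ) v₀.arg := by
        fun_prop
      refine hc.eventually (hV.mem_nhds ?_)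
      simpa [hE, Complex.norm_mul_exp_arg_mul_I] using hv₀V
    obtain ⟨δ, hδ, hball⟩ := Metric.eventually_nhds_iff.1 hev
    -- The bound 1 < π makes sin η positive, so three rays at angles η apart span positive areas,
    -- and so do their images under B.
    set η := min (δ / 2) 1 with hη
    have hη0 : 0 < η := lt_min (by linarith) one_pos
    have hη1 : η ≤ 1 := min_le_right _ _
    have hηδ : η < δ := lt_of_le_of_lt (min_le_left _ _) (by linarith)
    have hmem : ∀ θ, |θ - v₀.arg| ≤ η → θ ∈ J ∧ ‖v₀‖ • E θ ∈ V := by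
      intro θ hθ
      obtain ⟨h1, h2, h3⟩ := hball (y := θ) (by rw [Real.dist_eq]; linarith)
      refine ⟨?_, h1⟩
      have h4 := hDJ _ (hVD h1) (smul_ne_zero hr.ne' (hE0 _))
      have h5 : (‖v₀‖ • E θ).arg = θ := by
        rw [show ‖v₀‖ • E θ = (‖v₀‖ : ℂ) * E θ by simp, Complex.arg_real_mul _ hr, hE]
        dsimp only
        rw [Complex.arg_exp_mul_I, toIocMod_eq_self]
        exact ⟨h2, by linarith⟩
      rwa [h5] at h4
    have m1 := hmem (v₀.arg - η) (by rw [abs_le]; constructor <;> linarith)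
    have m2 := hmem v₀.arg (by simp [hη0.le])
    have m3 := hmem (v₀.arg + η) (by rw [abs_le]; constructor <;> linarith)
    have hp : (v₀.arg - η, v₀.arg, v₀.arg + η) ∈ T :=
      ⟨⟨m1.1, m2.1, m3.1⟩, by dsimp only; linarith, by dsimp only; linarith⟩
    refine ⟨_, hp, ?_⟩
    have hk' : ∀ θ ∈ J, ‖v₀‖ • E θ ∈ V → (k (E θ)).arg = (B (‖v₀‖ • E θ)).arg := by
      intro θ h h'
      rw [← hkB h', hks _ hr _ (hJD _ h)]
      exact (Complex.arg_real_mul _ hr).symm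
    have hs := Real.sin_pos_of_pos_of_lt_pi hη0 (by linarith [Real.pi_gt_three])
    have hpos : 0 < rayArea (B (‖v₀‖ • E (v₀.arg - η))) (B (‖v₀‖ • E v₀.arg))
        (B (‖v₀‖ • E (v₀.arg + η))) := by
      apply rayArea_pos_of_planeArea_pos <;> rw [planeArea_map, planeArea_exp]
      · rw [sub_sub_cancel]; positivity
      · rw [add_sub_cancel_left]; positivity
    have h1 := hFs _ hp
    dsimp only at h1
    have hn : ∀ θ ∈ J, ‖v₀‖ • E θ ∈ V → B (‖v₀‖ • E θ) ≠ 0 := by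
      intro θ h h'
      rw [← hkB h', hks _ hr _ (hJD _ h)]
      exact smul_ne_zero hr.ne' (hkE0 _ h)
    rw [hk' _ m1.1 m1.2, hk' _ m2.1 m2.2, hk' _ m3.1 m3.2,
      cycSign_arg (hn _ m1.1 m1.2) (hn _ m2.1 m2.2) (hn _ m3.1 m3.2), ordSign_of_lt hpos] at h1
    by_contra h2
    rcases (not_lt.1 h2).eq_or_lt with h2 | h2
    · exact hF0 _ hp h2
    · rw [ordSign_of_gt h2] at h1
      omega
  have hFpos : ∀ p ∈ T, 0 < F p := by
    intro p hp
    by_contra! h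
    have hc := hTc.isPreconnected.intermediate_value hp hp₀ hFc
    obtain ⟨q, hq, hq0⟩ := hc ⟨h, hFp₀.le⟩
    exact hF0 q hq hq0
  refine (eq_of_alternating (X := {z : ℂ // z ∈ D ∧ z ≠ 0}) (fun z => z.1.arg)
    (f := fun a b c => cycSign (k a.1).arg (k b.1).arg (k c.1).arg)
    (g := fun a b c => cycSign a.1.arg b.1.arg c.1.arg)
    (fun a b c => cycSign_rotate _ _ _) (fun a b c => cycSign_rotate _ _ _)
    (fun a b c => cycSign_swap _ _ _) (fun a b c => cycSign_swap _ _ _) ?_ ?_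
    ⟨u, hu, hu0⟩ ⟨v, hv, hv0⟩ ⟨w, hw, hw0⟩)
  · intro a b c h
    have h' : a.1.arg = b.1.arg := h
    simp only [hkarg _ a.2.1 a.2.2, hkarg _ b.2.1 b.2.2, h', cycSign_self_left]
  · intro a b c h h'
    have hp : (a.1.arg, b.1.arg, c.1.arg) ∈ T :=
      ⟨⟨hDJ _ a.2.1 a.2.2, hDJ _ b.2.1 b.2.2, hDJ _ c.2.1 c.2.2⟩, h, h'⟩
    have h1 := hFs _ hp
    rw [ordSign_of_lt (hFpos _ hp)] at h1
    rw [cycSign_of_lt h h', hkarg _ a.2.1 a.2.2, hkarg _ b.2.1 b.2.2, hkarg _ c.2.1 c.2.2]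
    exact h1

end Plane

/-! ### Conic germs -/

section Conic

variable {E : Type*} [NormedAddCommGroup E] [NormedSpace ℝ E]

/-- `C` is a cone that is invariant under translations by `L`. -/
structure IsConeMod (C : Set E) (L : Submodule ℝ E) : Prop where
  zero_mem : (0 : E) ∈ C
  smul_mem : ∀ a : ℝ, 0 ≤ a → ∀ v ∈ C, a • v ∈ C
  add_mem : ∀ v ∈ C, ∀ l ∈ L, v + l ∈ C

/-- On `x₀ + C`, the germ of `f` at `x₀` is conic: it is that of `x₀ + v ↦ x₀ + h v` for a
positively homogeneous map `h` of the cone `C` that commutes with translations by `L`. -/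
structure IsConicGerm (f : E → E) (x₀ : E) (C : Set E) (L : Submodule ℝ E) (h : E → E) : Prop where
  continuousOn : ContinuousOn h C
  mapsTo : MapsTo h C C
  smul : ∀ a : ℝ, 0 ≤ a → ∀ v ∈ C, h (a • v) = a • h v
  add : ∀ v ∈ C, ∀ l ∈ L, h (v + l) = h v + l
  eventually_eq : ∀ᶠ v in 𝓝[C] 0, f (x₀ + v) = x₀ + h v

variable {f f' h h' : E → E} {x₀ : E} {C : Set E} {L : Submodule ℝ E}

theorem IsConicGerm.map_zero (hC : IsConeMod C L) (hf : IsConicGerm f x₀ C L h) : h 0 = 0 := by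
  simpa using hf.smul 0 le_rfl 0 hC.zero_mem

theorem IsConicGerm.tendsto (hC : IsConeMod C L) (hf : IsConicGerm f x₀ C L h) :
    Tendsto h (𝓝[C] 0) (𝓝[C] 0) := by
  have h1 := hf.continuousOn 0 hC.zero_mem
  rw [ContinuousWithinAt, hf.map_zero hC] at h1
  exact tendsto_nhdsWithin_of_tendsto_nhds_of_eventually_within _ h1
    (eventually_nhdsWithin_of_forall hf.mapsTo)

theorem IsConicGerm.comp (hC : IsConeMod C L) (hf : IsConicGerm f x₀ C L h)
    (hf' : IsConicGerm f' x₀ C L h') : IsConicGerm (f ∘ f') x₀ C L (h ∘ h') where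
  continuousOn := hf.continuousOn.comp hf'.continuousOn hf'.mapsTo
  mapsTo := hf.mapsTo.comp hf'.mapsTo
  smul a ha v hv := by simp only [Function.comp, hf'.smul a ha v hv, hf.smul a ha _ (hf'.mapsTo hv)]
  add v hv l hl := by simp only [Function.comp, hf'.add v hv l hl, hf.add _ (hf'.mapsTo hv) l hl]
  eventually_eq := by
    filter_upwards [hf'.eventually_eq, (hf'.tendsto hC).eventually hf.eventually_eq] with v h1 h2
    simp only [Function.comp, h1, h2]

theorem IsConicGerm.congr (hf : IsConicGerm f x₀ C L h)
    (he : ∀ᶠ v in 𝓝[C] 0, f' (x₀ + v) = f (x₀ + v)) : IsConicGerm f' x₀ C L h where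
  continuousOn := hf.continuousOn
  mapsTo := hf.mapsTo
  smul := hf.smul
  add := hf.add
  eventually_eq := by
    filter_upwards [hf.eventually_eq, he] with v h1 h2
    rw [h2, h1]

theorem isConicGerm_id : IsConicGerm id x₀ C L id where
  continuousOn := continuousOn_id
  mapsTo := mapsTo_id _
  smul _ _ _ _ := rfl
  add _ _ _ _ := rfl
  eventually_eq := Eventually.of_forall fun _ => rfl

theorem IsConeMod.tendsto_smul (hC : IsConeMod C L) {v : E} (hv : v ∈ C) :
    Tendsto (fun a : ℝ => a • v) (𝓝[>] 0) (𝓝[C] 0) := by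
  refine tendsto_nhdsWithin_of_tendsto_nhds_of_eventually_within _ ?_ ?_
  · have : Tendsto (fun a : ℝ => a • v) (𝓝 0) (𝓝 ((0 : ℝ) • v)) :=
      (continuous_id.smul continuous_const).tendsto 0
    rw [zero_smul] at this
    exact this.mono_left nhdsWithin_le_nhds
  · filter_upwards [self_mem_nhdsWithin] with a ha
    exact hC.smul_mem a (le_of_lt ha) v hv

/-- Every v in C has a positive multiple so close to 0 that both h and h' can be read off from f.
This uniqueness is what turns germs into a group action. -/
theorem IsConicGerm.eqOn (hC : IsConeMod C L) (hf : IsConicGerm f x₀ C L h)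
    (hf' : IsConicGerm f x₀ C L h') : EqOn h h' C := by
  intro v hv
  obtain ⟨a, ⟨h1, h2⟩, ha⟩ := (((hC.tendsto_smul hv).eventually
    (hf.eventually_eq.and hf'.eventually_eq)).and self_mem_nhdsWithin).exists
  have ha' : (0 : ℝ) < a := ha
  rw [h1, hf.smul a ha'.le v hv, hf'.smul a ha'.le v hv] at h2
  exact smul_right_injective E ha'.ne' (add_left_cancel h2)

/-- A map that is conic and `L`-invariant near `x₀` has a conic germ. -/
theorem exists_isConicGerm {r : ℝ} (hC : IsConeMod C L) (hr : 0 < r)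
    (hc : ContinuousOn (fun v => f (x₀ + v)) (C ∩ Metric.ball 0 r))
    (hm : ∀ v ∈ C, ‖v‖ < r → f (x₀ + v) - x₀ ∈ C)
    (hs : ∀ v ∈ C, ‖v‖ < r → ∀ a : ℝ, 0 ≤ a → a ≤ 1 →
      f (x₀ + a • v) - x₀ = a • (f (x₀ + v) - x₀))
    (ha : ∀ v ∈ C, ‖v‖ < r → ∀ l ∈ L, ‖l‖ < r → f (x₀ + (v + l)) = f (x₀ + v) + l) :
    ∃ h, IsConicGerm f x₀ C L h := by
  set F : E → E := fun v => f (x₀ + v) - x₀ with hF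
  -- A continuous factor that brings v into the ball of radius r. The extension of F divides F (ρ v
  -- • v) by ρ v; by `key'` any other admissible factor gives the same value.
  set ρ : E → ℝ := fun v => r / (2 * (‖v‖ + 1)) with hρ
  have hρ0 : ∀ v, 0 < ρ v := fun v => by positivity
  have hρv : ∀ v, ‖ρ v • v‖ < r := fun v => by
    rw [norm_smul, Real.norm_of_nonneg (hρ0 v).le, hρ]
    dsimp only
    rw [div_mul_eq_mul_div, div_lt_iff₀ (by positivity)]
    nlinarith [norm_nonneg v]
  have key : ∀ v ∈ C, ∀ a b : ℝ, 0 < a → a ≤ b → ‖b • v‖ < r →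
      a⁻¹ • F (a • v) = b⁻¹ • F (b • v) := by
    intro v hv a b ha0 hab hb
    have hb0 := ha0.trans_le hab
    have := hs (b • v) (hC.smul_mem b hb0.le v hv) hb (a / b) (by positivity)
      ((div_le_one hb0).2 hab)
    rw [smul_smul, div_mul_cancel₀ _ hb0.ne'] at this
    simp only [hF, this, smul_smul]
    congr 1
    field_simp
  have key' : ∀ v ∈ C, ∀ a : ℝ, 0 < a → ‖a • v‖ < r → (ρ v)⁻¹ • F (ρ v • v) = a⁻¹ • F (a • v) := by
    intro v hv a ha0 har
    rcases le_total (ρ v) a with h1 | h1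
    · exact key v hv _ _ (hρ0 v) h1 har
    · exact (key v hv _ _ ha0 h1 (hρv v)).symm
  refine ⟨fun v => (ρ v)⁻¹ • F (ρ v • v), ?_, ?_, ?_, ?_, ?_⟩
  · have hρc : Continuous ρ := by
      refine continuous_const.div (by fun_prop) fun v => ?_
      positivity
    refine ((hρc.inv₀ fun v => (hρ0 v).ne').continuousOn).smul (ContinuousOn.sub ?_ continuousOn_const)
    refine hc.comp (hρc.smul continuous_id).continuousOn fun v hv => ⟨?_, ?_⟩
    · exact hC.smul_mem _ (hρ0 v).le v hv
    · simpa using hρv v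
  · intro v hv
    exact hC.smul_mem _ (inv_pos.2 (hρ0 v)).le _
      (hm _ (hC.smul_mem _ (hρ0 v).le v hv) (hρv v))
  · intro a ha v hv
    rcases ha.eq_or_lt with rfl | ha
    · have h0 := hs 0 hC.zero_mem (by simpa using hr) 0 le_rfl zero_le_one
      simp only [smul_zero, zero_smul] at h0
      simp [hF] at h0 ⊢
      exact Or.inr h0
    · have hav := hC.smul_mem a ha.le v hv
      rw [key' v hv (ρ (a • v) * a) (mul_pos (hρ0 _) ha) (by rw [mul_smul]; exact hρv _), smul_smul,
        smul_smul]
      congr 1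
      have := (hρ0 (a • v)).ne'
      field_simp
  · intro v hv l hl
    have hvl := hC.add_mem v hv l hl
    set a := min (min (ρ v) (ρ l)) (ρ (v + l))
    have ha0 : 0 < a := lt_min (lt_min (hρ0 _) (hρ0 _)) (hρ0 _)
    have hmono : ∀ w, a ≤ ρ w → ‖a • w‖ < r := fun w hw => by
      refine lt_of_le_of_lt ?_ (hρv w)
      rw [norm_smul, norm_smul, Real.norm_of_nonneg ha0.le, Real.norm_of_nonneg (hρ0 w).le]
      gcongr
    rw [key' v hv a ha0 (hmono v ((min_le_left _ _).trans (min_le_left _ _))),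
      key' _ hvl a ha0 (hmono _ (min_le_right _ _)), smul_add]
    simp only [hF]
    rw [ha _ (hC.smul_mem a ha0.le v hv)
      (hmono v ((min_le_left _ _).trans (min_le_left _ _))) _ (L.smul_mem a hl)
      (hmono l ((min_le_left _ _).trans (min_le_right _ _))), add_sub_right_comm, smul_add a⁻¹,
      smul_smul, inv_mul_cancel₀ ha0.ne', one_smul]
  · filter_upwards [self_mem_nhdsWithin,
      mem_nhdsWithin_of_mem_nhds (Metric.ball_mem_nhds (0 : E) hr)] with v hv hvr
    have := key' v hv 1 one_pos (by simpa using hvr)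
    rw [this]
    simp [hF]

variable {G : Type*} [Group G]

/-- The maps `h g`, for `g` in `H`, form an action of `H` on the cone `C` by positively homogeneous
maps that commute with translations by `L`. -/
structure IsConeAction (H : Subgroup G) (C : Set E) (L : Submodule ℝ E) (h : G → E → E) :
    Prop where
  one : ∀ v ∈ C, h 1 v = v
  mul : ∀ a ∈ H, ∀ b ∈ H, ∀ v ∈ C, h (a * b) v = h a (h b v)
  mapsTo : ∀ g ∈ H, MapsTo (h g) C C
  smul : ∀ g ∈ H, ∀ a : ℝ, 0 ≤ a → ∀ v ∈ C, h g (a • v) = a • h g v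
  add : ∀ g ∈ H, ∀ v ∈ C, ∀ l ∈ L, h g (v + l) = h g v + l

/-- If a group acts on a cone and preserves the half-space `ℝ>0 • v + L`, then it has a
left-invariant preorder for which only elements fixing `v` are trivial. -/
theorem IsConeAction.hasOrderFun {H : Subgroup G} {h : G → E → E} (hC : IsConeMod C L)
    (hH : IsConeAction H C L h) {S : Set G} (hS : S ⊆ H) {v : E} (hv : v ∈ C)
    (hl : ∀ g ∈ H, ∃ a : ℝ, 0 < a ∧ ∃ l ∈ L, h g v = a • v + l) {s : G} (hs : s ∈ S)
    (hsv : h s v ≠ v) : HasOrderFun S := by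
  classical
  -- Elements of H fix L pointwise, since they fix 0 and commute with translations by L.
  have hvL : v ∉ L := by
    intro hvL
    refine hsv ?_
    have h1 := hH.add s (hS hs) 0 hC.zero_mem v hvL
    have h2 := hH.smul s (hS hs) 0 le_rfl 0 hC.zero_mem
    rw [zero_smul, zero_smul] at h2
    rwa [h2, zero_add] at h1
  have huniq : ∀ a b : ℝ, ∀ l ∈ L, ∀ m ∈ L, a • v + l = b • v + m → a = b := by
    intro a b l hl m hm he
    by_contra hab
    have h1 : (a - b) • v = m - l := by rw [sub_smul, sub_eq_sub_iff_add_eq_add, he, add_comm]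
    have h2 : (a - b) • v ∈ L := h1 ▸ L.sub_mem hm hl
    exact hvL ((L.smul_mem_iff (sub_ne_zero.2 hab)).1 h2)
  choose! φ hφ0 l hlL hφ using hl
  have hact : ∀ a ∈ H, ∀ b ∈ H, h (a * b) v = φ b • h a v + l b := by
    intro a ha b hb
    rw [hH.mul a ha b hb v hv, hφ b hb, hH.add a ha _ (hC.smul_mem _ (hφ0 b hb).le v hv) _ (hlL b hb),
      hH.smul a ha _ (hφ0 b hb).le v hv]
  have hφmul : ∀ a ∈ H, ∀ b ∈ H, φ (a * b) = φ a * φ b := by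
    intro a ha b hb
    have h1 := hact a ha b hb
    rw [hφ a ha, hφ _ (H.mul_mem ha hb), smul_add, smul_smul, add_assoc, mul_comm] at h1
    exact huniq _ _ _ (hlL _ (H.mul_mem ha hb)) _ (L.add_mem (L.smul_mem _ (hlL a ha)) (hlL b hb)) h1
  have hφ1 : φ 1 = 1 := by
    have h1 := hφ 1 H.one_mem
    rw [hH.one v hv] at h1
    refine huniq _ 1 _ (hlL 1 H.one_mem) 0 L.zero_mem ?_
    rw [← h1, one_smul, add_zero]
  -- The dilation factor φ is a homomorphism to the positive reals and gives the preorder if it is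
  -- nontrivial on S. Otherwise S lies in its kernel, where g ↦ h g v - v is a homomorphism to L,
  -- and a linear functional that detects h s v - v gives the preorder.
  by_cases hall : ∃ t ∈ S, φ t ≠ 1
  · obtain ⟨t, ht, ht1⟩ := hall
    refine ⟨H, φ, hS, fun a ha b hb c hc hbc => ?_, t, ht, by rwa [hφ1]⟩
    rw [hφmul a ha b hb, hφmul a ha c hc]
    exact mul_le_mul_of_nonneg_left hbc (hφ0 a ha).le
  · push Not at hall
    let H' : Subgroup G :=
      { carrier := {g | g ∈ H ∧ φ g = 1}
        mul_mem' := fun {a b} ha hb => ⟨H.mul_mem ha.1 hb.1, by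
          rw [hφmul a ha.1 b hb.1, ha.2, hb.2, mul_one]⟩
        one_mem' := ⟨H.one_mem, hφ1⟩
        inv_mem' := fun {a} ha => ⟨H.inv_mem ha.1, by
          have h1 := hφmul a⁻¹ (H.inv_mem ha.1) a ha.1
          rw [inv_mul_cancel, hφ1, ha.2, mul_one] at h1
          exact h1.symm⟩ }
    obtain ⟨m, hm⟩ : ∃ m : Module.Dual ℝ E, m (h s v - v) ≠ 0 := by
      by_contra! hm
      exact hsv (sub_eq_zero.1 ((Module.forall_dual_apply_eq_zero_iff ℝ _).1 hm))
    refine ⟨H', fun g => m (h g v), fun g hg => ⟨hS hg, hall g hg⟩, ?_, s, hs, ?_⟩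
    · intro a ha b hb c hc hbc
      have hbv := hφ b hb.1
      have hcv := hφ c hc.1
      rw [hb.2, one_smul] at hbv
      rw [hc.2, one_smul] at hcv
      dsimp only at hbc ⊢
      rw [hact a ha.1 b hb.1, hact a ha.1 c hc.1, hb.2, hc.2, _root_.map_add, _root_.map_add]
      rw [hbv, hcv, _root_.map_add, _root_.map_add] at hbc
      linarith
    · dsimp only
      rw [hH.one v hv]
      rwa [map_sub, sub_ne_zero] at hm

end Conic

theorem tendsto_const_add_nhds_zero {E : Type*} [NormedAddCommGroup E] (x₀ : E) : Tendsto (fun v : E => x₀ + v) (𝓝 0) (𝓝 x₀) := by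
  have : Tendsto (fun v : E => x₀ + v) (𝓝 0) (𝓝 (x₀ + 0)) :=
    (continuous_const.add continuous_id).tendsto 0
  rwa [add_zero] at this

/-! ### Local structure of piecewise linear maps -/

section LocalPL

variable {E F : Type*} [NormedAddCommGroup E] [NormedSpace ℝ E] [NormedAddCommGroup F]
  [NormedSpace ℝ F]

/-- Near each point, a piecewise linear map is affine on sets of points on which the signs of
finitely many affine functionals are controlled. -/
theorem IsPLOn.exists_affine_of_sign {f : E → F} {T : Set E} (hf : IsPLOn f T) {x : E}
    (hx : x ∈ T) : ∃ Λ : Set (E →ᵃ[ℝ] ℝ), Λ.Finite ∧ ∃ U : Set E, IsOpen U ∧ x ∈ U ∧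
      ∀ y ∈ T ∩ U, ∃ B : E →ᵃ[ℝ] F, ∀ z ∈ T ∩ U, (∀ l ∈ Λ, 0 ≤ l y → 0 ≤ l z) → f z = B z := by
  obtain ⟨Q, hQ, hP, hy⟩ := hf.2 x hx
  choose! Λ hΛ hPΛ using hP
  obtain ⟨U, hU, hxU, hUT⟩ := mem_nhdsWithin.1 hy
  refine ⟨⋃ q ∈ Q, Λ q, hQ.biUnion hΛ, U, hU, hxU, fun y hyU => ?_⟩
  obtain ⟨⟨q, hq, hyq⟩, -⟩ := hUT ⟨hyU.2, hyU.1⟩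
  refine ⟨q.2, fun z hz hyz => ?_⟩
  refine (hUT ⟨hz.2, hz.1⟩).2 q hq ?_
  rw [hPΛ q hq] at hyq ⊢
  exact fun l hl => hyz l (mem_biUnion hq hl) (hyq l hl)

/-- A nonempty open set is not covered by the zero sets of finitely many nonzero affine
functionals. -/
theorem exists_forall_affine_ne_zero [FiniteDimensional ℝ E] {Λ : Set (E →ᵃ[ℝ] ℝ)}
    (hΛ : Λ.Finite) (h0 : ∀ l ∈ Λ, l ≠ 0) {V : Set E} (hV : IsOpen V) (hne : V.Nonempty) :
    ∃ y ∈ V, ∀ l ∈ Λ, l y ≠ 0 := by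
  suffices ∃ V' ⊆ V, IsOpen V' ∧ V'.Nonempty ∧ ∀ y ∈ V', ∀ l ∈ Λ, l y ≠ 0 by
    obtain ⟨V', hV', -, ⟨y, hy⟩, h⟩ := this
    exact ⟨y, hV' hy, h y hy⟩
  induction Λ, hΛ using Set.Finite.induction_on with
  | empty => exact ⟨V, subset_rfl, hV, hne, by simp⟩
  | @insert l s _ _ ih =>
    obtain ⟨V', hV', hV'o, hV'ne, h⟩ := ih fun l hl => h0 l (mem_insert_of_mem _ hl)
    refine ⟨V' ∩ {y | l y ≠ 0}, inter_subset_left.trans hV', hV'o.inter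
      (isOpen_ne_fun l.continuous_of_finiteDimensional continuous_const), ?_, ?_⟩
    · by_contra hcon
      refine h0 l (mem_insert _ _) (AffineMap.eq_of_eqOn_isOpen hV'o hV'ne fun y hy => ?_)
      by_contra hy0
      exact hcon ⟨y, hy, hy0⟩
    · rintro y ⟨hy, hy'⟩ l' (rfl | hl')
      exacts [hy', h y hy l' hl']

/-- The nonzero signs of finitely many affine functionals are locally constant. -/
theorem eventually_affine_sign [FiniteDimensional ℝ E] {Λ : Set (E →ᵃ[ℝ] ℝ)} (hΛ : Λ.Finite)
    (x₀ : E) : ∀ᶠ y in 𝓝 x₀, ∀ l ∈ Λ, (0 < l x₀ → 0 < l y) ∧ (l x₀ < 0 → l y < 0) := by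
  rw [Filter.eventually_all_finite hΛ]
  intro l _
  have hl : Tendsto l (𝓝 x₀) (𝓝 (l x₀)) := l.continuous_of_finiteDimensional.tendsto x₀
  refine Filter.Eventually.and ?_ ?_
  · by_cases h0 : 0 < l x₀
    · exact (hl.eventually (lt_mem_nhds h0)).mono fun v hv _ => hv
    · exact Eventually.of_forall fun v hv => (h0 hv).elim
  · by_cases h0 : l x₀ < 0
    · exact (hl.eventually (gt_mem_nhds h0)).mono fun v hv _ => hv
    · exact Eventually.of_forall fun v hv => (h0 hv).elim

theorem AffineMap.apply_add (B : E →ᵃ[ℝ] F) (x v : E) : B (x + v) = B x + B.linear v := by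
  have := B.map_vadd x v
  simp only [vadd_eq_add] at this
  rw [add_comm, this, add_comm]

/-- The germ of a piecewise linear map at a point of a flat piece of its fixed point set is conic,
provided that the affine functionals that describe the map and vanish at the point vanish on the
piece. -/
theorem exists_isConicGerm_of_generic [FiniteDimensional ℝ E] {f : E → E} {T U R C : Set E}
    {L : Submodule ℝ E} (hC : IsConeMod C L) (hfc : ContinuousOn f T) {Λ : Set (E →ᵃ[ℝ] ℝ)}
    (hΛ : Λ.Finite) (hU : IsOpen U)
    (h : ∀ y ∈ T ∩ U, ∃ B : E →ᵃ[ℝ] E, ∀ z ∈ T ∩ U, (∀ l ∈ Λ, 0 ≤ l y → 0 ≤ l z) → f z = B z)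
    {x₀ : E} (hx₀ : x₀ ∈ U) (hL : ∀ l ∈ Λ, l x₀ = 0 → ∀ v ∈ L, l.linear v = 0)
    (hfix : ∀ᶠ v in 𝓝 (0 : E), v ∈ L → f (x₀ + v) = x₀ + v)
    (hTC : ∀ᶠ v in 𝓝 (0 : E), v ∈ C → x₀ + v ∈ T) (hTR : MapsTo f T R)
    (hRC : ∀ v, x₀ + v ∈ R → v ∈ C) : ∃ h, IsConicGerm f x₀ C L h := by
  have hnear : ∀ᶠ v in 𝓝 (0 : E), x₀ + v ∈ U ∧ (v ∈ C → x₀ + v ∈ T) ∧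
      (v ∈ L → f (x₀ + v) = x₀ + v) ∧
      ∀ l ∈ Λ, (0 < l x₀ → 0 < l (x₀ + v)) ∧ (l x₀ < 0 → l (x₀ + v) < 0) := by
    have hc := tendsto_const_add_nhds_zero x₀
    refine (hc.eventually (hU.mem_nhds hx₀)).and (hTC.and (hfix.and ?_))
    exact hc.eventually (eventually_affine_sign hΛ x₀)
  obtain ⟨δ, hδ, hball⟩ := Metric.eventually_nhds_iff.1 hnear
  simp only [dist_zero_right] at hball
  have h00 : f x₀ = x₀ := by simpa using (hball (y := 0) (by simpa using hδ)).2.2.1 L.zero_mem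
  -- Passing from v to a • v + l keeps the sign conditions: functionals that are nonzero at x₀ have
  -- constant sign nearby, and those that vanish there scale by a and do not see L. So one affine
  -- map serves all a and l.
  have hkey : ∀ v ∈ C, ‖v‖ < δ / 2 → ∃ B : E →ᵃ[ℝ] E, ∀ a : ℝ, 0 ≤ a → a ≤ 1 → ∀ l ∈ L,
      ‖l‖ < δ / 2 → f (x₀ + (a • v + l)) = B (x₀ + (a • v + l)) := by
    intro v hv hvδ
    have hb := hball (y := v) (by linarith)
    obtain ⟨B, hB⟩ := h (x₀ + v) ⟨hb.2.1 hv, hb.1⟩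
    refine ⟨B, fun a ha0 ha1 l hl hlδ => ?_⟩
    have hav : ‖a • v + l‖ < δ := by
      refine (norm_add_le _ _).trans_lt ?_
      rw [norm_smul, Real.norm_of_nonneg ha0]
      nlinarith [norm_nonneg v]
    have hb' := hball hav
    refine hB _ ⟨hb'.2.1 (hC.add_mem _ (hC.smul_mem a ha0 v hv) l hl), hb'.1⟩ fun m hm h0 => ?_
    rcases lt_trichotomy 0 (m x₀) with h1 | h1 | h1
    · exact ((hb'.2.2.2 m hm).1 h1).le
    · have e : ∀ w, m (x₀ + w) = m.linear w := fun w => by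
        rw [m.apply_add, ← h1, zero_add]
      rw [e] at h0 ⊢
      rw [map_add, hL m hm h1.symm l hl, add_zero, map_smul]
      exact mul_nonneg ha0 h0
    · exact absurd h0 ((hb.2.2.2 m hm).2 h1).not_ge
  have hkey' : ∀ v ∈ C, ‖v‖ < δ / 2 → ∃ A : E →ₗ[ℝ] E, ∀ a : ℝ, 0 ≤ a → a ≤ 1 → ∀ l ∈ L,
      ‖l‖ < δ / 2 → f (x₀ + (a • v + l)) = x₀ + (a • A v + l) := by
    intro v hv hvδ
    obtain ⟨B, hB⟩ := hkey v hv hvδ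
    have e : ∀ w, B (x₀ + w) = B x₀ + B.linear w := B.apply_add x₀
    -- At a = 0 the points lie on the piece fixed by f, which forces B to fix x₀ and its linear part
    -- to fix small vectors of L.
    have h1 : ∀ l ∈ L, ‖l‖ < δ / 2 → B (x₀ + l) = x₀ + l := fun l hl hlδ => by
      have h2 := hB 0 le_rfl zero_le_one l hl hlδ
      rw [zero_smul, zero_add, (hball (by linarith)).2.2.1 hl] at h2
      exact h2.symm
    have h2 : B x₀ = x₀ := by simpa using h1 0 L.zero_mem (by simpa using hδ)
    refine ⟨B.linear, fun a ha0 ha1 l hl hlδ => ?_⟩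
    rw [hB a ha0 ha1 l hl hlδ, e, h2, map_add, map_smul]
    have h3 := h1 l hl hlδ
    rw [e, h2] at h3
    rw [add_left_cancel h3]
  refine exists_isConicGerm hC (half_pos hδ) ?_ ?_ ?_ ?_
  · refine hfc.comp (continuous_const.add continuous_id).continuousOn fun v hv => ?_
    exact (hball (by have := hv.2; simp at this; linarith)).2.1 hv.1
  · intro v hv hvδ
    refine hRC _ ?_
    rw [add_sub_cancel]
    exact hTR ((hball (by linarith)).2.1 hv)
  · intro v hv hvδ a ha0 ha1
    obtain ⟨A, hA⟩ := hkey' v hv hvδ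
    have h1 := hA a ha0 ha1 0 L.zero_mem (by simpa using hδ)
    have h2 := hA 1 zero_le_one le_rfl 0 L.zero_mem (by simpa using hδ)
    simp only [add_zero, one_smul] at h1 h2
    rw [h1, h2]
    simp
  · intro v hv hvδ l hl hlδ
    obtain ⟨A, hA⟩ := hkey' v hv hvδ
    have h1 := hA 1 zero_le_one le_rfl l hl hlδ
    have h2 := hA 1 zero_le_one le_rfl 0 L.zero_mem (by simpa using hδ)
    simp only [add_zero, one_smul] at h1 h2
    rw [h1, h2, add_assoc]

end LocalPL

/-! ### Self-homeomorphisms read in a chart -/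

section Charts

variable {n : ℕ} [NeZero n] {M : Type*} [TopologicalSpace M]

/-- The self-homeomorphism `g` read in the chart `c`. -/
noncomputable def chartRep (c : OpenPartialHomeomorph M (EuclideanHalfSpace n)) (g : M ≃ₜ M) :
    EuclideanSpace ℝ (Fin n) → EuclideanSpace ℝ (Fin n) :=
  fun y => (𝓡∂ n) (c (g (c.symm ((𝓡∂ n).symm y))))

/-- The domain on which `g` can be read in the chart `c`. -/
def chartDom (c : OpenPartialHomeomorph M (EuclideanHalfSpace n)) (g : M ≃ₜ M) :
    Set (EuclideanSpace ℝ (Fin n)) :=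
  (𝓡∂ n).symm ⁻¹' (c.symm ≫ₕ g.toOpenPartialHomeomorph ≫ₕ c).source ∩ range (𝓡∂ n)

variable {c : OpenPartialHomeomorph M (EuclideanHalfSpace n)} {g g' : M ≃ₜ M}

theorem mem_chartDom {y : EuclideanSpace ℝ (Fin n)} : y ∈ chartDom c g ↔
    ((𝓡∂ n).symm y ∈ c.target ∧ g (c.symm ((𝓡∂ n).symm y)) ∈ c.source) ∧ y ∈ range (𝓡∂ n) := by
  simp [chartDom]

theorem chartRep_mapsTo (s : Set (EuclideanSpace ℝ (Fin n))) :
    MapsTo (chartRep c g) s (range (𝓡∂ n)) := fun _ _ => mem_range_self _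

theorem chartRep_apply {p : M} (hp : p ∈ c.source) :
    chartRep c g ((𝓡∂ n) (c p)) = (𝓡∂ n) (c (g p)) := by
  simp only [chartRep, ModelWithCorners.left_inv, c.left_inv hp]

theorem chartRep_mul {y : EuclideanSpace ℝ (Fin n)} (hy : y ∈ chartDom c g') :
    chartRep c (g * g') y = chartRep c g (chartRep c g' y) := by
  rw [mem_chartDom] at hy
  simp only [chartRep, Homeomorph.mul_apply, ModelWithCorners.left_inv, c.left_inv hy.1.2]

theorem chartRep_eq_self_iff {y : EuclideanSpace ℝ (Fin n)} (hy : y ∈ chartDom c g) :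
    chartRep c g y = y ↔ g (c.symm ((𝓡∂ n).symm y)) = c.symm ((𝓡∂ n).symm y) := by
  obtain ⟨⟨h1, h2⟩, z, rfl⟩ := mem_chartDom.1 hy
  simp only [ModelWithCorners.left_inv] at h1 h2
  simp only [chartRep, ModelWithCorners.left_inv]
  constructor
  · intro h
    have h3 := (𝓡∂ n).injective h
    rw [← c.left_inv h2, h3]
  · intro h
    rw [h, c.right_inv h1]

theorem chartRep_injOn : InjOn (chartRep c g) (chartDom c g) := by
  rintro y hy z hz h
  obtain ⟨⟨h1, h2⟩, y, rfl⟩ := mem_chartDom.1 hy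
  obtain ⟨⟨h3, h4⟩, z, rfl⟩ := mem_chartDom.1 hz
  simp only [ModelWithCorners.left_inv, chartRep] at h1 h2 h3 h4 h
  have h5 := g.injective (c.injOn h2 h4 ((𝓡∂ n).injective h))
  rw [c.symm.injOn h1 h3 h5]

theorem eventually_mem_chartDom {p : M} (hp : p ∈ c.source) (hg : g p ∈ c.source) :
    ∀ᶠ y in 𝓝 ((𝓡∂ n) (c p)), y ∈ range (𝓡∂ n) → y ∈ chartDom c g := by
  have ho : IsOpen ((𝓡∂ n).symm ⁻¹' (c.symm ≫ₕ g.toOpenPartialHomeomorph ≫ₕ c).source) :=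
    (OpenPartialHomeomorph.open_source _).preimage (𝓡∂ n).continuous_symm
  have hm : (𝓡∂ n) (c p) ∈ (𝓡∂ n).symm ⁻¹' (c.symm ≫ₕ g.toOpenPartialHomeomorph ≫ₕ c).source := by
    rw [mem_preimage, ModelWithCorners.left_inv]
    simp [hp, hg]
  filter_upwards [ho.mem_nhds hm] with y hy hyR
  exact ⟨hy, hyR⟩

theorem PLOrientation.Preserves.isPLOn_chartRep [ChartedSpace (EuclideanHalfSpace n) M] {o : PLOrientation n M} (hg : o.Preserves g)
    (hc : c ∈ o.charts) : IsPLOn (chartRep c g) (chartDom c g) ∧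
      PreservesOrientationOn (chartRep c g) (chartDom c g) :=
  (mem_groupoid_of_pregroupoid.1 (hg c hc c hc)).1

/-- The self-homeomorphisms that fix `p` and have conic germs at `p` in the chart `c`. -/
def conicSubgroup (c : OpenPartialHomeomorph M (EuclideanHalfSpace n)) {p : M} (hp : p ∈ c.source)
    {C : Set (EuclideanSpace ℝ (Fin n))} {L : Submodule ℝ (EuclideanSpace ℝ (Fin n))}
    (hC : IsConeMod C L) (hCR : ∀ᶠ v in 𝓝 0, v ∈ C → (𝓡∂ n) (c p) + v ∈ range (𝓡∂ n)) :
    Subgroup (M ≃ₜ M) :=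
  have hmul : ∀ {g g' : M ≃ₜ M}, g p = p → g' p = p →
      (∃ h, IsConicGerm (chartRep c g) ((𝓡∂ n) (c p)) C L h) →
      (∃ h, IsConicGerm (chartRep c g') ((𝓡∂ n) (c p)) C L h) →
      ∃ h, IsConicGerm (chartRep c (g * g')) ((𝓡∂ n) (c p)) C L h := by
    rintro g g' hg hg' ⟨h, hh⟩ ⟨h', hh'⟩
    refine ⟨h ∘ h', (hh.comp hC hh').congr ?_⟩
    have hd := eventually_mem_chartDom (g := g') hp (by rwa [hg'])
    filter_upwards [mem_nhdsWithin_of_mem_nhds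
      (((tendsto_const_add_nhds_zero _).eventually hd).and hCR), self_mem_nhdsWithin] with v hv hvC
    exact chartRep_mul (hv.1 (hv.2 hvC))
  -- Demanding conic germs of both g and g⁻¹ avoids inverting a conic germ.
  { carrier := {g | g p = p ∧ (∃ h, IsConicGerm (chartRep c g) ((𝓡∂ n) (c p)) C L h) ∧
      ∃ h, IsConicGerm (chartRep c g⁻¹) ((𝓡∂ n) (c p)) C L h}
    mul_mem' := by
      rintro g g' ⟨hg, h1, h2⟩ ⟨hg', h1', h2'⟩
      have e : g⁻¹ p = p := g.symm_apply_eq.2 hg.symm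
      have e' : g'⁻¹ p = p := g'.symm_apply_eq.2 hg'.symm
      refine ⟨by rw [Homeomorph.mul_apply, hg', hg], hmul hg hg' h1 h1', ?_⟩
      rw [mul_inv_rev]
      exact hmul e' e h2' h2
    one_mem' := by
      have h1 : IsConicGerm (chartRep c 1) ((𝓡∂ n) (c p)) C L id := by
        refine isConicGerm_id.congr ?_
        have hd := eventually_mem_chartDom (g := 1) hp (by simpa using hp)
        filter_upwards [mem_nhdsWithin_of_mem_nhds
          (((tendsto_const_add_nhds_zero _).eventually hd).and hCR), self_mem_nhdsWithin]
          with v hv hvC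
        exact (chartRep_eq_self_iff (hv.1 (hv.2 hvC))).2 rfl
      exact ⟨rfl, ⟨id, h1⟩, ⟨id, by rwa [inv_one]⟩⟩
    inv_mem' := by
      rintro g ⟨hg, h1, h2⟩
      exact ⟨g.symm_apply_eq.2 hg.symm, h2, by rwa [inv_inv]⟩ }

/-- The conic map of a germ is unique, so the chosen maps compose as the group elements do. `hCR`
keeps small vectors of C in the half-space, where chart representations can be composed. -/
theorem exists_isConeAction {p : M} (hp : p ∈ c.source)
    {C : Set (EuclideanSpace ℝ (Fin n))} {L : Submodule ℝ (EuclideanSpace ℝ (Fin n))}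
    (hC : IsConeMod C L) (hCR : ∀ᶠ v in 𝓝 0, v ∈ C → (𝓡∂ n) (c p) + v ∈ range (𝓡∂ n)) :
    ∃ h : (M ≃ₜ M) → EuclideanSpace ℝ (Fin n) → EuclideanSpace ℝ (Fin n),
      (∀ g ∈ conicSubgroup c hp hC hCR, IsConicGerm (chartRep c g) ((𝓡∂ n) (c p)) C L (h g)) ∧
      IsConeAction (conicSubgroup c hp hC hCR) C L h := by
  have hex : ∀ g ∈ conicSubgroup c hp hC hCR,
      ∃ h, IsConicGerm (chartRep c g) ((𝓡∂ n) (c p)) C L h := fun g hg => hg.2.1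
  choose! h hh using hex
  refine ⟨h, hh, ⟨?_, ?_, fun g hg => (hh g hg).mapsTo, fun g hg => (hh g hg).smul,
    fun g hg => (hh g hg).add⟩⟩
  · intro v hv
    refine (hh 1 (Subgroup.one_mem _)).eqOn hC (h' := id) (isConicGerm_id.congr ?_) hv
    have hd := eventually_mem_chartDom (g := 1) hp (by simpa using hp)
    filter_upwards [mem_nhdsWithin_of_mem_nhds
      (((tendsto_const_add_nhds_zero _).eventually hd).and hCR), self_mem_nhdsWithin]
      with v hv hvC
    exact (chartRep_eq_self_iff (hv.1 (hv.2 hvC))).2 rfl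
  · intro a ha b hb v hv
    refine (hh _ (Subgroup.mul_mem _ ha hb)).eqOn hC (h' := h a ∘ h b)
      (((hh a ha).comp hC (hh b hb)).congr ?_) hv
    have hd := eventually_mem_chartDom (g := b) hp (by rwa [hb.1])
    filter_upwards [mem_nhdsWithin_of_mem_nhds
      (((tendsto_const_add_nhds_zero _).eventually hd).and hCR), self_mem_nhdsWithin] with v hv hvC
    exact chartRep_mul (hv.1 (hv.2 hvC))

end Charts

/-! ### The frontier of the fixed point set -/

section Frontier

variable {E : Type*} [NormedAddCommGroup E] [NormedSpace ℝ E] [FiniteDimensional ℝ E]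

/-- On the way from an open set `Y` to a point outside, one can leave `Y` at a point at which only
one of finitely many hyperplanes is met. -/
theorem exists_exit_point {Λ : Set (E →ᵃ[ℝ] ℝ)} (hΛ : Λ.Finite) {O Y Z : Set E} (hO : Convex ℝ O)
    (hY : IsOpen Y) (hYO : Y ⊆ O) (hYne : Y.Nonempty) (hZ : IsOpen Z) (hZO : Z ⊆ O)
    (hZne : Z.Nonempty) (hd : Disjoint Y Z) :
    ∃ x₀ ∈ O, x₀ ∉ Y ∧ ∃ ν : E →ᵃ[ℝ] ℝ, ν x₀ = 0 ∧ (∃ᶠ y in 𝓝 x₀, y ∈ Y ∧ ν y < 0) ∧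
      ∀ l ∈ Λ, l x₀ = 0 → ∃ a : ℝ, l = a • ν := by
  obtain ⟨z, hzZ, hz⟩ := exists_forall_affine_ne_zero (Λ := {l ∈ Λ | l ≠ 0})
    (hΛ.subset (sep_subset _ _)) (fun l hl => hl.2) hZ hZne
  -- The combination l z • m - m z • l vanishes at z. If l and m both vanish at the exit point, it
  -- vanishes there too, hence on the whole line and at y. As y avoids the zeros of all nonzero
  -- combinations, l and m are proportional.
  set Λ' : Set (E →ᵃ[ℝ] ℝ) := {l ∈ Λ | l ≠ 0} ∪
    {m ∈ (fun q : (E →ᵃ[ℝ] ℝ) × (E →ᵃ[ℝ] ℝ) => q.1 z • q.2 - q.2 z • q.1) '' (Λ ×ˢ Λ) | m ≠ 0}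
    with hΛ'
  have hΛ'f : Λ'.Finite := (hΛ.subset (sep_subset _ _)).union
    (((hΛ.prod hΛ).image _).subset (sep_subset _ _))
  obtain ⟨y, hyY, hy⟩ := exists_forall_affine_ne_zero hΛ'f
    (by rintro l (hl | hl); exacts [hl.2, hl.2]) hY hYne
  set γ : ℝ →ᵃ[ℝ] E := AffineMap.lineMap y z with hγ
  have hγc : Continuous γ := γ.continuous_of_finiteDimensional
  have hγ0 : γ 0 = y := AffineMap.lineMap_apply_zero _ _
  have hγ1 : γ 1 = z := AffineMap.lineMap_apply_one _ _
  have hlγ : ∀ (l : E →ᵃ[ℝ] ℝ) (t : ℝ), l (γ t) = (1 - t) * l y + t * l z := by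
    intro l t
    have : l (γ t) = AffineMap.lineMap (l y) (l z) t := AffineMap.apply_lineMap _ _ _ _
    rw [this, AffineMap.lineMap_apply_module]
    simp
  have hzY : z ∉ Y := fun h => disjoint_left.1 hd h hzZ
  obtain ⟨t, ⟨⟨ht0, ht1⟩, htY⟩, hmin⟩ : ∃ t, IsLeast (Icc (0 : ℝ) 1 ∩ γ ⁻¹' Yᶜ) t :=
    (isCompact_Icc.inter_right (hY.isClosed_compl.preimage hγc)).exists_isLeast
      ⟨1, ⟨zero_le_one, le_rfl⟩, by simpa [hγ1] using hzY⟩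
  have htpos : 0 < t := by
    refine lt_of_le_of_ne ht0 ?_
    rintro rfl
    exact htY (by rwa [hγ0])
  have hlt : ∀ s, 0 ≤ s → s < t → γ s ∈ Y := by
    intro s hs0 hst
    by_contra h
    exact absurd (hmin ⟨⟨hs0, hst.le.trans ht1⟩, h⟩) hst.not_ge
  have hxO : γ t ∈ O := by
    have : γ t ∈ segment ℝ y z := by
      rw [segment_eq_image_lineMap]
      exact ⟨t, ⟨ht0, ht1⟩, rfl⟩
    exact hO.segment_subset (hYO hyY) (hZO hzZ) this
  have key : ∃ ν : E →ᵃ[ℝ] ℝ, ν (γ t) = 0 ∧ ν y < 0 ∧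
      ∀ l ∈ Λ, l (γ t) = 0 → ∃ a : ℝ, l = a • ν := by
    by_cases hex : ∃ l ∈ Λ, l ≠ 0 ∧ l (γ t) = 0
    · obtain ⟨l, hl, hl0, hlt0⟩ := hex
      have hlz : l z ≠ 0 := hz l ⟨hl, hl0⟩
      have hly : l y ≠ 0 := hy l (Or.inl ⟨hl, hl0⟩)
      have hmul : ∀ m ∈ Λ, m (γ t) = 0 → ∃ a : ℝ, m = a • l := by
        intro m hm hmt
        have h0 : l z • m - m z • l = 0 := by
          by_contra hne
          refine hy _ (Or.inr ⟨⟨(l, m), ⟨hl, hm⟩, rfl⟩, hne⟩) ?_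
          rw [hlγ] at hlt0 hmt
          have ht1' : 1 - t ≠ 0 := by
            intro h
            rw [h, zero_mul, zero_add] at hlt0
            rcases mul_eq_zero.1 hlt0 with h' | h'
            exacts [htpos.ne' h', hlz h']
          simp only [AffineMap.coe_sub, AffineMap.coe_smul, Pi.sub_apply, Pi.smul_apply,
            smul_eq_mul]
          apply mul_left_cancel₀ ht1'
          linear_combination (l z) * hmt - (m z) * hlt0
        refine ⟨(l z)⁻¹ * m z, ?_⟩
        rw [mul_smul, ← sub_eq_zero.1 h0, smul_smul, inv_mul_cancel₀ hlz, one_smul]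
      rcases lt_or_gt_of_ne hly with h | h
      · exact ⟨l, hlt0, h, hmul⟩
      · refine ⟨-l, by simp [hlt0], by simpa using h, fun m hm hmt => ?_⟩
        obtain ⟨a, ha⟩ := hmul m hm hmt
        exact ⟨-a, by simp [ha]⟩
    · push Not at hex
      have hne : γ t - y ≠ 0 := fun h => htY (by rw [sub_eq_zero.1 h]; exact hyY)
      obtain ⟨m, hm⟩ : ∃ m : Module.Dual ℝ E, m (γ t - y) ≠ 0 := by
        by_contra! hm
        exact hne ((Module.forall_dual_apply_eq_zero_iff ℝ _).1 hm)
      -- No wall passes through the exit point, so any hyperplane there separating off y will do;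
      -- the factor m (γ t - y) makes the value at y minus a square.
      refine ⟨(m (γ t - y)) • (m.toAffineMap - AffineMap.const ℝ E (m (γ t))), by simp, ?_, ?_⟩
      · have : m (γ t - y) • (m.toAffineMap - AffineMap.const ℝ E (m (γ t))) y =
          -(m (γ t - y) * m (γ t - y)) := by
          simp only [AffineMap.coe_sub, Pi.sub_apply, LinearMap.coe_toAffineMap,
            AffineMap.const_apply, smul_eq_mul, map_sub]
          ring
        rw [AffineMap.coe_smul, Pi.smul_apply, this]
        have := mul_self_pos.2 hm
        linarith
      · intro l hl hlt0
        refine ⟨0, ?_⟩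
        by_contra h
        rw [zero_smul] at h
        exact hex l hl h hlt0
  obtain ⟨ν, hν0, hνy, hν⟩ := key
  refine ⟨γ t, hxO, htY, ν, hν0, ?_, hν⟩
  have hlim : Tendsto γ (𝓝[<] t) (𝓝 (γ t)) := (hγc.tendsto t).mono_left nhdsWithin_le_nhds
  refine hlim.frequently (Eventually.frequently ?_)
  filter_upwards [self_mem_nhdsWithin, mem_nhdsWithin_of_mem_nhds (lt_mem_nhds htpos)] with s hs hs0
  have hs' : s < t := hs
  refine ⟨hlt s (le_of_lt hs0) hs', ?_⟩
  rw [hlγ] at hν0 ⊢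
  have h1 : 0 < t - s := by linarith
  have h2 : t * ((1 - s) * ν y + s * ν z) = (t - s) * ν y := by linear_combination s * hν0
  have h3 : t * ((1 - s) * ν y + s * ν z) < 0 := by
    rw [h2]; exact mul_neg_of_pos_of_neg h1 hνy
  exact neg_of_mul_neg_right h3 htpos.le

/-- A piecewise linear map that is the identity on an open set is, near an exit point of this set
as above, the identity on one side of a hyperplane and affine on the other side. -/
theorem exists_linear_at_exit_point {f : E → E} {Y N : Set E} {Λ : Set (E →ᵃ[ℝ] ℝ)}
    (hΛ : Λ.Finite) (hN : IsOpen N)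
    (h : ∀ y ∈ N, ∃ B : E →ᵃ[ℝ] E, ∀ z ∈ N, (∀ l ∈ Λ, 0 ≤ l y → 0 ≤ l z) → f z = B z)
    (hY : IsOpen Y) (hfY : ∀ y ∈ Y, f y = y) {x₀ : E} (hx₀ : x₀ ∈ N) {ν : E →ᵃ[ℝ] ℝ}
    (hν0 : ν x₀ = 0) (hν : ∃ᶠ y in 𝓝 x₀, y ∈ Y ∧ ν y < 0)
    (hΛν : ∀ l ∈ Λ, l x₀ = 0 → ∃ a : ℝ, l = a • ν) :
    ∃ A : E →ₗ[ℝ] E, (∀ v, ν.linear v = 0 → A v = v) ∧ ∀ᶠ v in 𝓝 (0 : E),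
      (ν.linear v ≤ 0 → f (x₀ + v) = x₀ + v) ∧ (0 ≤ ν.linear v → f (x₀ + v) = x₀ + A v) := by
  have hev : ∀ᶠ y in 𝓝 x₀, y ∈ N ∧ ∀ l ∈ Λ, (0 < l x₀ → 0 < l y) ∧ (l x₀ < 0 → l y < 0) :=
    (hN.eventually_mem hx₀).and (eventually_affine_sign hΛ x₀)
  obtain ⟨W, hW, hWo, hxW⟩ := eventually_nhds_iff.1 hev
  have hνx : ∀ v, ν (x₀ + v) = ν.linear v := fun v => by rw [ν.apply_add, hν0, zero_add]
  -- Near x₀ the only possible wall is ν = 0, so a closed side inherits the sign conditions of any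
  -- point strictly on that side.
  have hside : ∀ y ∈ W, ∀ z ∈ W, (ν y < 0 ∧ ν z ≤ 0 ∨ 0 < ν y ∧ 0 ≤ ν z) →
      ∀ l ∈ Λ, 0 ≤ l y → 0 ≤ l z := by
    intro y hy z hz hyz l hl hly
    rcases lt_trichotomy 0 (l x₀) with h1 | h1 | h1
    · exact (((hW z hz).2 l hl).1 h1).le
    · obtain ⟨a, rfl⟩ := hΛν l hl h1.symm
      simp only [AffineMap.coe_smul, Pi.smul_apply, smul_eq_mul] at hly ⊢
      rcases hyz with ⟨h2, h3⟩ | ⟨h2, h3⟩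
      · have : a ≤ 0 := by
          by_contra! ha
          exact absurd hly (mul_neg_of_pos_of_neg ha h2).not_ge
        exact mul_nonneg_of_nonpos_of_nonpos this h3
      · have : 0 ≤ a := nonneg_of_mul_nonneg_left hly h2
        exact mul_nonneg this h3
    · exact absurd hly (((hW y hy).2 l hl).2 h1).not_ge
  obtain ⟨y, ⟨hyY, hyν⟩, hyW⟩ := (hν.and_eventually (hWo.mem_nhds hxW)).exists
  have hneg : ∀ z ∈ W, ν z ≤ 0 → f z = z := by
    obtain ⟨B, hB⟩ := h y (hW y hyW).1
    have hBz : ∀ z ∈ W, ν z ≤ 0 → f z = B z := fun z hz hz0 =>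
      hB z (hW z hz).1 (hside y hyW z hz (Or.inl ⟨hyν, hz0⟩))
    have hBid : B = AffineMap.id ℝ E := by
      refine AffineMap.eq_of_eqOn_isOpen (W := W ∩ Y ∩ {z | ν z < 0})
        ((hWo.inter hY).inter (isOpen_lt ν.continuous_of_finiteDimensional continuous_const))
        ⟨y, ⟨hyW, hyY⟩, hyν⟩ ?_
      rintro z ⟨⟨hzW, hzY⟩, hz0⟩
      rw [← hBz z hzW (le_of_lt hz0), hfY z hzY]
      rfl
    intro z hz hz0
    rw [hBz z hz hz0, hBid]
    rfl
  have hW0 : ∀ᶠ v in 𝓝 (0 : E), x₀ + v ∈ W :=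
    (tendsto_const_add_nhds_zero x₀).eventually (hWo.mem_nhds hxW)
  have hsmall : ∀ v : E, ∀ᶠ a in 𝓝[>] (0 : ℝ), x₀ + a • v ∈ W := by
    intro v
    have : Tendsto (fun a : ℝ => a • v) (𝓝 0) (𝓝 ((0 : ℝ) • v)) :=
      (continuous_id.smul continuous_const).tendsto 0
    rw [zero_smul] at this
    exact (this.eventually hW0).filter_mono nhdsWithin_le_nhds
  obtain ⟨B, hB⟩ : ∃ B : E →ᵃ[ℝ] E, ∀ z ∈ W, 0 ≤ ν z → f z = B z := by
    -- Reflecting y in x₀ and shrinking gives a point of W strictly on the positive side.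
    obtain ⟨a, ha, ha0⟩ := ((hsmall (x₀ - y)).and self_mem_nhdsWithin).exists
    have ha0' : (0 : ℝ) < a := ha0
    have hpos : 0 < ν (x₀ + a • (x₀ - y)) := by
      have h1 := hνx (y - x₀)
      rw [add_sub_cancel] at h1
      have h2 : ν.linear (x₀ - y) = -ν y := by rw [h1, ← map_neg, neg_sub]
      rw [hνx, map_smul, h2, smul_eq_mul]
      exact mul_pos ha0' (by linarith)
    obtain ⟨B, hB⟩ := h _ (hW _ ha).1
    exact ⟨B, fun z hz hz0 => hB z (hW z hz).1 (hside _ ha z hz (Or.inr ⟨hpos, hz0⟩))⟩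
  have hBx : B x₀ = x₀ := by rw [← hB x₀ hxW hν0.ge, hneg x₀ hxW hν0.le]
  refine ⟨B.linear, fun v hv => ?_, ?_⟩
  · obtain ⟨a, ha, ha0⟩ := ((hsmall v).and self_mem_nhdsWithin).exists
    have ha0' : (0 : ℝ) < a := ha0
    have h1 : ν (x₀ + a • v) = 0 := by rw [hνx, map_smul, hv, smul_zero]
    have h2 := (hB _ ha h1.ge).symm.trans (hneg _ ha h1.le)
    rw [B.apply_add, hBx, map_smul] at h2
    exact smul_right_injective E ha0'.ne' (add_left_cancel h2)
  · filter_upwards [hW0] with v hv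
    refine ⟨fun h0 => hneg _ hv (by rwa [hνx]), fun h0 => ?_⟩
    rw [hB _ hv (by rwa [hνx]), B.apply_add, hBx]

/-- A map that is injective near `x₀`, the identity on one side of a hyperplane and linear on the
other one has a conic germ on the latter. -/
theorem isConicGerm_halfSpace {f : E → E} {T : Set E} {x₀ : E} (hT : ∀ᶠ v in 𝓝 (0 : E), x₀ + v ∈ T)
    (hf : InjOn f T) {ν : E →ₗ[ℝ] ℝ} {A : E →ₗ[ℝ] E} (hA : ∀ v, ν v = 0 → A v = v)
    (h : ∀ᶠ v in 𝓝 (0 : E), (ν v ≤ 0 → f (x₀ + v) = x₀ + v) ∧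
      (0 ≤ ν v → f (x₀ + v) = x₀ + A v)) :
    IsConicGerm f x₀ {v | 0 ≤ ν v} (LinearMap.ker ν) A where
  continuousOn := A.continuous_of_finiteDimensional.continuousOn
  mapsTo := by
    intro v hv
    have hv' : 0 ≤ ν v := hv
    -- If A v pointed strictly to the identity side, x₀ + a • v and x₀ + a • A v would have the same
    -- image for small a > 0. Injectivity gives A v = v, against the signs.
    by_contra hAv
    have hAv' : ν (A v) < 0 := not_le.1 hAv
    have hsmall : ∀ w : E, Tendsto (fun a : ℝ => a • w) (𝓝[>] 0) (𝓝 0) := by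
      intro w
      have : Tendsto (fun a : ℝ => a • w) (𝓝 0) (𝓝 ((0 : ℝ) • w)) :=
        (continuous_id.smul continuous_const).tendsto 0
      rw [zero_smul] at this
      exact this.mono_left nhdsWithin_le_nhds
    obtain ⟨a, ⟨⟨h1, h1'⟩, ⟨h2, h2'⟩⟩, ha0⟩ := ((((hsmall v).eventually (hT.and h)).and
      ((hsmall (A v)).eventually (hT.and h))).and self_mem_nhdsWithin).exists
    have ha : (0 : ℝ) < a := ha0
    have e1 := h1'.2 (by rw [map_smul]; exact mul_nonneg ha.le hv')
    have e2 := h2'.1 (by rw [map_smul]; exact (mul_neg_of_pos_of_neg ha hAv').le)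
    rw [map_smul] at e1
    have e3 := add_left_cancel (hf h1 h2 (e1.trans e2.symm))
    have e4 := smul_right_injective E ha.ne' e3
    rw [← e4] at hAv'
    linarith
  smul a _ v _ := map_smul A a v
  add v _ l hl := by rw [map_add, hA l (by simpa using hl)]
  eventually_eq := by
    filter_upwards [mem_nhdsWithin_of_mem_nhds h, self_mem_nhdsWithin] with v hv hv0
    exact hv.2 hv0

theorem isConeMod_halfSpace {E : Type*} [NormedAddCommGroup E] [NormedSpace ℝ E] (ν : E →ₗ[ℝ] ℝ) : IsConeMod {v | 0 ≤ ν v} (LinearMap.ker ν) where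
  zero_mem := by simp
  smul_mem a ha v hv := by
    have hv' : 0 ≤ ν v := hv
    simpa using mul_nonneg ha hv'
  add_mem v hv l hl := by
    have hl' : ν l = 0 := hl
    simpa [hl'] using hv

/-- A nontrivial conic action on a half-space yields a left-invariant preorder. -/
theorem IsConeAction.hasOrderFun_halfSpace {E : Type*} [NormedAddCommGroup E] [NormedSpace ℝ E]
    {G : Type*} [Group G] {H : Subgroup G} {ν : E →ₗ[ℝ] ℝ}
    {h : G → E → E} (hH : IsConeAction H {v | 0 ≤ ν v} (LinearMap.ker ν) h) {S : Set G}
    (hS : S ⊆ H) {s : G} (hs : s ∈ S) {v : E} (hv : 0 ≤ ν v) (hsv : h s v ≠ v) :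
    HasOrderFun S := by
  have hfix : ∀ g ∈ H, ∀ l, ν l = 0 → h g l = l := by
    intro g hg l hl
    have h1 := hH.add g hg 0 (by simp) l hl
    have h2 := hH.smul g hg 0 le_rfl 0 (by simp)
    rw [zero_smul, zero_smul] at h2
    rwa [h2, zero_add] at h1
  have hv0 : 0 < ν v := lt_of_le_of_ne hv fun h0 => hsv (hfix s (hS hs) v h0.symm)
  refine hH.hasOrderFun (isConeMod_halfSpace ν) hS hv (fun g hg => ?_) hs hsv
  have hpos : 0 < ν (h g v) := by
    refine lt_of_le_of_ne (hH.mapsTo g hg hv) fun h0 => ?_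
    have h1 := hH.mul g⁻¹ (H.inv_mem hg) g hg v hv
    rw [inv_mul_cancel, hH.one v hv, hfix _ (H.inv_mem hg) _ h0.symm] at h1
    rw [← h1] at h0
    exact hv0.ne h0
  -- The translation space has codimension one, so matching the values of ν leaves a remainder in
  -- it.
  refine ⟨ν (h g v) / ν v, div_pos hpos hv0, h g v - (ν (h g v) / ν v) • v, ?_, by simp⟩
  rw [LinearMap.mem_ker, map_sub, map_smul, smul_eq_mul, div_mul_cancel₀ _ hv0.ne', sub_self]

/-- An element is equivalent to 1 exactly when its inverse is. This permits symmetrizing S, as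
membership in `conicSubgroup` requires germs of inverses. -/
theorem HasOrderFun.of_inv {G : Type*} [Group G] {S : Set G} (h : HasOrderFun (S ∪ S⁻¹)) :
    HasOrderFun S := by
  obtain ⟨H, φ, hS, hφ, s, hs, hne⟩ := h
  refine ⟨H, φ, subset_union_left.trans hS, hφ, ?_⟩
  rcases hs with hs' | hs'
  · exact ⟨s, hs', hne⟩
  · refine ⟨s⁻¹, hs', fun he => hne ?_⟩
    have hsH : s ∈ H := hS (Or.inr hs')
    have := hφ.eq hsH (H.inv_mem hsH) H.one_mem he
    rw [mul_inv_cancel, mul_one] at this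
    exact this.symm

end Frontier

/-! ### Homeomorphisms that fix an open set -/

section FixedSet

variable {n : ℕ} [NeZero n] {M : Type*} [TopologicalSpace M]

/-- The points in the interior of the half-space and near that of `p` that represent points of an
open set with `p` in its closure. -/
theorem chart_inter_interior_nonempty {c : OpenPartialHomeomorph M (EuclideanHalfSpace n)} {p : M}
    (hp : p ∈ c.source) {N : Set (EuclideanSpace ℝ (Fin n))} (hN : IsOpen N)
    (hpN : (𝓡∂ n) (c p) ∈ N) {A : Set M} (hA : IsOpen A) (hpA : p ∈ closure A) :
    let W := N ∩ interior (range (𝓡∂ n)) ∩ (𝓡∂ n).symm ⁻¹' (c.target ∩ c.symm ⁻¹' A)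
    IsOpen W ∧ W.Nonempty := by
  intro W
  have hB : IsOpen ((𝓡∂ n).symm ⁻¹' (c.target ∩ c.symm ⁻¹' A)) :=
    (c.symm.isOpen_inter_preimage hA).preimage (𝓡∂ n).continuous_symm
  refine ⟨(hN.inter isOpen_interior).inter hB, ?_⟩
  have hO : IsOpen (c.source ∩ c ⁻¹' ((𝓡∂ n) ⁻¹' N)) :=
    c.isOpen_inter_preimage (hN.preimage (𝓡∂ n).continuous)
  obtain ⟨m, ⟨hm, hmN⟩, hmA⟩ := mem_closure_iff.1 hpA _ hO ⟨hp, hpN⟩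
  have h1 : (𝓡∂ n) (c m) ∈ closure (interior (range (𝓡∂ n))) :=
    (𝓡∂ n).range_subset_closure_interior (mem_range_self _)
  obtain ⟨y, ⟨hyN, hyB⟩, hy⟩ := mem_closure_iff.1 h1 _ (hN.inter hB) ⟨hmN, by
    rw [mem_preimage, ModelWithCorners.left_inv]
    exact ⟨c.map_source hm, by rwa [mem_preimage, c.left_inv hm]⟩⟩
  exact ⟨y, ⟨hyN, hy⟩, hyB⟩

variable [ChartedSpace (EuclideanHalfSpace n) M]

/-- By connectedness the interior of the common fixed set has a frontier point p. Near p, in a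
chart, there is an exit point x₀ at which all members of S are the identity on one side of a
hyperplane and linear on the other. If all the linear maps were trivial on that side, x₀ would be
interior to the fixed set; so the action on the half-space is nontrivial. -/
theorem hasOrderFun_of_fix_isOpen_aux [T2Space M] [ConnectedSpace M] {o : PLOrientation n M}
    {S : Set (M ≃ₜ M)} (hSf : S.Finite) (hSi : ∀ s ∈ S, s⁻¹ ∈ S) (hS : ∀ s ∈ S, o.Preserves s)
    (hne : ∃ s ∈ S, s ≠ 1) {O : Set M} (hO : IsOpen O) (hOne : O.Nonempty)
    (hfix : ∀ s ∈ S, ∀ x ∈ O, s x = x) : HasOrderFun S := by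
  set Fx : Set M := {x | ∀ s ∈ S, s x = x} with hFx
  have hFxc : IsClosed Fx := by
    have : Fx = ⋂ s ∈ S, {x | s x = x} := by ext; simp [hFx]
    rw [this]
    exact isClosed_biInter fun s _ => isClosed_eq s.continuous continuous_id
  have hint : (interior Fx).Nonempty := hOne.mono (interior_maximal (fun x hx s hs => hfix s hs x hx) hO)
  obtain ⟨p, hpc, hpi⟩ : ∃ p, p ∈ closure (interior Fx) ∧ p ∉ interior Fx := by
    by_contra! hcl
    have hcl' : IsClosed (interior Fx) := closure_subset_iff_isClosed.1 hcl
    rcases isClopen_iff.1 ⟨hcl', isOpen_interior⟩ with h | h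
    · rw [h] at hint; exact not_nonempty_empty hint
    · obtain ⟨s, hs, hs1⟩ := hne
      refine hs1 (Homeomorph.ext fun x => ?_)
      exact interior_subset (h ▸ mem_univ x : x ∈ interior Fx) s hs
  have hpF : p ∈ Fx := hFxc.closure_interior_subset hpc
  obtain ⟨c, hc, hp⟩ := o.cover p
  set x := (𝓡∂ n) (c p) with hx
  set R := range (𝓡∂ n) with hR
  have hPL : ∀ s ∈ S, IsPLOn (chartRep c s) (chartDom c s) := fun s hs =>
    ((hS s hs).isPLOn_chartRep hc).1
  have hdom : ∀ s ∈ S, ∀ᶠ y in 𝓝 x, y ∈ R → y ∈ chartDom c s := fun s hs =>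
    eventually_mem_chartDom hp (by rwa [hpF s hs])
  have hloc : ∀ s ∈ S, ∃ Λ : Set (EuclideanSpace ℝ (Fin n) →ᵃ[ℝ] ℝ), Λ.Finite ∧
      ∃ U : Set (EuclideanSpace ℝ (Fin n)), IsOpen U ∧ x ∈ U ∧ ∀ y ∈ chartDom c s ∩ U,
      ∃ B : EuclideanSpace ℝ (Fin n) →ᵃ[ℝ] EuclideanSpace ℝ (Fin n),
      ∀ z ∈ chartDom c s ∩ U, (∀ l ∈ Λ, 0 ≤ l y → 0 ≤ l z) → chartRep c s z = B z := fun s hs =>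
    (hPL s hs).exists_affine_of_sign ((hdom s hs).self_of_nhds (mem_range_self _))
  choose! Λ hΛ U hU hxU hB using hloc
  have hnear : ∀ᶠ y in 𝓝 x, ∀ s ∈ S, (y ∈ R → y ∈ chartDom c s) ∧ y ∈ U s := by
    rw [Filter.eventually_all_finite hSf]
    exact fun s hs => (hdom s hs).and ((hU s hs).mem_nhds (hxU s hs))
  obtain ⟨r, hr, hball⟩ := Metric.eventually_nhds_iff.1 hnear
  -- The exit point is sought in the interior of the half-space, since p itself may lie on the
  -- boundary.
  set N : Set (EuclideanSpace ℝ (Fin n)) := Metric.ball x r ∩ interior R with hN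
  have hNo : IsOpen N := Metric.isOpen_ball.inter isOpen_interior
  have hNc : Convex ℝ N := (convex_ball x r).inter (𝓡∂ n).convex_range.interior
  have hND : ∀ s ∈ S, N ⊆ chartDom c s ∩ U s := fun s hs y hy =>
    ⟨(hball hy.1 s hs).1 (interior_subset hy.2), (hball hy.1 s hs).2⟩
  have hxb : x ∈ Metric.ball x r := Metric.mem_ball_self hr
  set Y : Set (EuclideanSpace ℝ (Fin n)) := interior {y ∈ N | ∀ s ∈ S, chartRep c s y = y} with hY
  have hYN : Y ⊆ N := fun y hy => (interior_subset hy).1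
  have hYfix : ∀ s ∈ S, ∀ y ∈ Y, chartRep c s y = y := fun s hs y hy => (interior_subset hy).2 s hs
  have hYne : Y.Nonempty := by
    obtain ⟨h1, h2⟩ := chart_inter_interior_nonempty hp Metric.isOpen_ball hxb isOpen_interior hpc
    refine h2.mono (interior_maximal ?_ h1)
    rintro y ⟨hyN, -, hy⟩
    exact ⟨hyN, fun s hs => (chartRep_eq_self_iff (hND s hs hyN).1).2 (interior_subset hy s hs)⟩
  obtain ⟨hZo, hZne⟩ := chart_inter_interior_nonempty hp Metric.isOpen_ball hxb hFxc.isOpen_compl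
    (by rwa [closure_compl])
  obtain ⟨x₀, hx₀N, hx₀Y, ν, hν0, hν, hΛν⟩ := exists_exit_point (hSf.biUnion hΛ) hNc isOpen_interior
    hYN hYne hZo inter_subset_left hZne (by
      rw [disjoint_left]
      rintro y hy ⟨hyN, -, hy'⟩
      exact hy' fun s hs => (chartRep_eq_self_iff (hND s hs hyN).1).1 (hYfix s hs y hy))
  have hlin : ∀ s ∈ S, ∃ A : EuclideanSpace ℝ (Fin n) →ₗ[ℝ] EuclideanSpace ℝ (Fin n),
      (∀ v, ν.linear v = 0 → A v = v) ∧ ∀ᶠ v in 𝓝 (0 : EuclideanSpace ℝ (Fin n)),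
      (ν.linear v ≤ 0 → chartRep c s (x₀ + v) = x₀ + v) ∧
      (0 ≤ ν.linear v → chartRep c s (x₀ + v) = x₀ + A v) := by
    intro s hs
    refine exists_linear_at_exit_point (hΛ s hs) hNo (fun y hy => ?_) isOpen_interior
      (hYfix s hs) hx₀N hν0 hν fun l hl => hΛν l (mem_biUnion hs hl)
    obtain ⟨B, hB'⟩ := hB s hs y (hND s hs hy)
    exact ⟨B, fun z hz => hB' z (hND s hs hz)⟩
  choose! A hA hA' using hlin
  obtain ⟨m, hm⟩ := interior_subset hx₀N.2
  have hNx : ∀ᶠ v in 𝓝 (0 : EuclideanSpace ℝ (Fin n)), x₀ + v ∈ N :=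
    (tendsto_const_add_nhds_zero x₀).eventually (hNo.mem_nhds hx₀N)
  have hgerm : ∀ s ∈ S, IsConicGerm (chartRep c s) x₀ {v | 0 ≤ ν.linear v}
      (LinearMap.ker ν.linear) (A s) := fun s hs =>
    isConicGerm_halfSpace (hNx.mono fun v hv => (hND s hs hv).1) chartRep_injOn (hA s hs) (hA' s hs)
  obtain ⟨s, hs, v, hv, hsv⟩ : ∃ s ∈ S, ∃ v, 0 ≤ ν.linear v ∧ A s v ≠ v := by
    by_contra! hall
    refine hx₀Y (mem_interior_iff_mem_nhds.2 ?_)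
    have h1 : ∀ᶠ v in 𝓝 (0 : EuclideanSpace ℝ (Fin n)), x₀ + v ∈ N ∧
        ∀ s ∈ S, chartRep c s (x₀ + v) = x₀ + v := by
      refine hNx.and ((Filter.eventually_all_finite hSf).2 fun s hs => (hA' s hs).mono fun v hv => ?_)
      rcases le_total (ν.linear v) 0 with h0 | h0
      · exact hv.1 h0
      · rw [hv.2 h0, hall s hs v h0]
    have h2 : Tendsto (fun y => y - x₀) (𝓝 x₀) (𝓝 0) := by
      have : Tendsto (fun y => y - x₀) (𝓝 x₀) (𝓝 (x₀ - x₀)) :=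
        (continuous_id.sub continuous_const).tendsto x₀
      rwa [sub_self] at this
    filter_upwards [h2.eventually h1] with y hy
    simpa using hy
  have hx₀d := mem_chartDom.1 (hND s hs hx₀N).1
  rw [← hm, ModelWithCorners.left_inv] at hx₀d
  set q := c.symm m with hq
  have hqs : q ∈ c.source := c.map_target hx₀d.1.1
  have hqx : (𝓡∂ n) (c q) = x₀ := by rw [hq, c.right_inv hx₀d.1.1, hm]
  have hfixq : ∀ s ∈ S, s q = q := by
    intro s hs
    have h1 := (hA' s hs).self_of_nhds.1 (by simp)
    rw [add_zero, chartRep_eq_self_iff (hND s hs hx₀N).1, ← hm, ModelWithCorners.left_inv] at h1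
    exact h1
  have hCR : ∀ᶠ v in 𝓝 0, v ∈ {v | 0 ≤ ν.linear v} → (𝓡∂ n) (c q) + v ∈ range (𝓡∂ n) := by
    rw [hqx]
    exact hNx.mono fun v hv _ => interior_subset hv.2
  have hSH : S ⊆ conicSubgroup c hqs (isConeMod_halfSpace ν.linear) hCR := by
    intro t ht
    refine ⟨hfixq t ht, ⟨A t, ?_⟩, ⟨A t⁻¹, ?_⟩⟩
    · rw [hqx]; exact hgerm t ht
    · rw [hqx]; exact hgerm _ (hSi t ht)
  obtain ⟨h, hh, hact⟩ := exists_isConeAction hqs (isConeMod_halfSpace ν.linear) hCR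
  refine hact.hasOrderFun_halfSpace hSH hs hv ?_
  have h1 := hh s (hSH hs)
  rw [hqx] at h1
  rwa [h1.eqOn (isConeMod_halfSpace ν.linear) (hgerm s hs) hv]

/-- A finite set of piecewise linear self-homeomorphisms of a connected manifold that are not all
trivial but fix a nonempty open set pointwise generates a group with a nontrivial left-invariant
preorder. -/
theorem hasOrderFun_of_fix_isOpen [T2Space M] [ConnectedSpace M] {o : PLOrientation n M}
    {S : Set (M ≃ₜ M)} (hSf : S.Finite) (hS : ∀ s ∈ S, o.Preserves s) (hne : ∃ s ∈ S, s ≠ 1)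
    {O : Set M} (hO : IsOpen O) (hOne : O.Nonempty) (hfix : ∀ s ∈ S, ∀ x ∈ O, s x = x) :
    HasOrderFun S := by
  refine HasOrderFun.of_inv (hasOrderFun_of_fix_isOpen_aux (o := o) (hSf.union hSf.inv) ?_ ?_ ?_
    hO hOne ?_)
  · rintro s (hs | hs)
    · exact Or.inr (by simpa using hs)
    · exact Or.inl hs
  · rintro s (hs | hs)
    · exact hS s hs
    · simpa using o.preserves_closure.2.2 _ (hS _ hs)
  · obtain ⟨s, hs, h1⟩ := hne
    exact ⟨s, Or.inl hs, h1⟩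
  · rintro s (hs | hs) x hx
    · exact hfix s hs x hx
    · have h1 : s.symm x = x := hfix _ hs x hx
      exact (s.symm_apply_eq.1 h1).symm

end FixedSet

/-! ### Flat pieces of codimension two -/

section LinearAlgebra

variable {E : Type*} [AddCommGroup E] [Module ℝ E] [FiniteDimensional ℝ E]

/-- A functional m that kills L but not all of ker ν completes ν to coordinates (m, ν) on the
quotient by L. With ν as imaginary part, the half-space ν ≥ 0 becomes the preimage of the closed
upper half-plane. -/
theorem exists_proj_complex {L : Submodule ℝ E} (hL : Module.finrank ℝ L + 2 = Module.finrank ℝ E)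
    {ν : E →ₗ[ℝ] ℝ} (hν : ν ≠ 0) (hLν : L ≤ LinearMap.ker ν) :
    ∃ π : E →ₗ[ℝ] ℂ, Function.Surjective π ∧ LinearMap.ker π = L ∧ ∀ v, (π v).im = ν v := by
  have hνs : Function.Surjective ν := LinearMap.surjective hν
  have h1 := LinearMap.finrank_range_add_finrank_ker ν
  rw [LinearMap.range_eq_top.2 hνs, finrank_top, Module.finrank_self] at h1
  obtain ⟨v, hv, hvL⟩ : ∃ v ∈ LinearMap.ker ν, v ∉ L := by
    by_contra! h
    have := Submodule.finrank_mono (R := ℝ) (show LinearMap.ker ν ≤ L from h)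
    omega
  obtain ⟨m, hmv, hLm⟩ := Submodule.exists_le_ker_of_notMem hvL
  obtain ⟨u, hu⟩ := hνs 1
  have hv' : ν v = 0 := hv
  let π : E →ₗ[ℝ] ℂ := Complex.equivRealProdLm.symm.toLinearMap ∘ₗ m.prod ν
  have hπ : ∀ x, π x = ⟨m x, ν x⟩ := fun x => rfl
  have hπs : Function.Surjective π := by
    intro z
    refine ⟨z.im • u + ((z.re - z.im * m u) / m v) • v, ?_⟩
    rw [hπ]
    apply Complex.ext
    · simp [hmv]
    · simp [hu, hv']
  refine ⟨π, hπs, ?_, fun v => by rw [hπ]⟩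
  have h2 := LinearMap.finrank_range_add_finrank_ker π
  rw [LinearMap.range_eq_top.2 hπs, finrank_top, Complex.finrank_real_complex] at h2
  refine (Submodule.eq_of_le_of_finrank_eq ?_ (by omega)).symm
  intro l hl
  have e1 : m l = 0 := hLm hl
  have e2 : ν l = 0 := hLν hl
  rw [LinearMap.mem_ker, hπ, e1, e2]
  rfl

/-- A is block triangular: the identity on ker π, and B on the quotient. -/
theorem det_eq_of_fix_ker {V : Type*} [AddCommGroup V] [Module ℝ V] {π : E →ₗ[ℝ] V}
    (hπ : Function.Surjective π) {A : E →ₗ[ℝ] E} (hA : ∀ l ∈ LinearMap.ker π, A l = l)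
    {B : V →ₗ[ℝ] V} (hB : ∀ v, B (π v) = π (A v)) : LinearMap.det A = LinearMap.det B := by
  have hle : LinearMap.ker π ≤ (LinearMap.ker π).comap A := fun l hl => by
    rw [Submodule.mem_comap, hA l hl]; exact hl
  rw [LinearMap.det_eq_det_mul_det (LinearMap.ker π) A hle]
  have h1 : A.restrict hle = LinearMap.id := by
    ext l
    exact hA l l.2
  rw [h1, LinearMap.det_id, one_mul, ← LinearMap.det_conj _ (π.quotKerEquivOfSurjective hπ)]
  congr 1
  refine LinearMap.ext fun z => ?_
  obtain ⟨v, rfl⟩ := hπ z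
  have h2 : (π.quotKerEquivOfSurjective hπ).symm (π v) = Submodule.Quotient.mk v := by
    rw [LinearEquiv.symm_apply_eq]
    rfl
  simp only [LinearMap.comp_apply, LinearEquiv.coe_coe, h2, hB]
  rfl

end LinearAlgebra

section Pieces

variable {k : ℕ} {M : Type*} [TopologicalSpace M] [ChartedSpace (EuclideanHalfSpace (k + 2)) M]

/-- Moving along (1, …, 1) leaves the boundary of the half-space. Flat pieces of a submanifold can
thus be sought away from its boundary. -/
theorem halfSpaceSet_exists_open {k : ℕ} {O : Set (EuclideanSpace ℝ (Fin k))} (hO : IsOpen O)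
    (hne : (O ∩ halfSpaceSet k).Nonempty) :
    ∃ W ⊆ O ∩ halfSpaceSet k, IsOpen W ∧ W.Nonempty := by
  obtain ⟨y, hyO, hy⟩ := hne
  refine ⟨O ∩ {y | ∀ i : Fin k, (i : ℕ) = 0 → 0 < y i}, ?_, ?_, ?_⟩
  · exact fun z hz => ⟨hz.1, fun i hi => (hz.2 i hi).le⟩
  · refine hO.inter ?_
    have : {y : EuclideanSpace ℝ (Fin k) | ∀ i : Fin k, (i : ℕ) = 0 → 0 < y i} =
        ⋂ i : Fin k, ⋂ _ : (i : ℕ) = 0, {y | 0 < y i} := by ext; simp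
    rw [this]
    exact isOpen_iInter_of_finite fun i => isOpen_iInter_of_finite fun _ =>
      isOpen_lt continuous_const (by fun_prop)
  · set u : EuclideanSpace ℝ (Fin k) := WithLp.toLp 2 fun _ => 1
    have hc : Tendsto (fun a : ℝ => y + a • u) (𝓝[>] 0) (𝓝 y) := by
      have : Tendsto (fun a : ℝ => y + a • u) (𝓝 0) (𝓝 (y + (0 : ℝ) • u)) :=
        (continuous_const.add (continuous_id.smul continuous_const)).tendsto 0
      rw [zero_smul, add_zero] at this
      exact this.mono_left nhdsWithin_le_nhds
    obtain ⟨a, ha, ha0⟩ := ((hc.eventually (hO.mem_nhds hyO)).and self_mem_nhdsWithin).exists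
    have ha0' : (0 : ℝ) < a := ha0
    refine ⟨_, ha, fun i hi => ?_⟩
    have := hy i hi
    simp only [PiLp.add_apply, PiLp.smul_apply, smul_eq_mul, u, mul_one]
    linarith

/-- A nonempty submanifold contains a flat piece, in a chart of any oriented atlas. -/
theorem IsPLSubmanifold.exists_flat_piece {K : Set M} (hK : IsPLSubmanifold (k + 2) k K)
    (hne : K.Nonempty) (o : PLOrientation (k + 2) M) :
    ∃ c ∈ o.charts, ∃ A : EuclideanSpace ℝ (Fin k) →ᵃ[ℝ] EuclideanSpace ℝ (Fin (k + 2)),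
      Function.Injective A.linear ∧ ∃ W : Set (EuclideanSpace ℝ (Fin k)), IsOpen W ∧ W.Nonempty ∧
        ∀ w ∈ W, ∃ q ∈ K, q ∈ c.source ∧ (𝓡∂ (k + 2)) (c q) = A w := by
  obtain ⟨x, hx⟩ := hne
  obtain ⟨V, j, ⟨O, hO, rfl⟩, hj, ⟨U, -, hxU, hjU⟩, hjPL⟩ := hK x hx
  have hVne : (O ∩ halfSpaceSet k).Nonempty := by
    have : x ∈ j '' (O ∩ halfSpaceSet k) := hjU ▸ ⟨hx, hxU⟩
    exact this.imp fun y hy => hy.1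
  obtain ⟨W₀, hW₀, hW₀o, y, hy⟩ := halfSpaceSet_exists_open hO hVne
  have hjc : ContinuousOn j (O ∩ halfSpaceSet k) := continuousOn_iff_continuous_domRestrict.2 hj.continuous
  obtain ⟨c, hc, hyc⟩ := o.cover (j y)
  set c₀ := chartAt (EuclideanHalfSpace (k + 2)) (j y) with hc₀
  have hc₀a : c₀ ∈ atlas (EuclideanHalfSpace (k + 2)) M := chart_mem_atlas _ _
  set W₁ := W₀ ∩ j ⁻¹' (c.source ∩ c₀.source) with hW₁
  have hW₁o : IsOpen W₁ := (hjc.mono hW₀).isOpen_inter_preimage hW₀o (c.open_source.inter c₀.open_source)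
  -- The embedding is known to be PL in charts of the atlas, whereas an oriented chart lies only in
  -- the maximal atlas; the transition map bridges the two.
  have htrans : IsPLOn ((𝓡∂ (k + 2)) ∘ (c₀.symm ≫ₕ c) ∘ (𝓡∂ (k + 2)).symm)
      ((𝓡∂ (k + 2)).symm ⁻¹' (c₀.symm ≫ₕ c).source ∩ range (𝓡∂ (k + 2))) := by
    have := (mem_maximalAtlas_iff.1 (o.subset_maximalAtlas hc) c₀ hc₀a).2
    exact (mem_groupoid_of_pregroupoid.1 this).1
  have hPL : IsPLOn (fun y => (𝓡∂ (k + 2)) (c (j y))) W₁ := by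
    have h1 : IsPLOn (fun y => (𝓡∂ (k + 2)) (c₀ (j y))) W₁ :=
      (hjPL c₀ hc₀a).mono fun z hz => ⟨hW₀ hz.1, hz.2.2⟩
    refine (htrans.comp h1 ?_).congr ?_
    · intro z hz
      refine ⟨?_, mem_range_self _⟩
      rw [mem_preimage, ModelWithCorners.left_inv]
      simp [hz.2.1, hz.2.2]
    · intro z hz
      simp only [Function.comp, ModelWithCorners.left_inv, OpenPartialHomeomorph.coe_trans,
        c₀.left_inv hz.2.2]
  obtain ⟨W, hW, hWo, hWne, A, hA⟩ := hPL.exists_affine hW₁o ⟨y, hy, hyc, mem_chart_source _ _⟩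
  refine ⟨c, hc, A, ?_, W, hWo, hWne, ?_⟩
  · have hinj : InjOn A W := by
      intro z hz z' hz' h
      rw [← hA hz, ← hA hz'] at h
      have h1 := c.injOn (hW hz).2.1 (hW hz').2.1 ((𝓡∂ (k + 2)).injective h)
      have h2 := hj.injective (a₁ := ⟨z, hW₀ (hW hz).1⟩) (a₂ := ⟨z', hW₀ (hW hz').1⟩) h1
      exact congrArg Subtype.val h2
    obtain ⟨w, hw⟩ := hWne
    rw [injective_iff_map_eq_zero]
    intro u hu
    have hc' : Tendsto (fun a : ℝ => w + a • u) (𝓝[>] 0) (𝓝 w) := by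
      have : Tendsto (fun a : ℝ => w + a • u) (𝓝 0) (𝓝 (w + (0 : ℝ) • u)) :=
        (continuous_const.add (continuous_id.smul continuous_const)).tendsto 0
      rw [zero_smul, add_zero] at this
      exact this.mono_left nhdsWithin_le_nhds
    obtain ⟨a, ha, ha0⟩ := ((hc'.eventually (hWo.mem_nhds hw)).and self_mem_nhdsWithin).exists
    have ha0' : (0 : ℝ) < a := ha0
    have h1 := hinj ha hw (by rw [A.apply_add, map_smul, hu, smul_zero, add_zero])
    rw [add_eq_left] at h1
    exact (smul_eq_zero.1 h1).resolve_left ha0'.ne'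
  · intro w hw
    refine ⟨j w, ?_, (hW hw).2.1, hA hw⟩
    have : j w ∈ j '' (O ∩ halfSpaceSet k) := ⟨w, hW₀ (hW hw).1, rfl⟩
    rw [hjU] at this
    exact this.1

/-- Finitely many piecewise linear homeomorphisms that fix a submanifold of codimension two have
conic germs at some point of it. -/
theorem exists_subset_conicSubgroup {K : Set M} (hK : IsPLSubmanifold (k + 2) k K)
    (hne : K.Nonempty) (o : PLOrientation (k + 2) M) {S : Set (M ≃ₜ M)} (hSf : S.Finite)
    (hSi : ∀ s ∈ S, s⁻¹ ∈ S) (hSo : ∀ s ∈ S, o.Preserves s) (hSK : ∀ s ∈ S, ∀ x ∈ K, s x = x) :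
    ∃ c ∈ o.charts, ∃ (p : M) (hp : p ∈ c.source)
      (π : EuclideanSpace ℝ (Fin (k + 2)) →ₗ[ℝ] ℂ) (D : Set ℂ)
      (hC : IsConeMod (π ⁻¹' D) (LinearMap.ker π))
      (hCR : ∀ᶠ v in 𝓝 0, v ∈ π ⁻¹' D → (𝓡∂ (k + 2)) (c p) + v ∈ range (𝓡∂ (k + 2))),
      Function.Surjective π ∧ (D = univ ∨ D = {z | 0 ≤ z.im}) ∧
      (∀ v, (𝓡∂ (k + 2)) (c p) + v ∈ range (𝓡∂ (k + 2)) → v ∈ π ⁻¹' D) ∧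
      S ⊆ conicSubgroup c hp hC hCR := by
  obtain ⟨c, hc, A, hAi, W, hWo, ⟨w₁, hw₁⟩, hWK⟩ := hK.exists_flat_piece hne o
  refine ⟨c, hc, ?_⟩
  set R := range (𝓡∂ (k + 2)) with hR
  have hPL : ∀ s ∈ S, IsPLOn (chartRep c s) (chartDom c s) := fun s hs =>
    ((hSo s hs).isPLOn_chartRep hc).1
  have hdom : ∀ w ∈ W, ∀ s ∈ S, ∀ᶠ y in 𝓝 (A w), y ∈ R → y ∈ chartDom c s := by
    intro w hw s hs
    obtain ⟨q, hqK, hq, hqA⟩ := hWK w hw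
    rw [← hqA]
    exact eventually_mem_chartDom hq (by rwa [hSK s hs q hqK])
  have hAR : ∀ w ∈ W, A w ∈ R := fun w hw => by
    obtain ⟨q, -, -, hqA⟩ := hWK w hw
    exact ⟨_, hqA⟩
  have hloc : ∀ s ∈ S, ∃ Λ : Set (EuclideanSpace ℝ (Fin (k + 2)) →ᵃ[ℝ] ℝ), Λ.Finite ∧
      ∃ U : Set (EuclideanSpace ℝ (Fin (k + 2))), IsOpen U ∧ A w₁ ∈ U ∧ ∀ y ∈ chartDom c s ∩ U,
      ∃ B : EuclideanSpace ℝ (Fin (k + 2)) →ᵃ[ℝ] EuclideanSpace ℝ (Fin (k + 2)),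
      ∀ z ∈ chartDom c s ∩ U, (∀ l ∈ Λ, 0 ≤ l y → 0 ≤ l z) → chartRep c s z = B z := fun s hs =>
    (hPL s hs).exists_affine_of_sign ((hdom w₁ hw₁ s hs).self_of_nhds (hAR w₁ hw₁))
  choose! Λ hΛ U hU hxU hB using hloc
  have hAc : Continuous A := A.continuous_of_finiteDimensional
  set W' : Set (EuclideanSpace ℝ (Fin k)) := W ∩ A ⁻¹' (⋂ s ∈ S, U s) with hW'
  have hW'o : IsOpen W' := hWo.inter ((hSf.isOpen_biInter hU).preimage hAc)
  have hw₁W' : w₁ ∈ W' := ⟨hw₁, mem_iInter₂.2 hxU⟩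
  let ν₀ : EuclideanSpace ℝ (Fin (k + 2)) →ₗ[ℝ] ℝ := (EuclideanSpace.proj (0 : Fin (k + 2))).toLinearMap
  have hν₀ : ∀ v, ν₀ v = v 0 := fun v => rfl
  have hRν : ∀ v, v ∈ R ↔ 0 ≤ ν₀ v := fun v => by
    rw [hR, range_modelWithCornersEuclideanHalfSpace]
    rfl
  -- The boundary hyperplane counts as a wall, so at a generic point it is either missed or parallel
  -- to the flat piece.
  have hΛf : (insert ν₀.toAffineMap (⋃ s ∈ S, Λ s)).Finite := (hSf.biUnion hΛ).insert _
  -- Pullbacks along A that vanish identically are discarded, and w avoids the zeros of the others.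
  -- A wall through A w therefore contains all directions of the piece.
  obtain ⟨w, hw, hgen⟩ := exists_forall_affine_ne_zero
    (Λ := {l ∈ (fun l : EuclideanSpace ℝ (Fin (k + 2)) →ᵃ[ℝ] ℝ => l.comp A) ''
      insert ν₀.toAffineMap (⋃ s ∈ S, Λ s) | l ≠ 0})
    ((hΛf.image _).subset (sep_subset _ _)) (fun l hl => hl.2) hW'o ⟨w₁, hw₁W'⟩
  obtain ⟨p, hpK, hp, hpA⟩ := hWK w hw.1
  set L := LinearMap.range A.linear with hL
  have hfin : Module.finrank ℝ L + 2 = Module.finrank ℝ (EuclideanSpace ℝ (Fin (k + 2))) := by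
    rw [hL, LinearMap.finrank_range_of_inj hAi]
    simp
  have hvan : ∀ l ∈ insert ν₀.toAffineMap (⋃ s ∈ S, Λ s), l (A w) = 0 → ∀ v ∈ L, l.linear v = 0 := by
    intro l hl hl0 v hv
    obtain ⟨u, rfl⟩ := hv
    have h1 : l.comp A = 0 := by
      by_contra hne
      exact hgen _ ⟨⟨l, hl, rfl⟩, hne⟩ hl0
    have h2 : (l.comp A).linear u = 0 := by rw [h1]; rfl
    exact h2
  refine ⟨p, hp, ?_⟩
  simp only [hpA]
  have hcone : ∃ (π : EuclideanSpace ℝ (Fin (k + 2)) →ₗ[ℝ] ℂ) (D : Set ℂ),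
      Function.Surjective π ∧ LinearMap.ker π = L ∧ (D = univ ∨ D = {z | 0 ≤ z.im}) ∧
      (∀ᶠ v in 𝓝 0, v ∈ π ⁻¹' D → A w + v ∈ R) ∧ ∀ v, A w + v ∈ R → v ∈ π ⁻¹' D := by
    have h0 : 0 ≤ ν₀ (A w) := (hRν _).1 (hAR w hw.1)
    rcases h0.eq_or_lt with h0 | h0
    · have hLν : L ≤ LinearMap.ker ν₀ := fun v hv => hvan ν₀.toAffineMap (mem_insert _ _) h0.symm v hv
      have hν₀0 : ν₀ ≠ 0 := by
        intro h
        have := congrArg (fun f : EuclideanSpace ℝ (Fin (k + 2)) →ₗ[ℝ] ℝ =>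
          f (EuclideanSpace.single 0 1)) h
        simp [hν₀] at this
      obtain ⟨π, hπs, hπk, hπν⟩ := exists_proj_complex hfin hν₀0 hLν
      have hiff : ∀ v, A w + v ∈ R ↔ v ∈ π ⁻¹' {z | 0 ≤ z.im} := fun v => by
        rw [hRν, map_add, ← h0, zero_add, ← hπν]
        rfl
      exact ⟨π, {z | 0 ≤ z.im}, hπs, hπk, Or.inr rfl,
        Eventually.of_forall fun v => (hiff v).2, fun v => (hiff v).1⟩
    · obtain ⟨v, hv⟩ : ∃ v, v ∉ L := by
        by_contra! h
        rw [(Submodule.eq_top_iff').2 h, finrank_top] at hfin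
        omega
      obtain ⟨ν, hνv, hLν⟩ := Submodule.exists_le_ker_of_notMem hv
      obtain ⟨π, hπs, hπk, -⟩ := exists_proj_complex hfin (ν := ν) (by rintro rfl; simp at hνv) hLν
      refine ⟨π, univ, hπs, hπk, Or.inl rfl, ?_, fun v _ => mem_univ _⟩
      have h1 : ∀ᶠ y in 𝓝 (A w), 0 < ν₀ y :=
        (ν₀.continuous_of_finiteDimensional.tendsto _).eventually (lt_mem_nhds h0)
      filter_upwards [(tendsto_const_add_nhds_zero _).eventually h1] with v hv _
      exact (hRν _).2 hv.le
  obtain ⟨π, D, hπs, hπk, hD, hCR, hRC⟩ := hcone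
  have hC : IsConeMod (π ⁻¹' D) (LinearMap.ker π) := by
    rcases hD with rfl | rfl
    · exact ⟨mem_univ _, fun _ _ _ _ => mem_univ _, fun _ _ _ _ => mem_univ _⟩
    · refine ⟨by simp, fun a ha v hv => ?_, fun v hv l hl => ?_⟩
      · have hv' : 0 ≤ (π v).im := hv
        simpa using mul_nonneg ha hv'
      · have hl' : π l = 0 := hl
        simpa [hl'] using hv
  refine ⟨π, D, hC, hCR, hπs, hD, hRC, ?_⟩
  -- The left inverse turns small vectors of L into small parameters, so that w + σ v stays in W and
  -- A (w + σ v) represents a point of K.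
  obtain ⟨σ, hσ⟩ := A.linear.exists_leftInverse_of_injective (LinearMap.ker_eq_bot.2 hAi)
  have hσc : Tendsto (fun v => w + σ v) (𝓝 0) (𝓝 w) := by
    have : Tendsto (fun v => w + σ v) (𝓝 0) (𝓝 (w + σ 0)) :=
      (continuous_const.add σ.continuous_of_finiteDimensional).tendsto 0
    rwa [map_zero, add_zero] at this
  have hgerm : ∀ s ∈ S, ∃ h, IsConicGerm (chartRep c s) (A w) (π ⁻¹' D) (LinearMap.ker π) h := by
    intro s hs
    refine exists_isConicGerm_of_generic hC (hPL s hs).1 (hΛ s hs) (hU s hs) (hB s hs)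
      (mem_iInter₂.1 hw.2 s hs) ?_ ?_ ?_ (chartRep_mapsTo _) hRC
    · intro l hl hl0 v hv
      rw [hπk] at hv
      exact hvan l (mem_insert_of_mem _ (mem_biUnion hs hl)) hl0 v hv
    · filter_upwards [hσc.eventually (hWo.mem_nhds hw.1)] with v hv hvL
      rw [hπk] at hvL
      obtain ⟨u, rfl⟩ := hvL
      have h1 : σ (A.linear u) = u := LinearMap.congr_fun hσ u
      rw [h1] at hv
      obtain ⟨q, hqK, hq, hqA⟩ := hWK _ hv
      rw [← A.apply_add, ← hqA, chartRep_apply hq, hSK s hs q hqK]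
    · filter_upwards [hCR, (tendsto_const_add_nhds_zero _).eventually (hdom w hw.1 s hs)]
        with v h1 h2 h3
      exact h2 (h1 h3)
  intro s hs
  refine ⟨hSK s hs p hpK, ?_, ?_⟩
  · rw [hpA]; exact hgerm s hs
  · rw [hpA]; exact hgerm _ (hSi s hs)

end Pieces

/-! ### The action on the circle of rays -/

section PlaneAction

theorem exists_smul_of_arg_eq {u v : ℂ} (hu : u ≠ 0) (hv : v ≠ 0) (h : u.arg = v.arg) :
    ∃ a : ℝ, 0 < a ∧ u = a • v := by
  have hv' := norm_pos_iff.2 hv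
  refine ⟨‖u‖ / ‖v‖, div_pos (norm_pos_iff.2 hu) hv', ?_⟩
  rw [← Complex.norm_mul_exp_arg_mul_I u, ← Complex.norm_mul_exp_arg_mul_I v, h]
  simp only [norm_mul, Complex.norm_real, norm_norm, Complex.norm_exp_ofReal_mul_I, mul_one,
    Complex.real_smul, Complex.ofReal_div]
  have : (‖v‖ : ℂ) ≠ 0 := by exact_mod_cast hv'.ne'
  field_simp

variable {G : Type*} [Group G] {H : Subgroup G} {D : Set ℂ} {k : G → ℂ → ℂ}

theorem IsConeAction.map_zero {E : Type*} [NormedAddCommGroup E] [NormedSpace ℝ E] {C : Set E}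
    {L : Submodule ℝ E} {h : G → E → E} (hC : IsConeMod C L) (hH : IsConeAction H C L h) {g : G}
    (hg : g ∈ H) : h g 0 = 0 := by
  simpa using hH.smul g hg 0 le_rfl 0 hC.zero_mem

theorem IsConeAction.mono {E : Type*} [NormedAddCommGroup E] [NormedSpace ℝ E] {C : Set E}
    {L : Submodule ℝ E} {h : G → E → E} (hH : IsConeAction H C L h) {H' : Subgroup G}
    (hle : H' ≤ H) : IsConeAction H' C L h where
  one := hH.one
  mul a ha b hb := hH.mul a (hle ha) b (hle hb)
  mapsTo g hg := hH.mapsTo g (hle hg)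
  smul g hg := hH.smul g (hle hg)
  add g hg := hH.add g (hle hg)

theorem IsConeAction.inv_apply {E : Type*} [NormedAddCommGroup E] [NormedSpace ℝ E] {C : Set E}
    {L : Submodule ℝ E} {h : G → E → E} (hH : IsConeAction H C L h) {g : G}
    (hg : g ∈ H) {v : E} (hv : v ∈ C) : h g⁻¹ (h g v) = v := by
  rw [← hH.mul _ (H.inv_mem hg) _ hg v hv, inv_mul_cancel, hH.one v hv]

theorem IsConeAction.ne_zero (hD : IsConeMod D ⊥) (hk : IsConeAction H D ⊥ k) {g : G} (hg : g ∈ H)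
    {u : ℂ} (hu : u ∈ D) (hu0 : u ≠ 0) : k g u ≠ 0 := by
  intro h0
  have := hk.inv_apply hg hu
  rw [h0, hk.map_zero hD (H.inv_mem hg)] at this
  exact hu0 this.symm

theorem IsConeAction.arg_eq (hk : IsConeAction H D ⊥ k) {g : G} (hg : g ∈ H)
    {u v : ℂ} (hu : u ∈ D) (hv : v ∈ D) (hu0 : u ≠ 0) (hv0 : v ≠ 0) (h : u.arg = v.arg) :
    (k g u).arg = (k g v).arg := by
  obtain ⟨a, ha, rfl⟩ := exists_smul_of_arg_eq hu0 hv0 h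
  rw [hk.smul g hg a ha.le v hv]
  exact Complex.arg_real_mul _ ha

theorem IsConeAction.arg_injective (hD : IsConeMod D ⊥) (hk : IsConeAction H D ⊥ k) {g : G}
    (hg : g ∈ H) {u v : ℂ} (hu : u ∈ D) (hv : v ∈ D) (hu0 : u ≠ 0) (hv0 : v ≠ 0)
    (h : (k g u).arg = (k g v).arg) : u.arg = v.arg := by
  have := hk.arg_eq (H.inv_mem hg) (hk.mapsTo g hg hu) (hk.mapsTo g hg hv)
    (hk.ne_zero hD hg hu hu0) (hk.ne_zero hD hg hv hv0) h
  rwa [hk.inv_apply hg hu, hk.inv_apply hg hv] at this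

/-- A cone action that commutes with translations by the kernel of `π` descends along `π`. -/
theorem IsConeAction.proj {E : Type*} [NormedAddCommGroup E] [NormedSpace ℝ E] {h : G → E → E}
    {π : E →ₗ[ℝ] ℂ} {σ : ℂ →ₗ[ℝ] E} (hσ : ∀ u, π (σ u) = u)
    (hH : IsConeAction H (π ⁻¹' D) (LinearMap.ker π) h) :
    (∀ g ∈ H, ∀ v ∈ π ⁻¹' D, π (h g (σ (π v))) = π (h g v)) ∧
      IsConeAction H D ⊥ fun g u => π (h g (σ u)) := by
  have hσD : ∀ u ∈ D, σ u ∈ π ⁻¹' D := fun u hu => by rwa [mem_preimage, hσ]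
  have key : ∀ g ∈ H, ∀ v ∈ π ⁻¹' D, π (h g (σ (π v))) = π (h g v) := by
    intro g hg v hv
    have hl : σ (π v) - v ∈ LinearMap.ker π := by rw [LinearMap.mem_ker, map_sub, hσ, sub_self]
    have := hH.add g hg v hv _ hl
    rw [add_sub_cancel] at this
    rw [this, _root_.map_add, LinearMap.mem_ker.1 hl, add_zero]
  refine ⟨key, ⟨fun u hu => ?_, fun a ha b hb u hu => ?_, fun g hg u hu => ?_,
    fun g hg a ha u hu => ?_, fun g hg u hu l hl => ?_⟩⟩
  · rw [hH.one _ (hσD u hu), hσ]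
  · rw [hH.mul a ha b hb _ (hσD u hu), key a ha _ (hH.mapsTo b hb (hσD u hu))]
  · exact hH.mapsTo g hg (hσD u hu)
  · rw [_root_.map_smul, hH.smul g hg a ha _ (hσD u hu), _root_.map_smul]
  · rw [Submodule.mem_bot] at hl
    simp [hl]

/-- A homeomorphism that preserves the circular order of rays and fixes the ray of `-1` preserves
the linear order of arguments. -/
theorem IsConeAction.arg_mono (hk : IsConeAction H D ⊥ k)
    {g : G} (hg : g ∈ H) (h1 : (-1 : ℂ) ∈ D) (hg1 : (k g (-1)).arg = Real.pi)
    (hcyc : ∀ u ∈ D, ∀ v ∈ D, ∀ w ∈ D, u ≠ 0 → v ≠ 0 → w ≠ 0 →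
      cycSign (k g u).arg (k g v).arg (k g w).arg = cycSign u.arg v.arg w.arg)
    {u v : ℂ} (hu : u ∈ D) (hv : v ∈ D) (hu0 : u ≠ 0) (hv0 : v ≠ 0) (huv : u.arg ≤ v.arg) :
    (k g u).arg ≤ (k g v).arg := by
  rcases huv.eq_or_lt with he | hlt
  · exact (hk.arg_eq hg hu hv hu0 hv0 he).le
  · have h10 : (-1 : ℂ) ≠ 0 := by simp
    -- Since π is the largest argument, the fixed ray of -1 plays the role of a maximum, and the
    -- circular order of u, v and -1 decides between u and v.
    rcases v.arg_le_pi.eq_or_lt with he | hlt'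
    · rw [hk.arg_eq hg hv h1 hv0 h10 (he.trans Complex.arg_neg_one.symm), hg1]
      exact Complex.arg_le_pi _
    · have h2 := hcyc u hu v hv (-1) h1 hu0 hv0 h10
      rw [hg1, Complex.arg_neg_one, cycSign_of_lt hlt hlt'] at h2
      by_contra! hcon
      rcases (Complex.arg_le_pi (k g u)).eq_or_lt with he | hlt''
      · rw [he, ← cycSign_rotate, ← cycSign_rotate, cycSign_self_left] at h2
        omega
      · rw [cycSign_swap] at h2
        rw [cycSign_of_lt hcon hlt''] at h2
        omega

theorem isConeMod_bot_of_eq (hD : D = univ ∨ D = {z : ℂ | 0 ≤ z.im}) : IsConeMod D ⊥ := by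
  rcases hD with rfl | rfl
  · exact ⟨mem_univ _, fun _ _ _ _ => mem_univ _, fun _ _ _ _ => mem_univ _⟩
  · refine ⟨by simp, fun a ha v hv => ?_, fun v hv l hl => ?_⟩
    · have hv' : 0 ≤ v.im := hv
      simpa using mul_nonneg ha hv'
    · rw [Submodule.mem_bot] at hl
      simpa [hl] using hv

/-- In both cases the arguments fill an interval, all of (-π, π] or [0, π]. This lets the plane and
the half-plane be treated alike. -/
theorem exists_arg_range (hD : D = univ ∨ D = {z : ℂ | 0 ≤ z.im}) :
    ∃ J : Set ℝ, Convex ℝ J ∧ J ⊆ Ioc (-Real.pi) Real.pi ∧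
      (∀ θ ∈ J, Complex.exp (θ * Complex.I) ∈ D) ∧ ∀ u ∈ D, u ≠ 0 → u.arg ∈ J := by
  rcases hD with rfl | rfl
  · exact ⟨Ioc (-Real.pi) Real.pi, convex_Ioc _ _, subset_rfl, fun _ _ => mem_univ _,
      fun u _ _ => Complex.arg_mem_Ioc u⟩
  · refine ⟨Icc 0 Real.pi, convex_Icc _ _, fun θ hθ => ⟨by linarith [hθ.1, Real.pi_pos], hθ.2⟩,
      fun θ hθ => ?_, fun u hu _ => ⟨Complex.arg_nonneg_iff.2 hu, Complex.arg_le_pi u⟩⟩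
    rw [mem_ofPred_eq, Complex.exp_ofReal_mul_I_im]
    exact Real.sin_nonneg_of_nonneg_of_le_pi hθ.1 hθ.2

end PlaneAction

/-! ### Orientation and the transverse plane -/

section Orientation

/-- An orientation-preserving piecewise linear map with a conic germ is somewhere linear with
positive determinant on the plane of directions transverse to `ker π`. -/
theorem IsConicGerm.exists_linear {E : Type*} [NormedAddCommGroup E] [NormedSpace ℝ E]
    [FiniteDimensional ℝ E] {f h : E → E} {x₀ : E} {T R : Set E} {π : E →ₗ[ℝ] ℂ} {D : Set ℂ}
    (hf : IsConicGerm f x₀ (π ⁻¹' D) (LinearMap.ker π) h) (hπ : Function.Surjective π)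
    {σ : ℂ →ₗ[ℝ] E} (hσ : ∀ u, π (σ u) = u)
    (hk : ∀ v ∈ π ⁻¹' D, π (h (σ (π v))) = π (h v))
    (hPL : IsPLOn f T) (ho : PreservesOrientationOn f T)
    (hRC : ∀ v, x₀ + v ∈ R → v ∈ π ⁻¹' D) (hRT : ∀ᶠ y in 𝓝 x₀, y ∈ R → y ∈ T)
    (hx₀ : x₀ ∈ closure (interior R)) :
    ∃ (V : Set ℂ) (B : ℂ →ₗ[ℝ] ℂ), IsOpen V ∧ V.Nonempty ∧ V ⊆ D ∧ 0 < LinearMap.det B ∧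
      EqOn (fun u => π (h (σ u))) B V := by
  obtain ⟨N, hN, hNo, hxN⟩ := eventually_nhds_iff.1 hRT
  have hsub : Tendsto (fun y => y - x₀) (𝓝 x₀) (𝓝 0) := by
    have : Tendsto (fun y => y - x₀) (𝓝 x₀) (𝓝 (x₀ - x₀)) :=
      (continuous_id.sub continuous_const).tendsto x₀
    rwa [sub_self] at this
  obtain ⟨N', hN', hN'o, hxN'⟩ := eventually_nhds_iff.1
    (hsub.eventually (eventually_nhdsWithin_iff.1 hf.eventually_eq))
  have hO : IsOpen (N ∩ N' ∩ interior R) := (hNo.inter hN'o).inter isOpen_interior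
  have hOne : (N ∩ N' ∩ interior R).Nonempty :=
    mem_closure_iff.1 hx₀ _ (hNo.inter hN'o) ⟨hxN, hxN'⟩
  have hOT : N ∩ N' ∩ interior R ⊆ T := fun y hy => hN y hy.1.1 (interior_subset hy.2)
  obtain ⟨W, hW, hWo, ⟨y, hy⟩, A, hA⟩ := (hPL.mono hOT).exists_affine hO hOne
  have hdet := ho W hWo ⟨y, hy⟩ (hW.trans hOT) A hA
  set V₀ : Set E := {v | x₀ + v ∈ W} with hV₀
  have hV₀o : IsOpen V₀ := hWo.preimage (continuous_const.add continuous_id)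
  have hV₀C : ∀ v ∈ V₀, v ∈ π ⁻¹' D := fun v hv => hRC v (interior_subset (hW hv).2)
  set b := A x₀ - x₀ with hb
  have hhA : ∀ v ∈ V₀, h v = b + A.linear v := by
    intro v hv
    have h1 := hN' _ (hW hv).1.2
    simp only [add_sub_cancel_left] at h1
    have h2 := h1 (hV₀C v hv)
    rw [hA hv, A.apply_add] at h2
    rw [hb, sub_add_eq_add_sub, h2, add_sub_cancel_left]
  have hy0 : y - x₀ ∈ V₀ := by simpa [hV₀] using hy
  -- Positive homogeneity excludes a constant term: compare y - x₀ with a slightly larger multiple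
  -- of it.
  have hb0 : b = 0 := by
    have hc : Tendsto (fun a : ℝ => a • (y - x₀)) (𝓝[>] 1) (𝓝 (y - x₀)) := by
      have : Tendsto (fun a : ℝ => a • (y - x₀)) (𝓝 1) (𝓝 ((1 : ℝ) • (y - x₀))) :=
        (continuous_id.smul continuous_const).tendsto 1
      rw [one_smul] at this
      exact this.mono_left nhdsWithin_le_nhds
    obtain ⟨a, ha, ha1⟩ := ((hc.eventually (hV₀o.mem_nhds hy0)).and self_mem_nhdsWithin).exists
    have ha1' : (1 : ℝ) < a := ha1
    have h1 := hf.smul a (by linarith) _ (hV₀C _ hy0)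
    rw [hhA _ ha, hhA _ hy0, map_smul, smul_add, add_left_inj] at h1
    have h2 : (a - 1) • b = 0 := by rw [sub_smul, one_smul, ← h1, sub_self]
    exact (smul_eq_zero.1 h2).resolve_left (by linarith)
  simp only [hb0, zero_add] at hhA
  -- Commutation with translations by ker π makes the linear part the identity there, so that its
  -- determinant equals that of the induced map of the plane.
  have hfix : ∀ l ∈ LinearMap.ker π, A.linear l = l := by
    intro l hl
    have hc : Tendsto (fun a : ℝ => y - x₀ + a • l) (𝓝[>] 0) (𝓝 (y - x₀)) := by
      have : Tendsto (fun a : ℝ => y - x₀ + a • l) (𝓝 0) (𝓝 (y - x₀ + (0 : ℝ) • l)) :=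
        (continuous_const.add (continuous_id.smul continuous_const)).tendsto 0
      rw [zero_smul, add_zero] at this
      exact this.mono_left nhdsWithin_le_nhds
    obtain ⟨a, ha, ha0⟩ := ((hc.eventually (hV₀o.mem_nhds hy0)).and self_mem_nhdsWithin).exists
    have ha0' : (0 : ℝ) < a := ha0
    have h1 := hf.add _ (hV₀C _ hy0) _ ((LinearMap.ker π).smul_mem a hl)
    rw [hhA _ ha, hhA _ hy0, map_add, add_right_inj, map_smul] at h1
    exact smul_right_injective E ha0'.ne' h1
  have hB : ∀ v, (π ∘ₗ A.linear ∘ₗ σ) (π v) = π (A.linear v) := by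
    intro v
    have hl : σ (π v) - v ∈ LinearMap.ker π := by rw [LinearMap.mem_ker, map_sub, hσ, sub_self]
    have h1 := hfix _ hl
    have h2 : A.linear (σ (π v)) = A.linear v + (σ (π v) - v) := by
      rw [← h1, ← map_add, add_sub_cancel]
    simp only [LinearMap.comp_apply]
    rw [h2, map_add, LinearMap.mem_ker.1 hl, add_zero]
  refine ⟨π '' V₀, π ∘ₗ A.linear ∘ₗ σ, LinearMap.isOpenMap_of_finiteDimensional π hπ _ hV₀o,
    ⟨_, mem_image_of_mem _ hy0⟩, ?_, ?_, ?_⟩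
  · rintro _ ⟨v, hv, rfl⟩
    exact hV₀C v hv
  · rwa [← det_eq_of_fix_ker hπ hfix hB]
  · rintro _ ⟨v, hv, rfl⟩
    simp only [hB, hk v (hV₀C v hv), hhA v hv]

end Orientation

/-! ### Assembly of the circular order -/

section Main

/-- The set on which a finite set of homeomorphisms with trivial conic germs is trivial contains a
nonempty open set. -/
theorem exists_isOpen_fix {n : ℕ} [NeZero n] {M : Type*} [TopologicalSpace M]
    {c : OpenPartialHomeomorph M (EuclideanHalfSpace n)} {p : M} (hp : p ∈ c.source)
    {C : Set (EuclideanSpace ℝ (Fin n))}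
    (hRC : ∀ v, (𝓡∂ n) (c p) + v ∈ range (𝓡∂ n) → v ∈ C) {S : Set (M ≃ₜ M)} (hSf : S.Finite)
    (hSp : ∀ s ∈ S, s p = p)
    (hS : ∀ s ∈ S, ∀ᶠ v in 𝓝[C] 0, chartRep c s ((𝓡∂ n) (c p) + v) = (𝓡∂ n) (c p) + v) :
    ∃ O : Set M, IsOpen O ∧ O.Nonempty ∧ ∀ s ∈ S, ∀ x ∈ O, s x = x := by
  set x₀ := (𝓡∂ n) (c p) with hx₀
  have hsub : Tendsto (fun y => y - x₀) (𝓝 x₀) (𝓝 0) := by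
    have : Tendsto (fun y => y - x₀) (𝓝 x₀) (𝓝 (x₀ - x₀)) :=
      (continuous_id.sub continuous_const).tendsto x₀
    rwa [sub_self] at this
  have hev : ∀ᶠ y in 𝓝 x₀, ∀ s ∈ S, (y ∈ range (𝓡∂ n) → y ∈ chartDom c s) ∧
      (y - x₀ ∈ C → chartRep c s y = y) := by
    refine (Filter.eventually_all_finite hSf).2 fun s hs =>
      (eventually_mem_chartDom hp (by rwa [hSp s hs])).and ?_
    filter_upwards [hsub.eventually (eventually_nhdsWithin_iff.1 (hS s hs))] with y hy hyC
    simpa using hy hyC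
  obtain ⟨N, hN, hNo, hxN⟩ := eventually_nhds_iff.1 hev
  refine ⟨c.source ∩ c ⁻¹' ((𝓡∂ n) ⁻¹' N), c.isOpen_inter_preimage
    (hNo.preimage (𝓡∂ n).continuous), ⟨p, hp, hxN⟩, ?_⟩
  rintro s hs m ⟨hm, hmN⟩
  have h1 := hN _ hmN s hs
  have h2 := h1.2 (hRC _ (by rw [add_sub_cancel]; exact mem_range_self _))
  rw [chartRep_eq_self_iff (h1.1 (mem_range_self _)), ModelWithCorners.left_inv, c.left_inv hm] at h2
  exact h2

variable {k : ℕ} {M : Type*} [TopologicalSpace M] [ChartedSpace (EuclideanHalfSpace (k + 2)) M]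

/-- Finitely many orientation-preserving piecewise linear homeomorphisms that fix a submanifold of
codimension two generate a circularly orderable group. -/
theorem exists_isLeftCircularOrderOn_closure [T2Space M] [ConnectedSpace M] {K : Set M}
    (hK : IsPLSubmanifold (k + 2) k K) (hne : K.Nonempty) (o : PLOrientation (k + 2) M)
    {S : Set (M ≃ₜ M)} (hSf : S.Finite) (hSi : ∀ s ∈ S, s⁻¹ ∈ S) (hSo : ∀ s ∈ S, o.Preserves s)
    (hSK : ∀ s ∈ S, ∀ x ∈ K, s x = x) :
    ∃ e, IsLeftCircularOrderOn (Subgroup.closure S) e := by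
  obtain ⟨c, hc, p, hp, π, D, hC, hCR, hπs, hD, hRC, hSH⟩ :=
    exists_subset_conicSubgroup hK hne o hSf hSi hSo hSK
  obtain ⟨h, hh, hact'⟩ := exists_isConeAction hp hC hCR
  set Γ := Subgroup.closure S with hΓ
  have hΓH : Γ ≤ conicSubgroup c hp hC hCR := (Subgroup.closure_le _).2 hSH
  have hact : IsConeAction Γ (π ⁻¹' D) (LinearMap.ker π) h := hact'.mono hΓH
  have hΓo : ∀ g ∈ Γ, o.Preserves g := by
    intro g hg
    induction hg using Subgroup.closure_induction with
    | mem s hs => exact hSo s hs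
    | one => exact o.preserves_closure.1
    | mul a b _ _ ha hb => exact o.preserves_closure.2.1 a b ha hb
    | inv a _ ha => exact o.preserves_closure.2.2 a ha
  obtain ⟨σ, hσ'⟩ := π.exists_rightInverse_of_surjective (LinearMap.range_eq_top.2 hπs)
  have hσ : ∀ u, π (σ u) = u := fun u => LinearMap.congr_fun hσ' u
  obtain ⟨hkπ, hk⟩ := hact.proj hσ
  set κ : (M ≃ₜ M) → ℂ → ℂ := fun g u => π (h g (σ u)) with hκ
  have hDc := isConeMod_bot_of_eq hD
  have h10 : (-1 : ℂ) ≠ 0 := by simp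
  -- The base ray is that of -1: it lies in both possible cones, and its argument π is maximal.
  have h1D : (-1 : ℂ) ∈ D := by rcases hD with rfl | rfl <;> simp
  obtain ⟨J, hJc, hJ, hJD, hDJ⟩ := exists_arg_range hD
  have hcyc : ∀ g ∈ Γ, ∀ u ∈ D, ∀ v ∈ D, ∀ w ∈ D, u ≠ 0 → v ≠ 0 → w ≠ 0 →
      cycSign (κ g u).arg (κ g v).arg (κ g w).arg = cycSign u.arg v.arg w.arg := by
    intro g hg u hu v hv w hw hu0 hv0 hw0
    have hgp : g p = p := (hΓH hg).1
    obtain ⟨hPL, hor⟩ := (hΓo g hg).isPLOn_chartRep hc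
    obtain ⟨V, B, hV, hVne, hVD, hB, hkB⟩ := (hh g (hΓH hg)).exists_linear hπs hσ (hkπ g hg) hPL hor
      hRC (eventually_mem_chartDom hp (by rwa [hgp]))
      ((𝓡∂ (k + 2)).range_subset_closure_interior (mem_range_self _))
    refine cycSign_arg_map hJc hJ hJD hDJ ?_ (fun u hu hu0 => hk.ne_zero hDc hg hu hu0)
      (fun a ha u hu => hk.smul g hg a ha.le u hu)
      (fun u hu v hv hu0 hv0 => hk.arg_injective hDc hg hu hv hu0 hv0) hV hVne hVD hB hkB
      hu hv hw hu0 hv0 hw0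
    exact π.continuous_of_finiteDimensional.comp_continuousOn
      ((hh g (hΓH hg)).continuousOn.comp σ.continuous_of_finiteDimensional.continuousOn
        fun u hu => by rwa [mem_preimage, hσ])
  set Φ : (M ≃ₜ M) → ℝ := fun g => (κ g (-1)).arg with hΦ
  have hκD : ∀ g ∈ Γ, κ g (-1) ∈ D ∧ κ g (-1) ≠ 0 := fun g hg =>
    ⟨hk.mapsTo g hg h1D, hk.ne_zero hDc hg h1D h10⟩
  have hΦmul : ∀ g ∈ Γ, ∀ a ∈ Γ, Φ (g * a) = (κ g (κ a (-1))).arg := fun g hg a ha => by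
    rw [hΦ]
    dsimp only
    rw [hk.mul g hg a ha _ h1D]
  have hΦ1 : Φ 1 = Real.pi := by
    rw [hΦ]
    dsimp only
    rw [hk.one _ h1D, Complex.arg_neg_one]
  have hΦeq : ∀ g ∈ Γ, ∀ a ∈ Γ, ∀ b ∈ Γ, Φ a = Φ b → Φ (g * a) = Φ (g * b) := by
    intro g hg a ha b hb hab
    rw [hΦmul g hg a ha, hΦmul g hg b hb]
    exact hk.arg_eq hg (hκD a ha).1 (hκD b hb).1 (hκD a ha).2 (hκD b hb).2 hab
  let Z : Subgroup (M ≃ₜ M) :=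
    { carrier := {g | g ∈ Γ ∧ Φ g = Φ 1}
      mul_mem' := fun {a b} ha hb => ⟨Γ.mul_mem ha.1 hb.1, by
        have := hΦeq a ha.1 b hb.1 1 Γ.one_mem hb.2
        rw [mul_one] at this
        exact this.trans ha.2⟩
      one_mem' := ⟨Γ.one_mem, rfl⟩
      inv_mem' := fun {a} ha => ⟨Γ.inv_mem ha.1, by
        have := hΦeq a⁻¹ (Γ.inv_mem ha.1) a ha.1 1 Γ.one_mem ha.2
        rw [mul_one, inv_mul_cancel] at this
        exact this.symm⟩ }
  have hZ : ∀ g, g ∈ Z ↔ g ∈ Γ ∧ Φ g = Φ 1 := fun g => Iff.rfl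
  have hZLO : ∃ ζ, IsLeftOrderSign Z ζ := by
    refine exists_isLeftOrderSign fun T hTZ hTne hT1 => ?_
    have hTΓ : ∀ s ∈ T, s ∈ Γ := fun s hs => (hTZ hs).1
    -- If T moves a ray, cut the circle at the ray of -1, which Z fixes; the argument of the image
    -- of u then gives the preorder on Z.
    by_cases hmove : ∃ s ∈ T, ∃ u ∈ D, u ≠ 0 ∧ (κ s u).arg ≠ u.arg
    · obtain ⟨s, hs, u, hu, hu0, hsu⟩ := hmove
      refine ⟨Z, fun g => (κ g u).arg, hTZ, ?_, s, hs, ?_⟩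
      · intro a ha b hb d hd hbd
        dsimp only
        rw [hk.mul a ha.1 b hb.1 u hu, hk.mul a ha.1 d hd.1 u hu]
        exact hk.arg_mono ha.1 h1D (ha.2.trans hΦ1) (hcyc a ha.1) (hk.mapsTo b hb.1 hu)
          (hk.mapsTo d hd.1 hu) (hk.ne_zero hDc hb.1 hu hu0) (hk.ne_zero hDc hd.1 hu hu0) hbd
      · dsimp only
        rwa [hk.one u hu]
    push Not at hmove
    -- Now T fixes all rays. A vector v that it moves is not in ker π, and the stabilizer of the ray
    -- of π v sends v to a positive multiple of v modulo ker π.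
    by_cases hmove' : ∃ s ∈ T, ∃ v ∈ π ⁻¹' D, h s v ≠ v
    · obtain ⟨s, hs, v, hv, hsv⟩ := hmove'
      have hπv : π v ≠ 0 := by
        intro h0
        have h1 := hact.add s (hTΓ s hs) 0 hC.zero_mem v h0
        rw [hact.map_zero hC (hTΓ s hs), zero_add] at h1
        exact hsv h1
      let H : Subgroup (M ≃ₜ M) :=
        { carrier := {g | g ∈ Γ ∧ (κ g (π v)).arg = (π v).arg}
          mul_mem' := fun {a b} ha hb => ⟨Γ.mul_mem ha.1 hb.1, by
            rw [hk.mul a ha.1 b hb.1 _ hv, hk.arg_eq ha.1 (hk.mapsTo b hb.1 hv) hv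
              (hk.ne_zero hDc hb.1 hv hπv) hπv hb.2, ha.2]⟩
          one_mem' := ⟨Γ.one_mem, by rw [hk.one _ hv]⟩
          inv_mem' := fun {a} ha => ⟨Γ.inv_mem ha.1, by
            have := hk.arg_eq (Γ.inv_mem ha.1) (hk.mapsTo a ha.1 hv) hv
              (hk.ne_zero hDc ha.1 hv hπv) hπv ha.2
            rw [hk.inv_apply ha.1 hv] at this
            exact this.symm⟩ }
      have hHΓ : H ≤ Γ := fun g hg => hg.1
      refine (hact.mono hHΓ).hasOrderFun hC (S := (T : Set (M ≃ₜ M)))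
        (fun g hg => ⟨hTΓ g hg, hmove g hg _ hv hπv⟩) hv (fun g hg => ?_) hs hsv
      obtain ⟨a, ha, hav⟩ := exists_smul_of_arg_eq (hk.ne_zero hDc hg.1 hv hπv) hπv hg.2
      refine ⟨a, ha, h g v - a • v, ?_, by simp⟩
      rw [LinearMap.mem_ker, map_sub, map_smul, ← hkπ g hg.1 v hv, ← hav, sub_self]
    push Not at hmove'
    -- All germs of T at p are trivial, so T fixes an open set near p and the frontier of its fixed
    -- set takes over.
    obtain ⟨O, hO, hOne, hfix⟩ := exists_isOpen_fix hp hRC T.finite_toSet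
      (fun s hs => (hΓH (hTΓ s hs)).1) fun s hs => by
        filter_upwards [(hh s (hΓH (hTΓ s hs))).eventually_eq, self_mem_nhdsWithin] with v hv hvC
        rw [hv, hmove' s hs v hvC]
    obtain ⟨s, hs⟩ := hTne
    exact hasOrderFun_of_fix_isOpen (o := o) T.finite_toSet (fun s hs => hΓo s (hTΓ s hs))
      ⟨s, hs, fun h => hT1 (h ▸ hs)⟩ hO hOne hfix
  obtain ⟨ζ, hζ⟩ := hZLO
  refine exists_isLeftCircularOrderOn (Φ := Φ) ?_ hΦeq hZ hζ
  intro g hg a ha b hb d hd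
  rw [hΦmul g hg a ha, hΦmul g hg b hb, hΦmul g hg d hd]
  exact hcyc g hg _ (hκD a ha).1 _ (hκD b hb).1 _ (hκD d hd).1 (hκD a ha).2 (hκD b hb).2 (hκD d hd).2

end Main

/-- Finitely many group elements and their inverses generate a circularly orderable group of
homeomorphisms, whose order restricts to the subgroup they generate in `PLPlus o K`. Writing n = k +
2 encodes n ≥ 2 and avoids subtraction in the dimension of K. -/
theorem mainTheorem3 (k : ℕ) (M : Type*) [TopologicalSpace M] [T2Space M] [ConnectedSpace M]
    [ChartedSpace (EuclideanHalfSpace (k + 2)) M] [IsPLManifold (k + 2) M]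
    (o : PLOrientation (k + 2) M) (K : Set M) (hne : K.Nonempty) (hcl : IsClosed K)
    (hK : IsPLSubmanifold (k + 2) k K) :
    CircularlyOrderable (PLPlus o K) := by
  refine circularlyOrderable_of_finite fun S => ?_
  set T : Set (M ≃ₜ M) := (Subtype.val '' (S : Set (PLPlus o K))) with hT
  have hTf : T.Finite := S.finite_toSet.image _
  have hTP : ∀ s ∈ T ∪ T⁻¹, s ∈ PLPlus o K := by
    rintro s (⟨t, -, rfl⟩ | ⟨t, -, ht⟩)
    · exact t.2
    · rw [← inv_inv s, ← ht]
      exact (PLPlus o K).inv_mem t.2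
  obtain ⟨e, he⟩ := exists_isLeftCircularOrderOn_closure hK hne o (hTf.union hTf.inv)
    (by rintro s (hs | hs)
        · exact Or.inr (by simpa using hs)
        · exact Or.inl hs)
    (fun s hs => (hTP s hs).2.1) (fun s hs => (hTP s hs).2.2)
  have hmem : ∀ g ∈ Subgroup.closure (S : Set (PLPlus o K)),
      (g : M ≃ₜ M) ∈ Subgroup.closure (T ∪ T⁻¹) := by
    have : Subgroup.closure (S : Set (PLPlus o K)) ≤
        (Subgroup.closure (T ∪ T⁻¹)).comap (PLPlus o K).subtype :=
      (Subgroup.closure_le _).2 fun s hs => Subgroup.subset_closure (Or.inl ⟨s, hs, rfl⟩)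
    exact fun g hg => this hg
  refine ⟨fun a b c => e a b c, ⟨?_, ?_, ?_, ?_⟩⟩
  · intro a ha b hb c hc h1 h2 h3
    exact he.eq_one_or_neg_one _ (hmem a ha) _ (hmem b hb) _ (hmem c hc)
      (fun h => h1 (Subtype.ext h)) (fun h => h2 (Subtype.ext h)) fun h => h3 (Subtype.ext h)
  · intro a ha b hb c hc h
    exact he.eq_zero _ (hmem a ha) _ (hmem b hb) _ (hmem c hc)
      (h.imp (congrArg _) (Or.imp (congrArg _) (congrArg _)))
  · intro a ha b hb c hc d hd
    exact he.cocycle _ (hmem a ha) _ (hmem b hb) _ (hmem c hc) _ (hmem d hd)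
  · intro g hg a ha b hb c hc
    exact he.left_invariant _ (hmem g hg) _ (hmem a ha) _ (hmem b hb) _ (hmem c hc)
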